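/- **Setting.** Let $H\in\mathbb F_2^{m\times n}$ with $n\ge 1$. Its Tanner graph $\mathcal G=(\mathcal V,\mathcal C,\mathcal E)$ is the bipartite graph with variable nodes $v_1,\dots,v_n$ and check nodes $c_1,\dots,c_m$ in which $v_j$ and $c_i$ are adjacent iff $H_{ij}=1$. Let $\varepsilon\subseteq\mathcal V$ be a set of erasures, $x\in\mathbb F_2^n$ a vector supported on $\varepsilon$, and $s=Hx$ its syndrome. Peeling repeatedly takes a check that has exactly one unresolved neighbour $v_j$, resolves $v_j$ to the current syndrome bit of that check, and updates the syndrome, until there is no such check. It leaves a set $S$ of unresolved variable nodes and a residual syndrome $s'$. The residual Tanner graph $\mathcal G'$ is the subgraph of $\mathcal G$ induced by $S$ and the check nodes adjacent to $S$. A *cluster* (biconnected component) of $\mathcal G'$ is an inclusion-maximal set of nodes whose induced subgraph is connected and has no articulation point (a node whose deletion increases the number of connected components); so an isolated node forms a cluster, and so do the two ends of a bridge. A *cut node* is a node that lies in more than one cluster. Joining every cut node to the clusters that contain it gives the cluster forest. **Algorithm (cluster decomposition post-processing).** The input is $n$, $\mathcal G'$ (as adjacency lists, in any order) and $s'$. 1.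 Construct the cluster forest by the Hopcroft–Tarjan depth-first search, and root every tree at a cluster. 2. Process each tree from the leaves to the root. For a cluster $B$, first process the clusters below it. The linear system of $B$ has the variable nodes of $B$ as unknowns and the following constraints: the equation of every check of $B$ that is not a cut node, with right-hand side its bit of $s'$; for every child variable cut node with a frozen child cluster, the value sent by that cluster; for every child check cut node all of whose child clusters are frozen, the contribution of $B$ to that check that together with theirs gives the bit of $s'$. If $B$ is not a root, compute and store by Gaussian elimination a solution with value (for a check: contribution) $0$ at the parent cut node and one with value $1$; $B$ is *free* if both exist, and otherwise *frozen*, and then it sends the only possible value to its parent. If $B$ is a root, compute one solution. 3. Process each tree from the root to the leaves. A root or frozen cluster keeps its only solution, and a free cluster selects the stored solution with the value that its parent cut node requires. A variable cut node passes its value on to its child clusters; at a check cut node the first free child cluster makes the contribution that is still missing after those of the parent cluster and of the frozen child clusters, and the other free child clusters contribute $0$. 4. Merge the selected solutions into one vector. **Theorem.** Assume that the number of edges of the Tanner graph is linear in the block length, $|\mathcal E|\le c\,n$. Let $B_1,\dots,B_t$ be all the clusters of $\mathcal G'$, and let $B_i$ contain $n_i$ variable nodes and $m_i$ check nodes. Then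 the algorithm terminates, and its running time, the number of steps on a unit-cost random access machine whose memory apart from the input is initially zero, is $$O\Big(\sum_{i=1}^t n_i\,m_i\,\min\{n_i,m_i\}\Big)+O(n),$$ where the implied constants depend only on $c$. -/

import Mathlib

/-- The number of connected components of a graph. -/
noncomputable def numComponents {V : Type*} (G : SimpleGraph V) : ℕ :=
  Nat.card G.ConnectedComponent

/-- An articulation point: deleting `v` (with its edges) increases the number of
connected components. -/
def IsArticulationPoint {V : Type*} (G : SimpleGraph V) (v : V) : Prop :=
  numComponents G < numComponents (G.induce {w | w ≠ v})

/-- A cluster (biconnected component): an inclusion-maximal set of nodes whose induced subgraph is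
connected and has no articulation point. -/
def IsCluster {V : Type*} (G : SimpleGraph V) (B : Set V) : Prop :=
  Maximal (fun A : Set V => (G.induce A).Connected ∧ ∀ v : A, ¬ IsArticulationPoint (G.induce A) v) B

section Tanner

variable {n m : ℕ}

/-- The Tanner graph of a binary parity-check matrix with `n` columns (variable nodes, `inl`) and
`m` rows (check nodes, `inr`). -/
def tannerGraph (H : Matrix (Fin m) (Fin n) (ZMod 2)) : SimpleGraph (Fin n ⊕ Fin m) where
  Adj
    | .inl j, .inr i => H i j = 1
    | .inr i, .inl j => H i j = 1
    | _, _ => False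
  symm := ⟨by rintro (j | i) (j' | i') h <;> exact h⟩
  loopless := ⟨by rintro (j | i) h <;> exact h⟩

/-- The nodes of the variable-induced subgraph of `S`: the variable nodes in `S` and the check nodes
adjacent to at least one of them. -/
def residualNodes (H : Matrix (Fin m) (Fin n) (ZMod 2)) (S : Finset (Fin n)) :
    Set (Fin n ⊕ Fin m) :=
  {x | (∃ j ∈ S, x = .inl j) ∨ ∃ j ∈ S, (tannerGraph H).Adj (.inl j) x}

/-- The variable-induced subgraph of the set `S` of variable nodes of the Tanner graph. -/
def residualGraph (H : Matrix (Fin m) (Fin n) (ZMod 2)) (S : Finset (Fin n)) :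
    SimpleGraph (residualNodes H S) :=
  (tannerGraph H).induce (residualNodes H S)

/-- Check node `i` is dangling in the variable-induced subgraph of `S`, and `j` is its only
neighbour there. -/
def IsDangling (H : Matrix (Fin m) (Fin n) (ZMod 2)) (S : Finset (Fin n)) (i : Fin m) (j : Fin n) :
    Prop :=
  ∀ k, (k ∈ S ∧ H i k = 1) ↔ k = j

/-- One iteration of the peeling decoder, acting on the set of unresolved erasures and on the
residual syndrome: variable `j` is resolved through a dangling check `i` to the value `s i`. -/
inductive PeelStep (H : Matrix (Fin m) (Fin n) (ZMod 2)) :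
    Finset (Fin n) × (Fin m → ZMod 2) → Finset (Fin n) × (Fin m → ZMod 2) → Prop
  | peel (S : Finset (Fin n)) (s : Fin m → ZMod 2) (i : Fin m) (j : Fin n)
      (h : IsDangling H S i j) : PeelStep H (S, s) (S.erase j, fun k => s k + H k j * s i)

/-- A possible result of the peeling decoder on the erasure pattern `ε` and the syndrome `s`: the
set `S` of unresolved erasures and the residual syndrome `s'`. The residual Tanner graph is then
`residualGraph H S`. -/
def IsPeelingResult (H : Matrix (Fin m) (Fin n) (ZMod 2)) (ε : Finset (Fin n)) (s : Fin m → ZMod 2)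
    (S : Finset (Fin n)) (s' : Fin m → ZMod 2) : Prop :=
  Relation.ReflTransGen (PeelStep H) (ε, s) (S, s') ∧ ∀ i j, ¬ IsDangling H S i j

/-- The clusters of the residual Tanner graph. -/
noncomputable def clusters (H : Matrix (Fin m) (Fin n) (ZMod 2)) (S : Finset (Fin n)) :
    Finset (Set (residualNodes H S)) :=
  Set.Finite.toFinset (Set.toFinite {B | IsCluster (residualGraph H S) B})

/-- The number of variable nodes of a cluster. -/
noncomputable def numVars {H : Matrix (Fin m) (Fin n) (ZMod 2)} {S : Finset (Fin n)}
    (B : Set (residualNodes H S)) : ℕ :=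
  {x ∈ B | ∃ j, x.1 = .inl j}.ncard

/-- The number of check nodes of a cluster. -/
noncomputable def numChecks {H : Matrix (Fin m) (Fin n) (ZMod 2)} {S : Finset (Fin n)}
    (B : Set (residualNodes H S)) : ℕ :=
  {x ∈ B | ∃ i, x.1 = .inr i}.ncard

end Tanner

/-! ### The machine model

A unit-cost random access machine. The memory consists of finitely many named two-dimensional arrays
of natural numbers (one-dimensional arrays and scalars use the index `0` for the missing
coordinates). Reading or writing one memory cell costs one step, and so does each `tick`; every loop
iteration and every procedure call below performs a `tick`. Between two such steps only a bounded
number of comparisons and additions of indices and bits takes place. A computation that does not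
terminate has no result (`none`). -/

/-- Names of the arrays. Nodes of the Tanner graph are numbered so that variable node `j` is `j` and
check node `i` is `n + i`. -/
inductive Arr
  /- input -/
  | cnt    -- number of variable nodes of the residual graph
  | vars   -- list of these variable nodes
  | deg    -- degree of a node in the residual graph
  | nbr    -- adjacency list of a node in the residual graph
  | syn    -- residual syndrome bit of a check node
  /- depth-first search -/
  | clock | disc | low
  | stk | sp
  /- clusters: their number, and for each of them its topmost node, variable nodes, check nodes -/
  | nblk | top | nv | cvar | nc | cchk
  /- for each node: the cluster directly above it (in the tree it is a child of that cluster if it is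
  a cut node), its position in that cluster, its child clusters -/
  | blk | loc | nchd | chd
  /- cluster trees: their number, their root clusters -/
  | nroot | root
  /- list of constraints: is there one on the node, and which -/
  | con | cval
  /- Gaussian elimination -/
  | mat | rk | pivot | pcol
  /- stored solutions of a cluster, label (1 for frozen, 0 for free), the value a frozen cluster
  sends to its parent, the selected solution -/
  | sol0 | sol1 | froz | fval | sel
  /- contribution still to be distributed among the child clusters of a check node -/
  | need
  /- output -/
  | xhat
  deriving DecidableEq

/-- The contents of the memory. -/
abbrev Mem := Arr → ℕ → ℕ → ℕ

/-- A state of the machine: the memory and the number of steps made so far. -/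
structure RamState where
  mem : Mem
  time : ℕ

/-- Programs: partial functions that transform the state and return a value. -/
abbrev Prog (α : Type) := StateT RamState Option α

/-- One step without effect on the memory. -/
def tick : Prog Unit := fun σ => some ((), ⟨σ.mem, σ.time + 1⟩)

/-- Read one memory cell, in one step. -/
def load (a : Arr) (i : ℕ) (j : ℕ := 0) : Prog ℕ := fun σ => some (σ.mem a i j, ⟨σ.mem, σ.time + 1⟩)

/-- Write one memory cell, in one step. -/
def put (a : Arr) (i j v : ℕ) : Prog Unit := fun σ =>
  some ((), ⟨fun a' i' j' => if a' = a ∧ i' = i ∧ j' = j then v else σ.mem a' i' j', σ.time + 1⟩)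

/-- The computation without result. A recursive procedure below takes as its first argument a number
`h` that only serves to define it by structural recursion: if the recursion gets deeper than `h`, the
run has no result; otherwise the run does not depend on `h`. -/
def diverge : Prog Unit := fun _ => none

/-- Write one cell of a one-dimensional array. -/
def store (a : Arr) (i v : ℕ) : Prog Unit := put a i 0 v

/-! ### Decomposition into a cluster forest: the Hopcroft-Tarjan algorithm -/

/-- Append node `y` to the list of variable nodes or of check nodes of cluster `b`; return its
position in that list. -/
def addNode (n b y : ℕ) : Prog ℕ := do
  tick
  if y < n then
    let k ← load .nv b
    put .cvar b k y
    store .nv b (k + 1)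
    return k
  else
    let k ← load .nc b
    put .cchk b k y
    store .nc b (k + 1)
    return k

/-- Create a new cluster with topmost node `u`; return its number. -/
def newCluster (n u : ℕ) : Prog ℕ := do
  tick
  let b ← load .nblk 0
  store .nblk 0 (b + 1)
  store .top b u
  let _ ← addNode n b u
  return b

/-- Create the cluster that consists of `u` and of the nodes on the stack from position `s` on;
remove the latter from the stack, and make the cluster a child of `u`. -/
def popCluster (n u s : ℕ) : Prog Unit := do
  tick
  let b ← newCluster n u
  let e ← load .sp 0
  for k in List.range (e - s) do
    tick
    let y ← load .stk (s + k)
    let p ← addNode n b y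
    store .loc y p
    store .blk y b
  store .sp 0 s
  let c ← load .nchd u
  put .chd u c b
  store .nchd u (c + 1)

/-- Depth-first search from `u`. `low u` becomes the smallest discovery time among `u` and the
neighbours of the nodes in the subtree of `u`. When a child `w` of `u` is finished, then `u` separates
the subtree of `w` from the rest (or `u` is the root) exactly if `disc u ≤ low w`, and then the nodes
on the stack from `w` on form a cluster together with `u`. -/
def dfs : ℕ → ℕ → ℕ → Prog Unit
  | 0, _, _ => diverge
  | h + 1, n, u => do
    tick
    let t ← load .clock 0
    store .clock 0 (t + 1)
    store .disc u (t + 1)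
    store .low u (t + 1)
    let s ← load .sp 0
    store .stk s u
    store .sp 0 (s + 1)
    let d ← load .deg u
    for k in List.range d do
      tick
      let w ← load .nbr u k
      let dw ← load .disc w
      if dw = 0 then
        let s' ← load .sp 0
        dfs h n w
        let lu ← load .low u
        let lw ← load .low w
        store .low u (min lu lw)
        if t + 1 ≤ lw then
          popCluster n u s'
      else
        let lu ← load .low u
        store .low u (min lu dw)

/-- Build the cluster tree of the connected component of the variable node `r`. Its root cluster is
a cluster that contains `r`; the other clusters with topmost node `r` are children of `r`, and `r` is
then a child of the root cluster. If `r` is isolated, it forms a cluster by itself. -/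
def buildTree (h n r : ℕ) : Prog Unit := do
  tick
  dfs h n r
  store .sp 0 0
  let q ← load .nroot 0
  store .nroot 0 (q + 1)
  store .loc r 0
  let c ← load .nchd r
  if c = 0 then
    let b ← newCluster n r
    store .blk r b
    store .root q b
  else
    let b ← load .chd r (c - 1)
    store .nchd r (c - 1)
    store .blk r b
    store .root q b

/-- Decompose the residual graph into a cluster forest. -/
def buildForest (h n : ℕ) : Prog Unit := do
  tick
  let q ← load .cnt 0
  for k in List.range q do
    tick
    let v ← load .vars k
    let d ← load .disc v
    if d = 0 then
      buildTree h n v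

/-! ### Solutions of one cluster: Gaussian elimination -/

/-- Is `b` a root cluster? (Otherwise `top b` is the parent cut node of `b`.) -/
def isRoot (b : ℕ) : Prog Bool := do
  tick
  let u ← load .top b
  let b' ← load .blk u
  return b' = b

/-- The position of node `x` in the list of variable nodes or of check nodes of cluster `b`. -/
def position (b x : ℕ) : Prog ℕ := do
  tick
  let u ← load .top b
  if x = u then return 0 else load .loc x

/-- Is there a constraint on node `x` in cluster `b`, and which value does it prescribe? The parent
cut node of `b`, if any, is required to have the value (contribution) `a`; for the other nodes, the
list of constraints decides. -/
def constraint (b a x : ℕ) : Prog (Bool × ℕ) := do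
  tick
  let u ← load .top b
  let r ← isRoot b
  if x = u ∧ r = false then
    return (true, a)
  else
    let f ← load .con x
    let v ← load .cval x
    return (f = 1, v)

/-- Enter the edges of cluster `b` that join node `y` to nodes discovered before `y`. -/
def enterEdges (n b y : ℕ) : Prog Unit := do
  tick
  let u ← load .top b
  if y ≠ u then
    let p ← position b y
    let dy ← load .disc y
    let d ← load .deg y
    for k in List.range d do
      tick
      let x ← load .nbr y k
      let dx ← load .disc x
      if dx < dy then
        let q ← position b x
        if y < n then put .mat q p 1 else put .mat p q 1

/-- Build the augmented matrix (`R` rows, `C` columns and a right-hand side) of the linear system of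
cluster `b` under its constraints. A constraint on a check is its equation, a check without constraint
has a zero row, and the value of a variable with a constraint is substituted. -/
def buildSystem (n b a R C : ℕ) : Prog Unit := do
  tick
  for i in List.range R do
    tick
    for j in List.range (C + 1) do
      tick
      put .mat i j 0
  for j in List.range C do
    tick
    let y ← load .cvar b j
    enterEdges n b y
  for i in List.range R do
    tick
    let y ← load .cchk b i
    enterEdges n b y
  for i in List.range R do
    tick
    let y ← load .cchk b i
    let (f, v) ← constraint b a y
    if f then
      put .mat i C v
    else
      for j in List.range C do
        tick
        put .mat i j 0
  for j in List.range C do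
    tick
    let y ← load .cvar b j
    let (f, v) ← constraint b a y
    if f then
      for i in List.range R do
        tick
        let e ← load .mat i j
        if e = 1 then
          let z ← load .mat i C
          put .mat i C ((z + v) % 2)
          put .mat i j 0

/-- Exchange two rows of the augmented matrix. -/
def swapRows (C i i' : ℕ) : Prog Unit := do
  tick
  for j in List.range (C + 1) do
    tick
    let e ← load .mat i j
    let e' ← load .mat i' j
    put .mat i j e'
    put .mat i' j e

/-- Add row `i` of the augmented matrix to row `i'`. -/
def addRow (C i i' : ℕ) : Prog Unit := do
  tick
  for j in List.range (C + 1) do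
    tick
    let e ← load .mat i j
    let e' ← load .mat i' j
    put .mat i' j ((e + e') % 2)

/-- Gauss-Jordan elimination over the field with two elements. At the end `rk 0` is the rank and
`pcol i` is the pivot column of row `i < rk 0`. -/
def eliminate (R C : ℕ) : Prog Unit := do
  tick
  store .rk 0 0
  for j in List.range C do
    tick
    let r ← load .rk 0
    store .pivot 0 R
    for i in List.range R do
      tick
      let p ← load .pivot 0
      let e ← load .mat i j
      if p = R ∧ r ≤ i ∧ e = 1 then
        store .pivot 0 i
    let p ← load .pivot 0
    if p < R then
      swapRows C r p
      for i in List.range R do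
        tick
        let e ← load .mat i j
        if i ≠ r ∧ e = 1 then
          addRow C r i
      store .pcol r j
      store .rk 0 (r + 1)

/-- Compute and store (in the array `out`) a solution of cluster `b` under its constraints, with the
value `a` for its parent cut node, if any. Returns whether there is one. -/
def solve (n b a : ℕ) (out : Arr) : Prog Bool := do
  tick
  let R ← load .nc b
  let C ← load .nv b
  buildSystem n b a R C
  eliminate R C
  for j in List.range C do
    tick
    let y ← load .cvar b j
    let (f, v) ← constraint b a y
    put out b j (if f then v else 0)
  let r ← load .rk 0
  for i in List.range r do
    tick
    let j ← load .pcol i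
    let z ← load .mat i C
    put out b j z
  -- the system is consistent if the zero rows have right-hand side zero
  store .pivot 0 1
  for i in List.range R do
    tick
    let z ← load .mat i C
    if r ≤ i ∧ z ≠ 0 then
      store .pivot 0 0
  let ok ← load .pivot 0
  return ok = 1

/-! ### First stage: from the leaves to the root -/

/-- Compute the solutions of cluster `b` and of all clusters below it, and label them. -/
def recursiveCompute : ℕ → ℕ → ℕ → Prog Unit
  | 0, _, _ => diverge
  | h + 1, n, b => do
    tick
    let C ← load .nv b
    for j in List.range C do
      tick
      let v ← load .cvar b j
      let b₀ ← load .blk v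
      if b₀ = b then
        let d ← load .nchd v
        for k in List.range d do
          tick
          let b' ← load .chd v k
          recursiveCompute h n b'
        -- a frozen child cluster freezes the variable
        for k in List.range d do
          tick
          let b' ← load .chd v k
          let f ← load .froz b'
          if f = 1 then
            let z ← load .fval b'
            store .con v 1
            store .cval v z
    let R ← load .nc b
    for i in List.range R do
      tick
      let c ← load .cchk b i
      let b₀ ← load .blk c
      if b₀ = b then
        let d ← load .nchd c
        for k in List.range d do
          tick
          let b' ← load .chd c k
          recursiveCompute h n b'
        -- the contribution of `b` is prescribed if all child clusters are frozen, in particular if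
        -- there are none (internal checks)
        let s ← load .syn c
        store .con c 1
        store .cval c s
        for k in List.range d do
          tick
          let b' ← load .chd c k
          let f ← load .froz b'
          if f = 1 then
            let z ← load .fval b'
            let z' ← load .cval c
            store .cval c ((z + z') % 2)
          else
            store .con c 0
    let r ← isRoot b
    if r then
      let _ ← solve n b 0 .sol0
      store .froz b 1
      store .fval b 0
    else
      let ok₀ ← solve n b 0 .sol0
      let ok₁ ← solve n b 1 .sol1
      if ok₀ ∧ ok₁ then
        store .froz b 0
      else
        store .froz b 1
        store .fval b (if ok₁ then 1 else 0)

/-! ### Second stage: from the root to the leaves -/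

/-- The value of the variable at position `j` of cluster `b` in the selected solution. -/
def selectedValue (b j : ℕ) : Prog ℕ := do
  tick
  let a ← load .sel b
  if a = 0 then load .sol0 b j else load .sol1 b j

/-- Subtract from `need c` the contribution of the selected solution of cluster `b` to the check node
`c`, a child cut node of `b`. -/
def subtractContribution (b c : ℕ) : Prog Unit := do
  tick
  let u ← load .top b
  let d ← load .deg c
  for k in List.range d do
    tick
    let x ← load .nbr c k
    let b' ← load .blk x
    if b' = b ∨ x = u then
      let p ← position b x
      let z ← selectedValue b p
      let s ← load .need c
      store .need c ((s + z) % 2)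

/-- Select a solution of cluster `b`, which is required to have the value (contribution) `a` at its
parent cut node, and then solutions of all clusters below it. For a frozen cluster or a root cluster
there is only one solution to select from. -/
def recursiveSelect : ℕ → ℕ → ℕ → Prog Unit
  | 0, _, _ => diverge
  | h + 1, b, a => do
    tick
    let f ← load .froz b
    if f = 1 then
      let z ← load .fval b
      store .sel b z
    else
      store .sel b a
    let C ← load .nv b
    for j in List.range C do
      tick
      let v ← load .cvar b j
      let b₀ ← load .blk v
      if b₀ = b then
        let z ← selectedValue b j
        let d ← load .nchd v
        for k in List.range d do
          tick
          let b' ← load .chd v k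
          recursiveSelect h b' z
    let R ← load .nc b
    for i in List.range R do
      tick
      let c ← load .cchk b i
      let b₀ ← load .blk c
      if b₀ = b then
        let d ← load .nchd c
        if 0 < d then
          let s ← load .syn c
          store .need c s
          subtractContribution b c
          -- frozen child clusters
          for k in List.range d do
            tick
            let b' ← load .chd c k
            let f' ← load .froz b'
            if f' = 1 then
              let z ← load .fval b'
              let s' ← load .need c
              store .need c ((s' + z) % 2)
              recursiveSelect h b' z
          -- free child clusters: the first one makes the whole remaining contribution
          for k in List.range d do
            tick
            let b' ← load .chd c k
            let f' ← load .froz b'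
            if f' ≠ 1 then
              let s' ← load .need c
              store .need c 0
              recursiveSelect h b' s'

/-! ### The whole procedure -/

/-- Merge the selected cluster solutions into a global solution. -/
def mergeSolutions : Prog Unit := do
  tick
  let t ← load .nblk 0
  for b in List.range t do
    tick
    let C ← load .nv b
    for j in List.range C do
      tick
      let v ← load .cvar b j
      let z ← selectedValue b j
      store .xhat v z

/-- Cluster decomposition post-processing, for block length `n` (with recursion depth at most `h`). -/
def clusterDecomposition (h n : ℕ) : Prog Unit := do
  tick
  buildForest h n
  let t ← load .nroot 0
  for k in List.range t do
    tick
    let b ← load .root k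
    recursiveCompute h n b
    recursiveSelect h b 0
  mergeSolutions

/-! ### Input of the procedure -/

/-- The number of a node of the Tanner graph. -/
def nodeNumber {n m : ℕ} : Fin n ⊕ Fin m → ℕ
  | .inl j => j
  | .inr i => n + i

/-- The initial memory `M` contains the residual graph of `S`, as adjacency lists in an arbitrary
order, and the residual syndrome `s'`; all other cells are zero. -/
structure IsInput {n m : ℕ} (H : Matrix (Fin m) (Fin n) (ZMod 2)) (S : Finset (Fin n))
    (s' : Fin m → ZMod 2) (M : Mem) : Prop where
  vars : Set.BijOn (fun k => M .vars k 0) (Set.Iio (M .cnt 0 0)) {v | ∃ j ∈ S, v = (j : ℕ)}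
  nbr : ∀ x : residualNodes H S,
    Set.BijOn (fun k => M .nbr (nodeNumber x.1) k) (Set.Iio (M .deg (nodeNumber x.1) 0))
      {y | ∃ y' : residualNodes H S, (residualGraph H S).Adj x y' ∧ y = nodeNumber y'.1}
  syn : ∀ i : Fin m, M .syn (n + i) 0 = (s' i).val
  zero : ∀ a, a ≠ .cnt → a ≠ .vars → a ≠ .deg → a ≠ .nbr → a ≠ .syn → ∀ i j, M a i j = 0

/-! ### A program logic for the machine -/

/-! The time consists of the depth-first search, which is linear in the size of the residual graph,
and of the work on the linear systems. Elimination on `R` checks and `C` variables adds rows only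
after a pivot has been found, and there are at most `min R C` pivots, so it takes
O((R+1)(C+1)(min(R,C)+1)) steps (`RunsWithin.eliminate_steps`). All other work on a cluster is
linear in the area of its matrix and in the degrees of its nodes.

The values and labels computed on the way influence which branch is taken, but not these bounds. The
two stages are therefore analysed relative to a fixed memory `m`: `RunsWithin` records only that the
arrays describing the cluster forest keep their contents and how many steps pass. Clusters are
numbered in the order of their completion, children before parents, so both recursions descend to
smaller numbers and visit each cluster at most once. Their cost is a sum over disjoint subtrees
(`sum_subtreeSum_le`).

It is not necessary to show that the search produces exactly the clusters. Two facts suffice. First,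
each node list stays connected when any node is removed, so it is contained in some cluster. This is
the low-point argument. The nodes that a search leaves on the stack form a segment (`IsSegment`):
after the removal of one node, every remaining node still reaches the top of the segment or a node
with an edge to an active ancestor. A child segment with an edge to a proper ancestor of `u` is
glued to the segment of `u` (`IsSegment.union`); one whose edges to active nodes all end in `u` is
removed and forms a cluster with `u` (`IsSegment.staysConnected_insert`). `SearchStart.dfs_runs`
carries this invariant together with an amortized time bound.

Second, every node of a list except possibly its topmost one is owned by that list through `blk`,
and every list owns a node. The owned sets are disjoint, and p·q·min(p,q) is superadditive, so the
lists inside one cluster cost no more than that cluster (`sum_mul_mul_min_le`,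
`ForestInvariant.sum_clusterWork_le`). The topmost node adds one row or one column, which costs a
constant factor and a term linear in the number of owned nodes.

Finally, every check of the residual graph has an edge there, so the numbers of nodes and of
adjacency entries are O(n + |E|) = O(n). -/

/-- The program `p` terminates from the state `σ`, with result and final state satisfying `Q`. -/
def Runs {α : Type} (p : Prog α) (σ : RamState) (Q : α → RamState → Prop) : Prop :=
  ∃ r σ', p σ = some (r, σ') ∧ Q r σ'

/-- Memory after the value `v` has been written to one cell. -/
def Mem.write (m : Mem) (a : Arr) (i j v : ℕ) : Mem := fun a' i' j' =>
  if a' = a ∧ i' = i ∧ j' = j then v else m a' i' j'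

theorem Mem.write_of_ne (m : Mem) {a a' : Arr} (h : a' ≠ a) (i j v : ℕ) :
    m.write a i j v a' = m a' := by
  funext i' j'; simp [Mem.write, h]

theorem Mem.write_apply (m : Mem) (a : Arr) (i j v i' j' : ℕ) :
    m.write a i j v a i' j' = if i' = i ∧ j' = j then v else m a i' j' := by
  simp [Mem.write]

theorem Mem.write_apply_zero (m : Mem) (a : Arr) (i v i' : ℕ) :
    m.write a i 0 v a i' 0 = if i' = i then v else m a i' 0 := by
  simp [Mem.write]

namespace Runs

variable {α β : Type} {σ : RamState} {Q : α → RamState → Prop}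

theorem mono {p : Prog α} {Q' : α → RamState → Prop} (h : Runs p σ Q)
    (hQ : ∀ r σ', Q r σ' → Q' r σ') : Runs p σ Q' := by
  obtain ⟨r, σ', h, hq⟩ := h
  exact ⟨r, σ', h, hQ _ _ hq⟩

theorem bind {p : Prog β} {f : β → Prog α} (h : Runs p σ fun r σ' => Runs (f r) σ' Q) :
    Runs (p >>= f) σ Q := by
  obtain ⟨r, σ', h, r', σ'', h', hq⟩ := h
  refine ⟨r', σ'', ?_, hq⟩
  change (p σ).bind (fun x => f x.1 x.2) = _
  rw [h]; exact h'

theorem pure {r : α} (h : Q r σ) : Runs (Pure.pure r) σ Q := ⟨r, σ, rfl, h⟩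

theorem tick_bind {f : Unit → Prog α} (h : Runs (f ()) ⟨σ.mem, σ.time + 1⟩ Q) :
    Runs (tick >>= f) σ Q := bind ⟨_, _, rfl, h⟩

theorem load_bind {a : Arr} {i j : ℕ} {f : ℕ → Prog α}
    (h : Runs (f (σ.mem a i j)) ⟨σ.mem, σ.time + 1⟩ Q) :
    Runs (load a i j >>= f) σ Q := bind ⟨_, _, rfl, h⟩

theorem put_bind {a : Arr} {i j v : ℕ} {f : Unit → Prog α}
    (h : Runs (f ()) ⟨σ.mem.write a i j v, σ.time + 1⟩ Q) :
    Runs (put a i j v >>= f) σ Q := bind ⟨_, _, rfl, h⟩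

theorem store_bind {a : Arr} {i v : ℕ} {f : Unit → Prog α}
    (h : Runs (f ()) ⟨σ.mem.write a i 0 v, σ.time + 1⟩ Q) :
    Runs (store a i v >>= f) σ Q := bind ⟨_, _, rfl, h⟩

theorem store {a : Arr} {i v : ℕ} {Q : Unit → RamState → Prop}
    (h : Q () ⟨σ.mem.write a i 0 v, σ.time + 1⟩) : Runs (store a i v) σ Q := ⟨_, _, rfl, h⟩

theorem forIn_range {d : ℕ} {f : ℕ → PUnit → Prog (ForInStep PUnit)}
    {Q : PUnit → RamState → Prop} (I : ℕ → RamState → Prop) (h₀ : I 0 σ)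
    (hstep : ∀ k < d, ∀ σ, I k σ →
      Runs (f k PUnit.unit) σ fun r σ' => r = ForInStep.yield PUnit.unit ∧ I (k + 1) σ')
    (hd : ∀ σ, I d σ → Q PUnit.unit σ) :
    Runs (forIn (List.range d) PUnit.unit f) σ Q := by
  -- The induction is on the length of the rest of the range, so its start has to be arbitrary.
  suffices H : ∀ l s : ℕ, s + l = d → ∀ σ, I s σ →
      Runs (forIn (List.range' s l) PUnit.unit f) σ Q by
    rw [List.range_eq_range']
    exact H d 0 (by simp) σ h₀
  intro l
  induction l with
  | zero =>
    intro s hs σ hσ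
    simp only [List.range'_zero, List.forIn_nil]
    exact pure (hd _ (by rwa [← hs]))
  | succ l ih =>
    intro s hs σ hσ
    rw [List.range'_succ, List.forIn_cons]
    refine bind ((hstep s (by omega) σ hσ).mono ?_)
    rintro r σ' ⟨rfl, hσ'⟩
    exact ih (s + 1) (by omega) σ' hσ'

end Runs

/-! ### Time bounds relative to protected arrays -/

/-- Started from any memory that agrees with `m` on the arrays `A`, the program `p` terminates
within `t` steps, does not change these arrays, and its result satisfies `R`. -/
def RunsWithin {α : Type} (A : Arr → Bool) (m : Mem) (p : Prog α) (t : ℕ) (R : α → Prop) : Prop :=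
  ∀ σ, (∀ a, A a = true → σ.mem a = m a) →
    Runs p σ fun r σ' => (∀ a, A a = true → σ'.mem a = m a) ∧ σ'.time ≤ σ.time + t ∧ R r

namespace RunsWithin

variable {α β : Type} {A : Arr → Bool} {m : Mem} {t : ℕ} {R : α → Prop}

theorem mono {p : Prog α} {t' : ℕ} (h : RunsWithin A m p t R) (ht : t ≤ t') :
    RunsWithin A m p t' R := fun σ hσ =>
  (h σ hσ).mono fun _ _ ⟨h₁, h₂, h₃⟩ => ⟨h₁, h₂.trans (by omega), h₃⟩

theorem bind {p : Prog β} {f : β → Prog α} {R' : β → Prop} {t' : ℕ} (h : RunsWithin A m p t' R')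
    (h' : ∀ r, R' r → RunsWithin A m (f r) t R) : RunsWithin A m (p >>= f) (t' + t) R := by
  intro σ hσ
  refine Runs.bind ((h σ hσ).mono ?_)
  rintro r σ' ⟨h₁, h₂, h₃⟩
  refine (h' r h₃ σ' h₁).mono ?_
  rintro r' σ'' ⟨h₄, h₅, h₆⟩
  exact ⟨h₄, by omega, h₆⟩

theorem pure {r : α} (h : R r) : RunsWithin A m (Pure.pure r) 0 R :=
  fun _ hσ => Runs.pure ⟨hσ, le_rfl, h⟩

theorem pure' {r : α} (h : R r) : RunsWithin A m (Pure.pure r) t R := (pure h).mono (Nat.zero_le t)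

theorem tick_bind {f : Unit → Prog α} (h : RunsWithin A m (f ()) t R) :
    RunsWithin A m (tick >>= f) (t + 1) R := fun σ hσ =>
  Runs.tick_bind ((h ⟨σ.mem, σ.time + 1⟩ hσ).mono
    fun _ _ ⟨h₁, h₂, h₃⟩ => ⟨h₁, by dsimp only at h₂; omega, h₃⟩)

theorem load_bind {a : Arr} (ha : A a = true) {i j : ℕ} {f : ℕ → Prog α}
    (h : RunsWithin A m (f (m a i j)) t R) :
    RunsWithin A m (load a i j >>= f) (t + 1) R := fun σ hσ => by
  refine Runs.load_bind ?_
  rw [hσ a ha]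
  exact (h ⟨σ.mem, σ.time + 1⟩ hσ).mono
    fun _ _ ⟨h₁, h₂, h₃⟩ => ⟨h₁, by dsimp only at h₂; omega, h₃⟩

/-- Nothing is known about the value of an unprotected cell, so the continuation is bounded for
every value. This is enough wherever data affect the branch taken but not the bound. -/
theorem load_bind' {a : Arr} {i j : ℕ} {f : ℕ → Prog α}
    (h : ∀ v, RunsWithin A m (f v) t R) :
    RunsWithin A m (load a i j >>= f) (t + 1) R := fun σ hσ =>
  Runs.load_bind ((h _ ⟨σ.mem, σ.time + 1⟩ hσ).mono
    fun _ _ ⟨h₁, h₂, h₃⟩ => ⟨h₁, by dsimp only at h₂; omega, h₃⟩)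

theorem load {a : Arr} {i j : ℕ} {R : ℕ → Prop} (h : ∀ v, R v) :
    RunsWithin A m (load a i j) 1 R := fun _ hσ => ⟨_, _, rfl, hσ, le_rfl, h _⟩

theorem put_bind {a : Arr} (ha : A a = false) {i j v : ℕ} {f : Unit → Prog α}
    (h : RunsWithin A m (f ()) t R) :
    RunsWithin A m (put a i j v >>= f) (t + 1) R := fun σ hσ => by
  refine Runs.put_bind ((h ⟨σ.mem.write a i j v, σ.time + 1⟩ ?_).mono
    fun _ _ ⟨h₁, h₂, h₃⟩ => ⟨h₁, by dsimp only at h₂; omega, h₃⟩)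
  intro a' ha'
  rw [← hσ a' ha']
  exact Mem.write_of_ne _ (by rintro rfl; simp [ha] at ha') ..

theorem store_bind {a : Arr} (ha : A a = false) {i v : ℕ} {f : Unit → Prog α}
    (h : RunsWithin A m (f ()) t R) :
    RunsWithin A m (store a i v >>= f) (t + 1) R := put_bind ha h

/-- Keeps the condition in the bound, for branches whose difference in cost matters. `ite_max` is
the coarser form for bounded branches. -/
theorem ite {c : Prop} [Decidable c] {p q : Prog α} {t' : ℕ}
    (h : c → RunsWithin A m p t R) (h' : ¬ c → RunsWithin A m q t' R) :
    RunsWithin A m (if c then p else q) (if c then t else t') R := by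
  split_ifs with hc
  exacts [h hc, h' hc]

theorem ite_max {c : Prop} [Decidable c] {p q : Prog α} {t' : ℕ}
    (h : c → RunsWithin A m p t R) (h' : ¬ c → RunsWithin A m q t' R) :
    RunsWithin A m (if c then p else q) (max t t') R := by
  split_ifs with hc
  exacts [(h hc).mono (le_max_left ..), (h' hc).mono (le_max_right ..)]

theorem forIn_range {d : ℕ} {f : ℕ → PUnit → Prog (ForInStep PUnit)} (c : ℕ → ℕ)
    (h : ∀ k < d, RunsWithin A m (f k PUnit.unit) (c k) fun r => r = ForInStep.yield PUnit.unit) :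
    RunsWithin A m (forIn (List.range d) PUnit.unit f) (∑ k ∈ Finset.range d, c k)
      fun _ => True := by
  intro σ hσ
  refine Runs.forIn_range (fun k σ' => (∀ a, A a = true → σ'.mem a = m a) ∧
    σ'.time ≤ σ.time + ∑ k ∈ Finset.range k, c k) ⟨hσ, by simp⟩ ?_ ?_
  · rintro k hk σ' ⟨h₁, h₂⟩
    refine (h k hk σ' h₁).mono ?_
    rintro r σ'' ⟨h₃, h₄, h₅⟩
    refine ⟨h₅, h₃, ?_⟩
    rw [Finset.sum_range_succ]
    omega
  · rintro σ' ⟨h₁, h₂⟩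
    exact ⟨h₁, h₂, trivial⟩

theorem forIn_range_const {d : ℕ} {f : ℕ → PUnit → Prog (ForInStep PUnit)} (c : ℕ)
    (h : ∀ k < d, RunsWithin A m (f k PUnit.unit) c fun r => r = ForInStep.yield PUnit.unit) :
    RunsWithin A m (forIn (List.range d) PUnit.unit f) (d * c) fun _ => True := by
  simpa using forIn_range (fun _ => c) h

end RunsWithin

/-! ### The time for the linear system of one cluster -/

/-- The arrays that represent the graph and its cluster forest. -/
def forestArrays : Arr → Bool
  | .deg | .nblk | .top | .nv | .cvar | .nc | .cchk | .blk | .nchd | .chd | .nroot | .root => true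
  | _ => false

/-- The number of adjacency list entries of `y` that are inspected for cluster `b`. -/
def edgeWork (m : Mem) (b y : ℕ) : ℕ := if y = m .top b 0 then 0 else m .deg y 0

/-- The total `edgeWork` of the nodes in the lists of cluster `b`. -/
def clusterEdgeWork (m : Mem) (b : ℕ) : ℕ :=
  ∑ j ∈ Finset.range (m .nv b 0), edgeWork m b (m .cvar b j) +
    ∑ i ∈ Finset.range (m .nc b 0), edgeWork m b (m .cchk b i)

namespace RunsWithin

variable {A : Arr → Bool} {m : Mem}

theorem isRoot_steps (b : ℕ) : RunsWithin A m (isRoot b) 3 fun _ => True :=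
  tick_bind <| load_bind' fun _ => load_bind' fun _ => pure trivial

theorem position_steps (b x : ℕ) : RunsWithin A m (position b x) 3 fun _ => True :=
  tick_bind <| load_bind' fun _ =>
    ((ite_max (fun _ => pure trivial) fun _ => load fun _ => trivial).mono
      (by simp))

theorem constraint_steps (b a x : ℕ) :
    RunsWithin A m (constraint b a x) 7 fun _ => True :=
  tick_bind <| load_bind' fun _ => (bind (isRoot_steps b) fun _ _ =>
    ite_max (fun _ => pure trivial) fun _ => load_bind' fun _ => load_bind' fun _ =>
      pure trivial).mono (by simp)

theorem selectedValue_steps (b j : ℕ) :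
    RunsWithin A m (selectedValue b j) 3 fun _ => True :=
  tick_bind <| load_bind' fun _ =>
    ((ite_max (fun _ => load fun _ => trivial)
      fun _ => load fun _ => trivial).mono (by simp))

/-- The topmost node is skipped by the program, which is essential for linearity: it may be topmost
in many clusters, and its degree would be paid in each of them. -/
theorem enterEdges_steps (hmat : A .mat = false) (htop : A .top = true)
    (hdeg : A .deg = true) (n b y : ℕ) :
    RunsWithin A m (enterEdges n b y) (edgeWork m b y * 7 + 8) fun _ => True := by
  refine RunsWithin.mono (t := (if y ≠ m .top b 0 then m .deg y 0 * 7 + 6 else 0) + 1 + 1) ?_ ?_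
  · refine tick_bind <| load_bind htop <| ite (fun _ => ?_) fun _ => pure trivial
    refine mono ?_ (show 3 + (m .deg y 0 * 7 + 1 + 1 + 1) ≤ _ by omega)
    refine bind (position_steps b y) fun p _ => load_bind' fun dy => load_bind hdeg ?_
    refine bind (forIn_range_const 7 fun k _ => ?_) fun _ _ => pure' trivial
    refine mono (t := max (3 + max (0 + 1) (0 + 1)) 0 + 1 + 1 + 1) ?_ (by simp)
    refine tick_bind <| load_bind' fun x => load_bind' fun dx => ite_max (fun _ => ?_)
      fun _ => pure rfl
    refine bind (position_steps b x) fun q _ => ite_max (fun _ => ?_) fun _ => ?_ <;>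
      exact put_bind hmat <| pure rfl
  · unfold edgeWork; split_ifs <;> omega

theorem buildSystem_steps (hmat : A .mat = false) (htop : A .top = true)
    (hdeg : A .deg = true) (hcvar : A .cvar = true) (hcchk : A .cchk = true) (n b a : ℕ) :
    RunsWithin A m (buildSystem n b a (m .nc b 0) (m .nv b 0))
      (30 * ((m .nc b 0 + 1) * (m .nv b 0 + 1) + clusterEdgeWork m b)) fun _ => True := by
  set R := m .nc b 0 with hR
  set C := m .nv b 0 with hC
  refine mono (t := R * ((C + 1) * 2 + 1 + 1) +
    (∑ j ∈ Finset.range C, (edgeWork m b (m .cvar b j) * 7 + 8 + 1 + 1 + 1) +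
    (∑ i ∈ Finset.range R, (edgeWork m b (m .cchk b i) * 7 + 8 + 1 + 1 + 1) +
    (R * (7 + max (0 + 1) (C * 2 + 1) + 1 + 1) +
    (C * (7 + max (R * (max (0 + 1 + 1 + 1) 0 + 1 + 1) + 1) 0 + 1 + 1) + 1)))) + 1) ?_ ?_
  · refine tick_bind <| bind (forIn_range_const _ fun i _ => ?_) fun _ _ =>
      bind (forIn_range _ fun j _ => ?_) fun _ _ => bind (forIn_range _ fun i _ => ?_) fun _ _ =>
      bind (forIn_range_const _ fun i _ => ?_) fun _ _ =>
      bind (forIn_range_const _ fun j _ => ?_) fun _ _ => pure' trivial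
    · refine tick_bind <| bind (forIn_range_const 2 fun j _ => ?_) fun _ _ => pure' rfl
      exact tick_bind <| put_bind hmat <| pure rfl
    · exact tick_bind <| load_bind hcvar <|
        mono (bind (enterEdges_steps hmat htop hdeg n b _) fun _ _ => pure rfl) (by omega)
    · exact tick_bind <| load_bind hcchk <|
        mono (bind (enterEdges_steps hmat htop hdeg n b _) fun _ _ => pure rfl) (by omega)
    · refine tick_bind <| load_bind' fun y => bind (constraint_steps b a y) fun x _ =>
        ite_max (fun _ => put_bind hmat <| pure rfl) fun _ =>
          bind (forIn_range_const 2 fun j _ => ?_) fun _ _ => pure' rfl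
      exact tick_bind <| put_bind hmat <| pure rfl
    · refine tick_bind <| load_bind' fun y => bind (constraint_steps b a y) fun x _ =>
        ite_max (fun _ => bind (forIn_range_const _ fun i _ => ?_) fun _ _ => pure' rfl)
          fun _ => pure rfl
      exact tick_bind <| load_bind' fun e => ite_max
        (fun _ => load_bind' fun z => put_bind hmat <| put_bind hmat <| pure rfl) fun _ => pure rfl
  · simp only [Finset.sum_add_distrib, ← Finset.sum_mul, clusterEdgeWork, Finset.sum_const,
      Finset.card_range, smul_eq_mul, ← hR, ← hC]
    have h₁ : max (0 + 1) (C * 2 + 1) = C * 2 + 1 := by omega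
    have h₂ : max (R * (max (0 + 1 + 1 + 1) 0 + 1 + 1) + 1) 0 = R * 5 + 1 := by simp
    rw [h₁, h₂]
    generalize ∑ j ∈ Finset.range C, edgeWork m b (m .cvar b j) = S
    generalize ∑ i ∈ Finset.range R, edgeWork m b (m .cchk b i) = S'
    nlinarith

theorem swapRows_steps (hmat : A .mat = false) (C i i' : ℕ) :
    RunsWithin A m (swapRows C i i') ((C + 1) * 5 + 1 + 1) fun _ => True :=
  tick_bind <| bind (forIn_range_const 5 fun _ _ => tick_bind <| load_bind' fun _ =>
    load_bind' fun _ => put_bind hmat <| put_bind hmat <| pure rfl) fun _ _ => pure' trivial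

theorem addRow_steps (hmat : A .mat = false) (C i i' : ℕ) :
    RunsWithin A m (addRow C i i') ((C + 1) * 4 + 1 + 1) fun _ => True :=
  tick_bind <| bind (forIn_range_const 4 fun _ _ => tick_bind <| load_bind' fun _ =>
    load_bind' fun _ => put_bind hmat <| pure rfl) fun _ _ => pure' trivial

end RunsWithin

/-! ### The cost of Gaussian elimination -/

/-- Number of steps of Gaussian elimination on `R` rows and `C` columns, up to a constant. -/
def eliminationWork (R C : ℕ) : ℕ := (R + 1) * (C + 1) * (min R C + 1)

theorem RunsWithin.runs {α : Type} {A : Arr → Bool} {p : Prog α} {t : ℕ} {R : α → Prop}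
    {σ : RamState} (h : RunsWithin A σ.mem p t R) :
    Runs p σ fun r σ' => (∀ a, A a = true → σ'.mem a = σ.mem a) ∧ σ'.time ≤ σ.time + t ∧ R r :=
  h σ fun _ _ => rfl

namespace RunsWithin

variable {A : Arr → Bool} {m : Mem}

/-- The rank counter grows by at most one per column and only when a pivot row `p` with `r ≤ p < R`
exists, so it never exceeds `min R C`. The search for a pivot costs O(R) per column, the swap and
the row additions O(RC) per pivot. The bound on the final rank limits the loop over pivot rows in
`solve`. -/
theorem eliminate_steps (hmat : A .mat = false) (hrk : A .rk = false) (hpiv : A .pivot = false)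
    (hpcol : A .pcol = false) (R C : ℕ) (σ : RamState) :
    Runs (eliminate R C) σ fun _ σ' => (∀ a, A a = true → σ'.mem a = σ.mem a) ∧
      σ'.time ≤ σ.time + 30 * eliminationWork R C ∧ σ'.mem .rk 0 0 ≤ R := by
  have keep : ∀ {m m' : Mem} {a : Arr}, A a = false → (∀ a, A a = true → m' a = m a) →
      ∀ i j v, ∀ a', A a' = true → m'.write a i j v a' = m a' := by
    intro m m' a ha h i j v a' ha'
    rw [Mem.write_of_ne _ (by rintro rfl; simp [ha] at ha'), h a' ha']
  -- Within the treatment of one column the rank must not change either, so it joins the protected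
  -- arrays.
  set B : Arr → Bool := fun a => A a || a = .rk with hB
  have hBA : ∀ a, A a = true → B a = true := by intro a ha; simp [hB, ha]
  have hBmat : B .mat = false := by simp [hB, hmat]
  -- In the time bound, `4 * R + 10` is paid for each column and the last factor for each pivot
  -- found so far.
  refine Runs.tick_bind <| Runs.store_bind <| Runs.bind <| Runs.forIn_range
    (fun j σ' => (∀ a, A a = true → σ'.mem a = σ.mem a) ∧ σ'.mem .rk 0 0 ≤ R ∧
      σ'.mem .rk 0 0 ≤ j ∧ σ'.time ≤ σ.time + 2 + j * (4 * R + 10) +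
        σ'.mem .rk 0 0 * ((C + 1) * 5 + 2 + R * ((C + 1) * 4 + 5) + 5))
    ⟨keep hrk (fun _ _ => rfl) 0 0 0, ?_, ?_, ?_⟩ ?_ ?_
  · simp [Mem.write]
  · simp [Mem.write]
  · simp [Mem.write]
  · rintro j hj σ₁ ⟨h₁, h₂, h₃, h₄⟩
    refine Runs.tick_bind <| Runs.load_bind <| Runs.store_bind <| Runs.bind ?_
    dsimp only
    set r := σ₁.mem .rk 0 0 with hr
    -- A pivot is recorded only at an index `i` with `r ≤ i < R`. Hence a recorded pivot shows `r <
    -- R`, and the rank may still grow.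
    refine Runs.forIn_range (fun i σ₂ => (∀ a, B a = true → σ₂.mem a = σ₁.mem a) ∧
      (σ₂.mem .pivot 0 0 < R → r < R) ∧ σ₂.time ≤ σ₁.time + 3 + i * 4) ⟨?_, ?_, ?_⟩ ?_ ?_
    · intro a ha
      exact Mem.write_of_ne _ (by rintro rfl; simp [hB, hpiv] at ha) ..
    · simp [Mem.write]
    · simp
    · rintro i hi σ₂ ⟨h₅, h₆, h₇⟩
      refine Runs.tick_bind <| Runs.load_bind <| Runs.load_bind ?_
      dsimp only
      split_ifs with hc
      · refine Runs.store_bind <| Runs.pure ⟨rfl, ?_, fun _ => by omega, by simp only; omega⟩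
        intro a ha
        rw [← h₅ a ha]
        exact Mem.write_of_ne _ (by rintro rfl; simp [hB, hpiv] at ha) ..
      · exact Runs.pure ⟨rfl, h₅, h₆, by simp only; omega⟩
    · rintro σ₂ ⟨h₅, h₆, h₇⟩
      have hA₂ : ∀ a, A a = true → σ₂.mem a = σ.mem a := fun a ha => by
        rw [h₅ a (hBA a ha), h₁ a ha]
      have hr₂ : σ₂.mem .rk 0 0 = r := by rw [h₅ .rk (by simp [hB])]
      refine Runs.load_bind ?_
      split_ifs with hc
      · have hrR := h₆ hc
        refine Runs.bind <| (swapRows_steps hBmat C r _ ⟨σ₂.mem, σ₂.time + 1⟩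
          (m := σ₂.mem) fun _ _ => rfl).mono ?_
        rintro - σ₃ ⟨h₈, h₉, -⟩
        refine Runs.bind ?_
        refine ((forIn_range_const (A := B) (m := σ₂.mem) ((C + 1) * 4 + 2 + 1 + 1) fun i _ => ?_)
          σ₃ h₈).mono ?_
        · refine tick_bind <| load_bind' fun e => mono (ite_max (fun _ => bind
            (addRow_steps hBmat C r i) fun _ _ => pure rfl) fun _ => pure rfl) (by simp)
        rintro - σ₄ ⟨h₁₀, h₁₁, -⟩
        refine Runs.store_bind <| Runs.store_bind <| Runs.pure ⟨rfl, ?_, ?_, ?_, ?_⟩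
        · exact keep hrk (keep hpcol (fun a ha => by rw [h₁₀ a (hBA a ha), hA₂ a ha]) _ _ _) _ _ _
        · simp only [Mem.write_apply_zero, if_true]; omega
        · simp only [Mem.write_apply_zero, if_true]; omega
        · simp only [Mem.write_apply_zero, if_true]
          dsimp only at h₉
          rw [Nat.succ_mul j, Nat.succ_mul r]
          have : R * ((C + 1) * 4 + 2 + 1 + 1) ≤ R * ((C + 1) * 4 + 5) := Nat.mul_le_mul_left _ (by omega)
          omega
      · refine Runs.pure ⟨rfl, hA₂, ?_, ?_, ?_⟩
        · simp only [hr₂]; omega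
        · simp only [hr₂]; omega
        · simp only [hr₂]
          rw [Nat.succ_mul j]
          omega
  · rintro σ₁ ⟨h₁, h₂, h₃, h₄⟩
    refine Runs.pure ⟨h₁, h₄.trans ?_, h₂⟩
    have : σ₁.mem .rk 0 0 ≤ min R C := le_min h₂ h₃
    generalize σ₁.mem .rk 0 0 = r at this
    have h := Nat.mul_le_mul_right ((C + 1) * 5 + 2 + R * ((C + 1) * 4 + 5) + 5) this
    unfold eliminationWork
    generalize min R C = q at *
    have h' : 2 + C * (4 * R + 10) + q * ((C + 1) * 5 + 2 + R * ((C + 1) * 4 + 5) + 5) ≤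
        30 * ((R + 1) * (C + 1) * (q + 1)) := by
      ring_nf
      nlinarith [Nat.zero_le (R * C * q), Nat.zero_le (R * C), Nat.zero_le (R * q),
        Nat.zero_le (C * q)]
    omega

end RunsWithin

/-- Number of steps spent on the linear system of cluster `b`, up to a constant. -/
def solveWork (m : Mem) (b : ℕ) : ℕ :=
  eliminationWork (m .nc b 0) (m .nv b 0) + clusterEdgeWork m b

theorem succ_mul_succ_le_eliminationWork (R C : ℕ) :
    (R + 1) * (C + 1) ≤ eliminationWork R C := Nat.le_mul_of_pos_right _ (by omega)

theorem add_lt_eliminationWork (R C : ℕ) : R + C + 1 ≤ eliminationWork R C :=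
  le_trans (by nlinarith) (succ_mul_succ_le_eliminationWork R C)

namespace RunsWithin

variable {m : Mem}

theorem solve_steps {out : Arr} (hout : forestArrays out = false) (hrk : out ≠ .rk)
    (n b a : ℕ) :
    RunsWithin forestArrays m (solve n b a out) (100 * solveWork m b) fun _ => True := by
  intro σ hσ
  refine Runs.tick_bind <| Runs.load_bind <| Runs.load_bind ?_
  simp only [hσ .nc rfl, hσ .nv rfl]
  set R := m .nc b 0 with hR
  set C := m .nv b 0 with hC
  refine Runs.bind <| (buildSystem_steps (A := forestArrays) rfl rfl rfl rfl rfl n b a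
    ⟨σ.mem, σ.time + 1 + 1 + 1⟩ hσ).mono ?_
  rintro - σ₁ ⟨h₁, h₂, -⟩
  rw [← hR, ← hC] at h₂
  refine Runs.bind <| (eliminate_steps (A := forestArrays) rfl rfl rfl rfl R C σ₁).mono ?_
  rintro - σ₂ ⟨h₃, h₄, h₅⟩
  -- The rank is protected here too, so that its bound by `R` survives until it is read again; this
  -- is why `out` must differ from `.rk`.
  have h₆ := (forIn_range_const (A := fun a => forestArrays a || a = .rk) (m := σ₂.mem) (d := C)
    (f := fun j _ => do
      tick
      let y ← _root_.load .cvar b j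
      let (f, v) ← constraint b a y
      _root_.put out b j (if f then v else 0)
      return ForInStep.yield PUnit.unit) 12 fun j _ => mono (tick_bind <| load_bind' fun y =>
      bind (constraint_steps b a y) fun x _ => put_bind (by simp [hout, hrk]) <| pure rfl)
        (by simp)).runs
  refine Runs.bind <| h₆.mono ?_
  rintro - σ₃ ⟨h₇, h₈, -⟩
  have hrkR : σ₃.mem .rk 0 0 ≤ R := by rw [h₇ .rk (by simp)]; exact h₅
  refine Runs.load_bind ?_
  set r := σ₃.mem .rk 0 0
  refine Runs.mono (RunsWithin.mono (A := forestArrays) (m := m) (t' := r * 4 + (R * 4 + 1 + 1))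
    (R := fun _ => True) ?_ le_rfl ⟨σ₃.mem, σ₃.time + 1⟩ fun a ha => by
      rw [h₇ a (by simp [ha]), h₃ a ha, h₁ a ha]) ?_
  · refine bind (forIn_range_const 4 fun i _ => tick_bind <| load_bind' fun j =>
      load_bind' fun z => put_bind hout <| pure rfl) fun _ _ => store_bind rfl <|
      bind (forIn_range_const 4 fun i _ => ?_) fun _ _ => load_bind' fun _ => pure' trivial
    exact mono (tick_bind <| load_bind' fun z =>
      ite_max (fun _ => store_bind rfl <| pure rfl) fun _ => pure rfl) (by simp)
  rintro _ σ₄ ⟨h₁₀, h₁₁, -⟩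
  refine ⟨h₁₀, ?_, trivial⟩
  dsimp only at h₁₁ h₂
  have h₁₂ := succ_mul_succ_le_eliminationWork R C
  have h₁₃ := add_lt_eliminationWork R C
  unfold solveWork
  rw [← hR, ← hC]
  omega

end RunsWithin

/-! ### Recursion over the cluster forest -/

/-- The total weight of the nodes below `b`, in the forest in which the parent of `x` is `par x` if
this is larger than `x`. -/
def subtreeSum (par w : ℕ → ℕ) (b : ℕ) : ℕ :=
  w b + ∑ x : Fin b, if par x = b then subtreeSum par w x else 0

theorem subtreeSum_eq (par w : ℕ → ℕ) (b : ℕ) : subtreeSum par w b =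
    w b + ∑ x ∈ Finset.range b with par x = b, subtreeSum par w x := by
  rw [subtreeSum, Finset.sum_filter, Finset.sum_range]

/-- The subtrees of the roots are disjoint. -/
theorem sum_subtreeSum_le (par w : ℕ → ℕ) (N : ℕ) :
    ∑ b ∈ Finset.range N with par b = b, subtreeSum par w b ≤ ∑ b ∈ Finset.range N, w b := by
  -- All subtree sums together equal all weights plus the subtree sums of those nodes that occur as
  -- children. These are non-roots, each occurring once, so cancelling the non-roots leaves the
  -- bound for the roots.
  have h₁ := Finset.sum_filter_add_sum_filter_not (Finset.range N) (fun b => par b = b)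
    (subtreeSum par w)
  have h₂ : ∑ b ∈ Finset.range N, subtreeSum par w b = ∑ b ∈ Finset.range N, w b +
      ∑ b ∈ Finset.range N, ∑ x ∈ Finset.range b with par x = b, subtreeSum par w x := by
    rw [← Finset.sum_add_distrib]
    exact Finset.sum_congr rfl fun b _ => subtreeSum_eq par w b
  have h₃ : ∑ b ∈ Finset.range N, ∑ x ∈ Finset.range b with par x = b, subtreeSum par w x ≤
      ∑ b ∈ Finset.range N with par b ≠ b, subtreeSum par w b := by
    rw [← Finset.sum_biUnion]
    · refine Finset.sum_le_sum_of_subset fun x hx => ?_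
      simp only [Finset.mem_biUnion, Finset.mem_filter, Finset.mem_range] at hx ⊢
      obtain ⟨b, hb, hx, rfl⟩ := hx
      exact ⟨by omega, by omega⟩
    · intro b _ b' _ hbb
      refine Finset.disjoint_left.2 fun x hx hx' => hbb ?_
      simp only [Finset.mem_filter] at hx hx'
      rw [← hx.2, hx'.2]
  simp only [ne_eq] at h₃
  omega

/-- The cluster forest with clusters numbered `0, …, nblk - 1`, children before their parents. -/
structure IsForest (m : Mem) : Prop where
  child_lt : ∀ b < m .nblk 0 0, ∀ x, ((∃ j < m .nv b 0, m .cvar b j = x) ∨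
    ∃ i < m .nc b 0, m .cchk b i = x) → m .blk x 0 = b → ∀ k < m .nchd x 0, m .chd x k < b
  top_child : ∀ x, ∀ k < m .nchd x 0, m .top (m .chd x k) 0 = x
  child_inj : ∀ x, Set.InjOn (m .chd x) (Set.Iio (m .nchd x 0))
  cvar_inj : ∀ b < m .nblk 0 0, Set.InjOn (m .cvar b) (Set.Iio (m .nv b 0))
  cchk_inj : ∀ b < m .nblk 0 0, Set.InjOn (m .cchk b) (Set.Iio (m .nc b 0))
  cvar_ne_cchk : ∀ b < m .nblk 0 0, ∀ j < m .nv b 0, ∀ i < m .nc b 0, m .cvar b j ≠ m .cchk b i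
  root_lt : ∀ q < m .nroot 0 0, m .root q 0 < m .nblk 0 0
  blk_top_root : ∀ q < m .nroot 0 0, m .blk (m .top (m .root q 0) 0) 0 = m .root q 0
  root_inj : Set.InjOn (fun q => m .root q 0) (Set.Iio (m .nroot 0 0))

/-- The parent cluster of a cluster that is not a root; a root is its own parent. -/
def parentCluster (m : Mem) (b : ℕ) : ℕ := m .blk (m .top b 0) 0

/-- Links the traversal by the program to the abstract forest. No child is met twice: the lists have
no repetitions, variables and checks are disjoint, and a child cluster is stored only at its topmost
node. -/
theorem IsForest.sum_children_le {m : Mem} (hm : IsForest m) (W : ℕ → ℕ) {b : ℕ}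
    (hb : b < m .nblk 0 0) :
    (∑ j ∈ Finset.range (m .nv b 0), if m .blk (m .cvar b j) 0 = b then
        ∑ k ∈ Finset.range (m .nchd (m .cvar b j) 0), W (m .chd (m .cvar b j) k) else 0) +
      (∑ i ∈ Finset.range (m .nc b 0), if m .blk (m .cchk b i) 0 = b then
        ∑ k ∈ Finset.range (m .nchd (m .cchk b i) 0), W (m .chd (m .cchk b i) k) else 0) ≤
    ∑ x ∈ Finset.range b with parentCluster m x = b, W x := by
  classical
  set ch : ℕ → Finset ℕ := fun v => (Finset.range (m .nchd v 0)).image (m .chd v) with hch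
  set L := (Finset.range (m .nv b 0)).image (m .cvar b) with hL
  set L' := (Finset.range (m .nc b 0)).image (m .cchk b) with hL'
  have hsum : ∀ v, ∑ k ∈ Finset.range (m .nchd v 0), W (m .chd v k) = ∑ x ∈ ch v, W x := by
    intro v
    rw [Finset.sum_image]
    intro k hk k' hk' h
    exact hm.child_inj v (by simpa using hk) (by simpa using hk') h
  simp only [hsum]
  have h₁ : ∀ f : ℕ → ℕ, ∑ j ∈ Finset.range (m .nv b 0), f (m .cvar b j) = ∑ v ∈ L, f v := by
    intro f
    rw [Finset.sum_image]
    intro k hk k' hk' h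
    exact hm.cvar_inj b hb (by simpa using hk) (by simpa using hk') h
  have h₂ : ∀ f : ℕ → ℕ, ∑ j ∈ Finset.range (m .nc b 0), f (m .cchk b j) = ∑ v ∈ L', f v := by
    intro f
    rw [Finset.sum_image]
    intro k hk k' hk' h
    exact hm.cchk_inj b hb (by simpa using hk) (by simpa using hk') h
  rw [h₁ (fun v => if m .blk v 0 = b then ∑ x ∈ ch v, W x else 0),
    h₂ (fun v => if m .blk v 0 = b then ∑ x ∈ ch v, W x else 0), ← Finset.sum_union]
  · rw [← Finset.sum_filter, ← Finset.sum_biUnion]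
    · refine Finset.sum_le_sum_of_subset fun x hx => ?_
      simp only [hch, hL, hL', Finset.mem_biUnion, Finset.mem_filter, Finset.mem_union,
        Finset.mem_image, Finset.mem_range] at hx
      obtain ⟨v, ⟨hv, hvb⟩, k, hk, rfl⟩ := hx
      rw [Finset.mem_filter, Finset.mem_range, parentCluster, hm.top_child v k hk]
      exact ⟨hm.child_lt b hb v hv hvb k hk, hvb⟩
    · intro v _ v' _ hvv
      refine Finset.disjoint_left.2 fun x hx hx' => hvv ?_
      simp only [hch, Finset.mem_image, Finset.mem_range] at hx hx'
      obtain ⟨k, hk, rfl⟩ := hx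
      obtain ⟨k', hk', h⟩ := hx'
      rw [← hm.top_child v k hk, ← h, hm.top_child v' k' hk']
  · refine Finset.disjoint_left.2 fun x hx hx' => ?_
    simp only [hL, hL', Finset.mem_image, Finset.mem_range] at hx hx'
    obtain ⟨j, hj, rfl⟩ := hx
    obtain ⟨i, hi, h⟩ := hx'
    exact hm.cvar_ne_cchk b hb j hj i hi h.symm

/-- The number of adjacency list entries inspected when the contributions of cluster `b` to its
child check nodes are computed. -/
def contributionWork (m : Mem) (b : ℕ) : ℕ :=
  ∑ i ∈ Finset.range (m .nc b 0), if m .blk (m .cchk b i) 0 = b then m .deg (m .cchk b i) 0 else 0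

/-- Bound for the number of steps spent on cluster `b` itself. -/
def clusterWork (m : Mem) (b : ℕ) : ℕ := 300 * (solveWork m b + contributionWork m b)

/-- Bound for the number of steps spent on cluster `b` and the clusters below it. -/
def subtreeWork (m : Mem) : ℕ → ℕ := subtreeSum (parentCluster m) (clusterWork m)

theorem length_lt_solveWork (m : Mem) (b : ℕ) : m .nv b 0 + m .nc b 0 + 1 ≤ solveWork m b := by
  have := add_lt_eliminationWork (m .nc b 0) (m .nv b 0)
  unfold solveWork
  omega

/-- A reserve of 20 steps per cluster. The recursive procedures are shown to stay 20 below
`subtreeWork`, so the loops of the calling cluster over its children are paid for by the children.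
-/
theorem le_subtreeWork (m : Mem) (b : ℕ) : 20 ≤ subtreeWork m b := by
  rw [subtreeWork, subtreeSum_eq, clusterWork]
  have := length_lt_solveWork m b
  omega

theorem sum_range_sub_add_le {d c : ℕ} {f : ℕ → ℕ} (hf : ∀ k, 20 ≤ f k) (hc : c ≤ 20) :
    ∑ k ∈ Finset.range d, (f k - 20) + d * c ≤ ∑ k ∈ Finset.range d, f k := by
  have : d * c = ∑ k ∈ Finset.range d, c := by simp
  rw [this, ← Finset.sum_add_distrib]
  exact Finset.sum_le_sum fun k _ => by have := hf k; omega

namespace RunsWithin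

variable {m : Mem}

/-- Induction on the depth parameter: children have smaller numbers than `b`, so any depth above `b`
suffices. The labels found below `b` do not enter the bound, since both outcomes of every test are
covered. -/
theorem recursiveCompute_steps (hm : IsForest m) (n : ℕ) : ∀ h b, b < h → b < m .nblk 0 0 →
    RunsWithin forestArrays m (recursiveCompute h n b) (subtreeWork m b - 20) fun _ => True := by
  intro h
  induction h with
  | zero => intro b hb; omega
  | succ h ih =>
  intro b hb hbN
  have hW := le_subtreeWork m
  have hchild : ∀ v, ((∃ j < m .nv b 0, m .cvar b j = v) ∨ ∃ i < m .nc b 0, m .cchk b i = v) →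
      m .blk v 0 = b → ∀ k < m .nchd v 0, RunsWithin forestArrays m
        (recursiveCompute h n (m .chd v k)) (subtreeWork m (m .chd v k) - 20) fun _ => True :=
    fun v hv hvb k hk => by
      have := hm.child_lt b hbN v hv hvb k hk
      exact ih _ (by omega) (by omega)
  set S : ℕ → ℕ := fun v => if m .blk v 0 = b then
    ∑ k ∈ Finset.range (m .nchd v 0), subtreeWork m (m .chd v k) else 0 with hS
  have hsum := hm.sum_children_le (subtreeWork m) hbN
  refine mono (t := ∑ j ∈ Finset.range (m .nv b 0), (10 + S (m .cvar b j)) + (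
    (∑ i ∈ Finset.range (m .nc b 0), (10 + S (m .cchk b i)) + (3 +
      max (100 * solveWork m b + (0 + 1 + 1))
        (100 * solveWork m b + (100 * solveWork m b + max (0 + 1) (0 + 1 + 1))))) + 1) + 1 + 1) ?_ ?_
  · refine tick_bind <| load_bind rfl <| bind (forIn_range _ fun j hj => ?_) fun _ _ =>
      load_bind rfl <| bind (forIn_range _ fun i hi => ?_) fun _ _ =>
      bind (isRoot_steps b) fun r _ => ite_max (fun _ => ?_) fun _ => ?_
    · have hj' := hchild _ (Or.inl ⟨j, hj, rfl⟩)
      set v := m .cvar b j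
      refine mono (t := (if m .blk v 0 = b then (∑ k ∈ Finset.range (m .nchd v 0),
          (subtreeWork m (m .chd v k) - 20 + 1 + 1 + 1)) + (m .nchd v 0 * 6 + 1) + 1 else 0) + 1 + 1 + 1) ?_ ?_
      · refine tick_bind <| load_bind rfl <| load_bind rfl <| ite (fun hv => ?_) fun _ => pure rfl
        refine load_bind rfl <| bind (forIn_range _ fun k hk => ?_) fun _ _ =>
          bind (forIn_range_const 6 fun k hk => ?_) fun _ _ => pure' rfl
        · exact tick_bind <| load_bind rfl <| mono (bind (hj' hv k hk) fun _ _ => pure rfl)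
            (by omega)
        · exact mono (tick_bind <| load_bind' fun _ => load_bind' fun _ => ite_max
            (fun _ => load_bind' fun _ => store_bind rfl <| store_bind rfl <| pure rfl)
              fun _ => pure rfl) (by simp)
      · simp only [hS]
        split_ifs
        · simp only [Finset.sum_add_distrib, Finset.sum_const, Finset.card_range, smul_eq_mul]
          -- Per child, 3 steps accompany the recursive call and 6 evaluate its label; both come out
          -- of its reserve.
          have := sum_range_sub_add_le (d := m .nchd v 0) (c := 9) (fun k => hW (m .chd v k))
            (by norm_num)
          omega
        · omega
    · have hi' := hchild _ (Or.inr ⟨i, hi, rfl⟩)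
      set v := m .cchk b i
      refine mono (t := (if m .blk v 0 = b then (∑ k ∈ Finset.range (m .nchd v 0),
          (subtreeWork m (m .chd v k) - 20 + 1 + 1 + 1)) + (m .nchd v 0 * 6 + 1 + 1 + 1 + 1) + 1 else 0) + 1 + 1 + 1) ?_ ?_
      · refine tick_bind <| load_bind rfl <| load_bind rfl <| ite (fun hv => ?_) fun _ => pure rfl
        refine load_bind rfl <| bind (forIn_range _ fun k hk => ?_) fun _ _ =>
          load_bind' fun _ => store_bind rfl <| store_bind rfl <|
          bind (forIn_range_const 6 fun k hk => ?_) fun _ _ => pure' rfl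
        · exact tick_bind <| load_bind rfl <| mono (bind (hi' hv k hk) fun _ _ => pure rfl)
            (by omega)
        · exact mono (tick_bind <| load_bind' fun _ => load_bind' fun _ => ite_max
            (fun _ => load_bind' fun _ => load_bind' fun _ => store_bind rfl <| pure rfl)
              fun _ => store_bind rfl <| pure rfl) (by simp)
      · simp only [hS]
        split_ifs
        · simp only [Finset.sum_add_distrib, Finset.sum_const, Finset.card_range, smul_eq_mul]
          have := sum_range_sub_add_le (d := m .nchd v 0) (c := 9) (fun k => hW (m .chd v k))
            (by norm_num)
          omega
        · omega
    · exact bind (solve_steps rfl (by simp) n b 0) fun _ _ => store_bind rfl <| store_bind rfl <|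
        pure trivial
    · exact bind (solve_steps rfl (by simp) n b 0) fun _ _ =>
        bind (solve_steps rfl (by simp) n b 1) fun _ _ =>
        ite_max (fun _ => store_bind rfl <| pure trivial) fun _ =>
        store_bind rfl <| store_bind rfl <| pure trivial
  · have h₁ := length_lt_solveWork m b
    rw [subtreeWork, subtreeSum_eq, clusterWork]
    simp only [Finset.sum_add_distrib, Finset.sum_const, Finset.card_range, smul_eq_mul]
    simp only [hS]
    simp only [subtreeWork] at hsum ⊢
    omega

end RunsWithin

/-! ### Selection of solutions and merging -/

/-- The arrays that the selection of solutions relies on. -/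
def selectionArrays (a : Arr) : Bool := forestArrays a || a = .froz

/-- The selection is analysed relative to the memory left by the first stage, where the labels are
new but the forest is the same. This and `IsForest.congr` carry the bounds over. -/
theorem subtreeWork_congr {m m' : Mem} (h : ∀ a, forestArrays a = true → m' a = m a) : subtreeWork m' = subtreeWork m := by
  have h₁ : parentCluster m' = parentCluster m := by
    funext b; simp only [parentCluster, h .blk rfl, h .top rfl]
  have h₂ : clusterWork m' = clusterWork m := by
    funext b
    simp only [clusterWork, solveWork, clusterEdgeWork, edgeWork, contributionWork, h .blk rfl,
      h .top rfl, h .nv rfl, h .nc rfl, h .cvar rfl, h .cchk rfl, h .deg rfl]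
  rw [subtreeWork, h₁, h₂, subtreeWork]

theorem IsForest.congr {m m' : Mem} (h : ∀ a, forestArrays a = true → m' a = m a)
    (hm : IsForest m) : IsForest m' := by
  obtain ⟨h₁, h₂, h₃, h₄, h₅, h₆, h₇, h₈, h₉⟩ := hm
  constructor <;> simpa only [h .blk rfl, h .top rfl, h .nv rfl, h .nc rfl, h .cvar rfl,
    h .cchk rfl, h .nblk rfl, h .nchd rfl, h .chd rfl, h .nroot rfl, h .root rfl]

namespace RunsWithin

variable {m : Mem}

theorem subtractContribution_steps (b c : ℕ) :
    RunsWithin selectionArrays m (subtractContribution b c) (m .deg c 0 * 12 + 5) fun _ => True := by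
  refine mono (t := m .deg c 0 * 12 + 1 + 1 + 1 + 1) ?_ (by omega)
  refine tick_bind <| load_bind' fun u => load_bind rfl <|
    bind (forIn_range_const 12 fun k _ => ?_) fun _ _ => pure' trivial
  refine mono (tick_bind <| load_bind' fun x => load_bind' fun b' => ite_max (fun _ =>
    bind (position_steps b x) fun p _ => bind (selectedValue_steps b p) fun z _ =>
      load_bind' fun s => store_bind rfl <| pure rfl) fun _ => pure rfl) (by simp)

/-- The child clusters of a check are passed over twice, once for the frozen and once for the free
ones. As the labels are protected, each child is entered in exactly one pass; without this its
subtree would be counted twice at every level. -/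
theorem recursiveSelect_steps (hm : IsForest m) : ∀ h b a, b < h → b < m .nblk 0 0 →
    RunsWithin selectionArrays m (recursiveSelect h b a) (subtreeWork m b - 20) fun _ => True := by
  intro h
  induction h with
  | zero => intro b a hb; omega
  | succ h ih =>
  intro b a hb hbN
  have hW := le_subtreeWork m
  have hchild : ∀ v, ((∃ j < m .nv b 0, m .cvar b j = v) ∨ ∃ i < m .nc b 0, m .cchk b i = v) →
      m .blk v 0 = b → ∀ k < m .nchd v 0, ∀ a, RunsWithin selectionArrays m
        (recursiveSelect h (m .chd v k) a) (subtreeWork m (m .chd v k) - 20) fun _ => True :=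
    fun v hv hvb k hk a => by
      have := hm.child_lt b hbN v hv hvb k hk
      exact ih _ a (by omega) (by omega)
  set S : ℕ → ℕ := fun v => if m .blk v 0 = b then
    ∑ k ∈ Finset.range (m .nchd v 0), subtreeWork m (m .chd v k) else 0 with hS
  set D : ℕ → ℕ := fun v => if m .blk v 0 = b then m .deg v 0 else 0 with hD
  have hsum := hm.sum_children_le (subtreeWork m) hbN
  refine mono (t := max (∑ j ∈ Finset.range (m .nv b 0), (10 + S (m .cvar b j)) + (
    (∑ i ∈ Finset.range (m .nc b 0), (30 + D (m .cchk b i) * 12 + S (m .cchk b i)) + 1) + 1) +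
      1 + 1 + 1) (∑ j ∈ Finset.range (m .nv b 0), (10 + S (m .cvar b j)) + (
    (∑ i ∈ Finset.range (m .nc b 0), (30 + D (m .cchk b i) * 12 + S (m .cchk b i)) + 1) + 1) +
      1 + 1) + 1 + 1) ?_ ?_
  · rw [recursiveSelect]
    refine tick_bind <| load_bind' fun f => ?_
    dsimp only
    refine ite_max (fun _ => load_bind' fun z => store_bind rfl ?_) fun _ => store_bind rfl ?_
    all_goals
      refine load_bind rfl <| bind (forIn_range _ fun j hj => ?_) fun _ _ =>
        load_bind rfl <| bind (forIn_range _ fun i hi => ?_) fun _ _ => pure' trivial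
      · have hj' := hchild _ (Or.inl ⟨j, hj, rfl⟩)
        set v := m .cvar b j
        refine mono (t := (if m .blk v 0 = b then 3 + ((∑ k ∈ Finset.range (m .nchd v 0),
            (subtreeWork m (m .chd v k) - 20 + 1 + 1 + 1)) + 1 + 1) else 0) + 1 + 1 + 1) ?_ ?_
        · refine tick_bind <| load_bind rfl <| load_bind rfl <| ite (fun hv => ?_) fun _ => pure rfl
          refine bind (selectedValue_steps b j) fun z _ => load_bind rfl <|
            bind (forIn_range _ fun k hk => ?_) fun _ _ => pure' rfl
          exact tick_bind <| load_bind rfl <| mono (bind (hj' hv k hk z) fun _ _ => pure rfl)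
            (by omega)
        · simp only [hS]
          split_ifs
          · simp only [Finset.sum_add_distrib, Finset.sum_const, Finset.card_range, smul_eq_mul]
            have := sum_range_sub_add_le (d := m .nchd v 0) (c := 3) (fun k => hW (m .chd v k))
              (by norm_num)
            omega
          · omega
      · have hi' := hchild _ (Or.inr ⟨i, hi, rfl⟩)
        set v := m .cchk b i
        refine mono (t := (if m .blk v 0 = b then max (m .deg v 0 * 12 + 5 + (
          ∑ k ∈ Finset.range (m .nchd v 0), ((if m .froz (m .chd v k) 0 = 1 then
            subtreeWork m (m .chd v k) - 20 + 1 + 1 + 1 + 1 else 0) + 1 + 1 + 1) + (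
          ∑ k ∈ Finset.range (m .nchd v 0), ((if m .froz (m .chd v k) 0 ≠ 1 then
            subtreeWork m (m .chd v k) - 20 + 1 + 1 + 1 else 0) + 1 + 1 + 1) + 1)) + 1 + 1) 0 + 1
              else 0) + 1 + 1 + 1) ?_ ?_
        · refine tick_bind <| load_bind rfl <| load_bind rfl <| ite (fun hv => ?_) fun _ => pure rfl
          refine load_bind rfl <| ite_max (fun _ => ?_) fun _ => pure rfl
          refine load_bind' fun s => store_bind rfl <|
            bind (subtractContribution_steps b v) fun _ _ =>
            bind (forIn_range _ fun k hk => ?_) fun _ _ =>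
            bind (forIn_range _ fun k hk => ?_) fun _ _ => pure' rfl
          · exact tick_bind <| load_bind rfl <| load_bind rfl <| ite (fun _ =>
              load_bind' fun z => load_bind' fun s' => store_bind rfl <|
              mono (bind (hi' hv k hk z) fun _ _ => pure rfl) (Nat.le_succ _)) fun _ => pure rfl
          · exact tick_bind <| load_bind rfl <| load_bind rfl <| ite (fun _ =>
              load_bind' fun s' => store_bind rfl <|
              mono (bind (hi' hv k hk s') fun _ _ => pure rfl) (Nat.le_succ _)) fun _ => pure rfl
        · simp only [hS, hD]
          split_ifs
          · rw [max_eq_left (Nat.zero_le _)]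
            have h₁ : ∀ f g u : ℕ → ℕ, (∀ k, f k + g k ≤ u k) →
                ∑ k ∈ Finset.range (m .nchd v 0), f k + ∑ k ∈ Finset.range (m .nchd v 0), g k ≤
                ∑ k ∈ Finset.range (m .nchd v 0), u k := fun f g u h => by
              rw [← Finset.sum_add_distrib]
              exact Finset.sum_le_sum fun k _ => h k
            -- Whatever its label, the steps for a child in both passes together fit into its
            -- `subtreeWork`.
            have h₂ := h₁ (fun k => (if m .froz (m .chd v k) 0 = 1 then
              subtreeWork m (m .chd v k) - 20 + 1 + 1 + 1 + 1 else 0) + 1 + 1 + 1)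
              (fun k => (if m .froz (m .chd v k) 0 ≠ 1 then
                subtreeWork m (m .chd v k) - 20 + 1 + 1 + 1 else 0) + 1 + 1 + 1)
              (fun k => subtreeWork m (m .chd v k)) fun k => by
                have := hW (m .chd v k)
                split_ifs <;> omega
            omega
          · omega
  · have h₁ := length_lt_solveWork m b
    rw [subtreeWork, subtreeSum_eq, clusterWork, contributionWork]
    simp only [Finset.sum_add_distrib, Finset.sum_const, Finset.card_range, smul_eq_mul,
      ← Finset.sum_mul]
    simp only [hS, hD]
    simp only [subtreeWork] at hsum ⊢
    omega

theorem mergeSolutions_steps :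
    RunsWithin selectionArrays m mergeSolutions
      (∑ b ∈ Finset.range (m .nblk 0 0), (m .nv b 0 * 6 + 4) + 3) fun _ => True := by
  refine mono (t := ∑ b ∈ Finset.range (m .nblk 0 0), (m .nv b 0 * 6 + 1 + 1 + 1) + 1 + 1 + 1)
    ?_ (by
      simp only [Finset.sum_add_distrib, Finset.sum_const, smul_eq_mul]; omega)
  refine tick_bind <| load_bind rfl <| bind (forIn_range _ fun b _ => ?_) fun _ _ => pure' trivial
  refine tick_bind <| load_bind rfl <| bind (forIn_range_const 6 fun j _ => ?_) fun _ _ => pure' rfl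
  exact mono (tick_bind <| load_bind rfl <| bind (selectedValue_steps b j) fun z _ =>
    store_bind rfl <| pure rfl) (by simp)

/-- The two stages and the merging, once the cluster forest has been built. -/
theorem stages_runsWithin (hm : IsForest m) {h n : ℕ} (hh : m .nblk 0 0 < h) :
    RunsWithin forestArrays m (do
      let t ← _root_.load .nroot 0
      for k in List.range t do
        tick
        let b ← _root_.load .root k
        recursiveCompute h n b
        recursiveSelect h b 0
      mergeSolutions)
      (3 * ∑ b ∈ Finset.range (m .nblk 0 0), clusterWork m b + 4) fun _ => True := by
  -- Of the factor 3, two parts pay for the two recursions and one for merging.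
  refine mono (t := ∑ q ∈ Finset.range (m .nroot 0 0), 2 * subtreeWork m (m .root q 0) +
    (∑ b ∈ Finset.range (m .nblk 0 0), (m .nv b 0 * 6 + 4) + 3) + 1) ?_ ?_
  · refine load_bind rfl <| bind (forIn_range _ fun q hq => ?_) fun _ _ => ?_
    · have hW := le_subtreeWork m (m .root q 0)
      have hN := hm.root_lt q hq
      refine mono (t := (subtreeWork m (m .root q 0) - 20 +
        (subtreeWork m (m .root q 0) - 20 + 0)) + 1 + 1) ?_ (by omega)
      refine tick_bind <| load_bind rfl <|
        bind (recursiveCompute_steps hm n h _ (by omega) hN) fun _ _ => bind (R' := fun _ => True) ?_ fun _ _ => pure rfl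
      -- From here on the reference memory is `σ.mem`, in which the labels have been computed.
      intro σ hσ
      have := recursiveSelect_steps (m := σ.mem) (hm.congr hσ) h (m .root q 0) 0 (by omega)
        (by rwa [hσ .nblk rfl])
      rw [subtreeWork_congr hσ] at this
      refine (this.runs).mono fun _ _ ⟨h₁, h₂, h₃⟩ => ⟨fun a ha => ?_, h₂, h₃⟩
      rw [h₁ a (by simp [selectionArrays, ha]), hσ a ha]
    · intro σ hσ
      have := mergeSolutions_steps (m := σ.mem)
      simp only [hσ .nblk rfl, hσ .nv rfl] at this
      refine (this.runs).mono fun _ _ ⟨h₁, h₂, h₃⟩ => ⟨fun a ha => ?_, h₂, h₃⟩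
      rw [h₁ a (by simp [selectionArrays, ha]), hσ a ha]
  · have h₁ : ∑ q ∈ Finset.range (m .nroot 0 0), subtreeWork m (m .root q 0) ≤
        ∑ b ∈ Finset.range (m .nblk 0 0), clusterWork m b := by
      rw [← Finset.sum_image (f := subtreeWork m) (g := fun q => m .root q 0)
        fun q hq q' hq' h => hm.root_inj (by simpa using hq) (by simpa using hq') h]
      refine le_trans (Finset.sum_le_sum_of_subset fun b hb => ?_)
        (sum_subtreeSum_le (parentCluster m) _ _)
      simp only [Finset.mem_image, Finset.mem_range, Finset.mem_filter] at hb ⊢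
      obtain ⟨q, hq, rfl⟩ := hb
      exact ⟨hm.root_lt q hq, hm.blk_top_root q hq⟩
    have h₂ : ∑ b ∈ Finset.range (m .nblk 0 0), (m .nv b 0 * 6 + 4) ≤
        ∑ b ∈ Finset.range (m .nblk 0 0), clusterWork m b := by
      refine Finset.sum_le_sum fun b _ => ?_
      have := length_lt_solveWork m b
      unfold clusterWork
      omega
    rw [← Finset.mul_sum]
    omega

end RunsWithin

/-! ### Biconnected sets of nodes -/

/-- There is a walk from `x` to `y` inside `X`. -/
def Linked (G : SimpleGraph ℕ) (X : Set ℕ) : ℕ → ℕ → Prop :=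
  Relation.ReflTransGen fun x y => G.Adj x y ∧ x ∈ X ∧ y ∈ X

/-- `X` stays connected when any node is removed. -/
def StaysConnected (G : SimpleGraph ℕ) (X : Set ℕ) : Prop :=
  ∀ v, ∀ x ∈ X \ {v}, ∀ y ∈ X \ {v}, Linked G (X \ {v}) x y

/-- The set `T` with topmost node `u` is connected, and when a node `v` is removed from it, every
other node is still connected to `u` or to a node with a neighbour in `Γ`. -/
structure IsSegment (G : SimpleGraph ℕ) (T : Set ℕ) (u : ℕ) (Γ : Set ℕ) : Prop where
  mem : u ∈ T
  linked : ∀ y ∈ T, Linked G T y u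
  avoid : ∀ v ∈ T, ∀ y ∈ T, y ≠ v → (u ≠ v ∧ Linked G (T \ {v}) y u) ∨
    ∃ z ∈ T, z ≠ v ∧ Linked G (T \ {v}) y z ∧ ∃ a ∈ Γ, G.Adj z a

section

variable {G : SimpleGraph ℕ} {X Y T T' Γ : Set ℕ} {u w x y z : ℕ}

namespace Linked

theorem refl (x : ℕ) : Linked G X x x := Relation.ReflTransGen.refl

theorem mono (h : Linked G X x y) (hXY : X ⊆ Y) : Linked G Y x y := by
  induction h with
  | refl => exact refl _
  | tail _ h ih => exact ih.tail ⟨h.1, hXY h.2.1, hXY h.2.2⟩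

theorem symm (h : Linked G X x y) : Linked G X y x := by
  induction h with
  | refl => exact refl _
  | tail _ h ih => exact .head ⟨h.1.symm, h.2.2, h.2.1⟩ ih

theorem trans (h : Linked G X x y) (h' : Linked G X y z) : Linked G X x z :=
  Relation.ReflTransGen.trans h h'

theorem of_adj (h : G.Adj x y) (hx : x ∈ X) (hy : y ∈ X) : Linked G X x y :=
  .single ⟨h, hx, hy⟩

end Linked

theorem staysConnected_singleton : StaysConnected G {u} := by
  rintro v x ⟨rfl, hx⟩ y ⟨rfl, -⟩
  exact .refl _

namespace IsSegment

theorem singleton : IsSegment G {u} u Γ where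
  mem := rfl
  linked := by rintro y rfl; exact .refl _
  avoid := by rintro v rfl y rfl h; exact absurd rfl h

/-- A segment without exits is trivial. -/
theorem eq_singleton (h : IsSegment G T u ∅) : T = {u} := by
  refine Set.eq_singleton_iff_unique_mem.2 ⟨h.mem, fun y hy => ?_⟩
  by_contra hne
  -- With `u` itself removed, any other node would need an exit.
  obtain ⟨h, -⟩ | ⟨z, -, -, -, a, ha, -⟩ := h.avoid u h.mem y hy hne
  exacts [h rfl, ha]

/-- The exits of the child segment `T'` lead to `u` or to `Γ`. Removing a node of `T'` leaves `T`
intact, so a piece of `T'` whose exit is `u` is joined to the top. Removing a node of `T`, possibly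
`u`, leaves `T'` intact, and it escapes to `Γ` by `hexit`: this is exactly why `u` does not separate
`T'` from the ancestors. -/
theorem union (h : IsSegment G T u Γ) (h' : IsSegment G T' w (insert u Γ)) (huw : G.Adj u w)
    (hd : Disjoint T T') (hexit : ∃ z ∈ T', ∃ a ∈ Γ, G.Adj z a) : IsSegment G (T ∪ T') u Γ where
  mem := Or.inl h.mem
  linked := by
    rintro y (hy | hy)
    · exact (h.linked y hy).mono Set.subset_union_left
    · exact ((h'.linked y hy).mono Set.subset_union_right).trans
        (.of_adj huw.symm (Or.inr h'.mem) (Or.inl h.mem))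
  avoid := by
    have sub : ∀ {v}, v ∈ T' → T ⊆ (T ∪ T') \ {v} := fun hv x hx =>
      ⟨Or.inl hx, by rintro rfl; exact Set.disjoint_left.1 hd hx hv⟩
    have sub' : ∀ {v}, v ∈ T → T' ⊆ (T ∪ T') \ {v} := fun hv x hx =>
      ⟨Or.inr hx, by rintro rfl; exact Set.disjoint_left.1 hd hv hx⟩
    rintro v (hv | hv) y (hy | hy) hyv
    · obtain ⟨h₁, h₂⟩ | ⟨z, hz, hzv, h₁, h₂⟩ := h.avoid v hv y hy hyv
      · exact Or.inl ⟨h₁, h₂.mono (Set.sdiff_subset_sdiff_left Set.subset_union_left)⟩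
      · exact Or.inr ⟨z, Or.inl hz, hzv,
          h₁.mono (Set.sdiff_subset_sdiff_left Set.subset_union_left), h₂⟩
    -- The removed node lies in `T` and `y` in `T'`; `y` walks inside `T'` to the exit.
    · obtain ⟨z, hz, hza⟩ := hexit
      refine Or.inr ⟨z, Or.inr hz, (sub' hv hz).2, ?_, hza⟩
      exact ((h'.linked y hy).trans (h'.linked z hz).symm).mono (sub' hv)
    · exact Or.inl ⟨(sub hv h.mem).2, (h.linked y hy).mono (sub hv)⟩
    · have huv : u ≠ v := (sub hv h.mem).2
      obtain ⟨h₁, h₂⟩ | ⟨z, hz, hzv, h₁, a, rfl | ha, h₂⟩ := h'.avoid v hv y hy hyv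
      · exact Or.inl ⟨huv, (h₂.mono (Set.sdiff_subset_sdiff_left Set.subset_union_right)).trans
          (.of_adj huw.symm ⟨Or.inr h'.mem, h₁⟩ (sub hv h.mem))⟩
      · exact Or.inl ⟨huv, (h₁.mono (Set.sdiff_subset_sdiff_left Set.subset_union_right)).trans
          (.of_adj h₂ ⟨Or.inr hz, hzv⟩ (sub hv h.mem))⟩
      · exact Or.inr ⟨z, Or.inr hz, hzv,
          h₁.mono (Set.sdiff_subset_sdiff_left Set.subset_union_right), a, ha, h₂⟩

/-- After a removal inside `T`, every remaining node reaches `w`, a neighbour of `u`, or a node with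
an exit, and the only possible exit is `u`. Thus everything is joined to `u`; if `u` is removed, `T`
is connected by itself. -/
theorem staysConnected_insert (h : IsSegment G T w Γ) (huw : G.Adj u w) (hu : u ∉ T)
    (hexit : ∀ z ∈ T, ∀ a ∈ Γ, G.Adj z a → a = u) : StaysConnected G (insert u T) := by
  intro v
  by_cases hvu : v = u
  · subst hvu
    have : T ⊆ insert v T \ {v} := fun x hx => ⟨Or.inr hx, by rintro rfl; exact hu hx⟩
    rintro x ⟨rfl | hx, hxv⟩ y ⟨rfl | hy, hyv⟩
    · exact .refl _
    · exact absurd rfl hxv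
    · exact absurd rfl hyv
    · exact ((h.linked x hx).trans (h.linked y hy).symm).mono this
  · have hu' : u ∈ insert u T \ {v} := ⟨Or.inl rfl, Ne.symm hvu⟩
    suffices H : ∀ x ∈ insert u T \ {v}, Linked G (insert u T \ {v}) x u from
      fun x hx y hy => (H x hx).trans (H y hy).symm
    rintro x ⟨rfl | hx, hxv⟩
    · exact .refl _
    have sub : T \ {v} ⊆ insert u T \ {v} := Set.sdiff_subset_sdiff_left (Set.subset_insert ..)
    by_cases hv : v ∈ T
    · obtain ⟨h₁, h₂⟩ | ⟨z, hz, hzv, h₁, a, ha, h₂⟩ := h.avoid v hv x hx hxv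
      · exact (h₂.mono sub).trans (.of_adj huw.symm ⟨Or.inr h.mem, h₁⟩ hu')
      · obtain rfl := hexit z hz a ha h₂
        exact (h₁.mono sub).trans (.of_adj h₂ ⟨Or.inr hz, hzv⟩ hu')
    · have sub' : T ⊆ insert u T \ {v} := fun y hy => ⟨Or.inr hy, by rintro rfl; exact hv hy⟩
      exact ((h.linked x hx).mono sub').trans (.of_adj huw.symm (sub' h.mem) hu')

end IsSegment

end

/-! ### Creating clusters -/

/-- The lists of cluster `b` contain exactly the nodes in `X`, without repetition. -/
structure IsNodeList (n : ℕ) (m : Mem) (b : ℕ) (X : Finset ℕ) : Prop where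
  vars : Set.BijOn (m .cvar b) (Set.Iio (m .nv b 0)) {x | x ∈ X ∧ x < n}
  checks : Set.BijOn (m .cchk b) (Set.Iio (m .nc b 0)) {x | x ∈ X ∧ ¬ x < n}

/-- The arrays that hold the node lists of the clusters. -/
def listArrays : Arr → Bool
  | .nv | .cvar | .nc | .cchk => true
  | _ => false

/-- `m'` is `m` up to the lists of cluster `b`. -/
def EqOffList (b : ℕ) (m m' : Mem) : Prop :=
  ∀ a, (listArrays a = false → m' a = m a) ∧ ∀ b' ≠ b, m' a b' = m a b'

theorem EqOffList.trans {b : ℕ} {m m' m'' : Mem} (h : EqOffList b m m') (h' : EqOffList b m' m'') :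
    EqOffList b m m'' := fun a =>
  ⟨fun ha => ((h' a).1 ha).trans ((h a).1 ha), fun b' hb => ((h' a).2 b' hb).trans ((h a).2 b' hb)⟩

theorem EqOffList.write {b : ℕ} {m : Mem} {a : Arr} (ha : listArrays a = true) (j v : ℕ) :
    EqOffList b m (m.write a b j v) := by
  refine fun a' => ⟨fun ha' => Mem.write_of_ne _ (by rintro rfl; simp [ha] at ha') .., ?_⟩
  intro b' hb
  funext j'
  simp [Mem.write, hb]

theorem IsNodeList.congr {n b : ℕ} {m m' : Mem} {X : Finset ℕ}
    (h : ∀ a, listArrays a = true → m' a b = m a b) (hX : IsNodeList n m b X) :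
    IsNodeList n m' b X := by
  obtain ⟨h₁, h₂⟩ := hX
  constructor <;> simpa only [h .nv rfl, h .nc rfl, h .cvar rfl, h .cchk rfl]

theorem bijOn_Iio_succ {f g : ℕ → ℕ} {k y : ℕ} {s : Set ℕ} (h : Set.BijOn f (Set.Iio k) s)
    (hy : y ∉ s) (hg : ∀ i < k, g i = f i) (hgk : g k = y) :
    Set.BijOn g (Set.Iio (k + 1)) (insert y s) := by
  have : Set.Iio (k + 1) = insert k (Set.Iio k) := by
    ext i; simp only [Set.mem_Iio, Set.mem_insert_iff]; omega
  rw [this, ← hgk]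
  refine Set.BijOn.insert (h.congr fun i hi => (hg i hi).symm) (by rwa [hgk])

theorem addNode_runs {n b y : ℕ} {X : Finset ℕ} {σ : RamState} (hX : IsNodeList n σ.mem b X)
    (hy : y ∉ X) :
    Runs (addNode n b y) σ fun _ σ' => IsNodeList n σ'.mem b (insert y X) ∧
      EqOffList b σ.mem σ'.mem ∧ σ'.time ≤ σ.time + 4 := by
  refine Runs.tick_bind ?_
  split_ifs with hyn
  · refine Runs.load_bind <| Runs.put_bind <| Runs.store_bind <| Runs.pure ⟨⟨?_, ?_⟩, ?_, by simp⟩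
    · have h₁ : {x | x ∈ insert y X ∧ x < n} = insert y {x | x ∈ X ∧ x < n} := by
        ext x
        simp only [Finset.mem_insert, Set.mem_ofPred_eq, Set.mem_insert_iff]
        constructor
        · rintro ⟨rfl | h, h'⟩
          exacts [Or.inl rfl, Or.inr ⟨h, h'⟩]
        · rintro (rfl | ⟨h, h'⟩)
          exacts [⟨Or.inl rfl, hyn⟩, ⟨Or.inr h, h'⟩]
      have h₂ : ((σ.mem.write .cvar b (σ.mem .nv b 0) y).write .nv b 0 (σ.mem .nv b 0 + 1)) .nv b 0
          = σ.mem .nv b 0 + 1 := by simp [Mem.write]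
      simp only [h₂, h₁]
      refine bijOn_Iio_succ hX.vars (by simp [hy]) ?_ (by simp [Mem.write])
      intro i hi
      simp [Mem.write, hi.ne]
    · have h₁ : {x | x ∈ insert y X ∧ ¬ x < n} = {x | x ∈ X ∧ ¬ x < n} := by
        ext x
        simp only [Finset.mem_insert, Set.mem_ofPred_eq]
        refine ⟨?_, fun h => ⟨Or.inr h.1, h.2⟩⟩
        rintro ⟨rfl | h, h'⟩
        exacts [absurd hyn h', ⟨h, h'⟩]
      rw [h₁]
      simpa [Mem.write_of_ne] using hX.checks
    · exact (EqOffList.write rfl _ _).trans (EqOffList.write rfl _ _)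
  · refine Runs.load_bind <| Runs.put_bind <| Runs.store_bind <| Runs.pure ⟨⟨?_, ?_⟩, ?_, by simp⟩
    · have h₁ : {x | x ∈ insert y X ∧ x < n} = {x | x ∈ X ∧ x < n} := by
        ext x
        simp only [Finset.mem_insert, Set.mem_ofPred_eq]
        refine ⟨?_, fun h => ⟨Or.inr h.1, h.2⟩⟩
        rintro ⟨rfl | h, h'⟩
        exacts [absurd h' hyn, ⟨h, h'⟩]
      rw [h₁]
      simpa [Mem.write_of_ne] using hX.vars
    · have h₁ : {x | x ∈ insert y X ∧ ¬ x < n} = insert y {x | x ∈ X ∧ ¬ x < n} := by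
        ext x
        simp only [Finset.mem_insert, Set.mem_ofPred_eq, Set.mem_insert_iff]
        constructor
        · rintro ⟨rfl | h, h'⟩
          exacts [Or.inl rfl, Or.inr ⟨h, h'⟩]
        · rintro (rfl | ⟨h, h'⟩)
          exacts [⟨Or.inl rfl, hyn⟩, ⟨Or.inr h, h'⟩]
      have h₂ : ((σ.mem.write .cchk b (σ.mem .nc b 0) y).write .nc b 0 (σ.mem .nc b 0 + 1)) .nc b 0
          = σ.mem .nc b 0 + 1 := by simp [Mem.write]
      simp only [h₂, h₁]
      refine bijOn_Iio_succ hX.checks (by simp [hy]) ?_ (by simp [Mem.write])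
      intro i hi
      simp [Mem.write, hi.ne]
    · exact (EqOffList.write rfl _ _).trans (EqOffList.write rfl _ _)

/-- `m'` arises from `m` by adding a cluster with topmost node `u`. -/
structure AddsCluster (n u : ℕ) (X : Finset ℕ) (m m' : Mem) : Prop where
  nblk : m' .nblk 0 0 = m .nblk 0 0 + 1
  top : ∀ b, m' .top b 0 = if b = m .nblk 0 0 then u else m .top b 0
  list : IsNodeList n m' (m .nblk 0 0) X
  lists : ∀ b ≠ m .nblk 0 0, ∀ a, listArrays a = true → m' a b = m a b

theorem newCluster_runs {n u : ℕ} {σ : RamState}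
    (h : σ.mem .nv (σ.mem .nblk 0 0) 0 = 0 ∧ σ.mem .nc (σ.mem .nblk 0 0) 0 = 0) :
    Runs (newCluster n u) σ fun b σ' => b = σ.mem .nblk 0 0 ∧ AddsCluster n u {u} σ.mem σ'.mem ∧
      (∀ a, listArrays a = false → a ≠ .nblk → a ≠ .top → σ'.mem a = σ.mem a) ∧
      σ'.time ≤ σ.time + 8 := by
  refine Runs.tick_bind <| Runs.load_bind <| Runs.store_bind <| Runs.store_bind <| Runs.bind ?_
  dsimp only
  refine (addNode_runs (X := ∅) (y := u) ⟨?_, ?_⟩ (by simp)).mono ?_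
  · simp [Mem.write_of_ne, h.1]
  · simp [Mem.write_of_ne, h.2]
  rintro _ σ' ⟨h₁, h₂, h₃⟩
  dsimp only at h₁ h₂ h₃
  refine Runs.pure ⟨rfl, ⟨?_, ?_, ?_, ?_⟩, ?_, ?_⟩
  · rw [(h₂ _).1 rfl]; simp [Mem.write]
  · intro b
    rw [(h₂ _).1 rfl]; simp [Mem.write]
  · simpa using h₁
  · intro b hb a ha
    rw [(h₂ a).2 b hb, Mem.write_of_ne _ (by rintro rfl; simp [listArrays] at ha),
      Mem.write_of_ne _ (by rintro rfl; simp [listArrays] at ha)]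
  · intro a h₄ h₅ h₆
    rw [(h₂ a).1 h₄, Mem.write_of_ne _ h₆, Mem.write_of_ne _ h₅]
  · omega

/-- The nodes on the stack from position `s` on. -/
def stackFrom (m : Mem) (s : ℕ) : Finset ℕ :=
  (Finset.Ico s (m .sp 0 0)).image fun k => m .stk k 0

/-- The arrays changed when a cluster is removed from the stack. -/
def popArrays : Arr → Bool
  | .loc | .blk | .nblk | .top | .nv | .cvar | .nc | .cchk | .sp | .nchd | .chd => true
  | _ => false

theorem listArrays_eq_false {a : Arr} (h : popArrays a = false) : listArrays a = false := by
  cases a <;> first | rfl | exact h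

/-- `m'` arises from `m` by making the nodes on the stack from position `s` on, together with `u`,
a cluster. -/
structure PopsCluster (n u s : ℕ) (m m' : Mem) : Prop extends
    AddsCluster n u (insert u (stackFrom m s)) m m' where
  frame : ∀ a, popArrays a = false → m' a = m a
  blk : ∀ x, m' .blk x 0 = if x ∈ stackFrom m s then m .nblk 0 0 else m .blk x 0
  sp : m' .sp 0 0 = s
  nchd : ∀ x, m' .nchd x 0 = if x = u then m .nchd u 0 + 1 else m .nchd x 0
  chd : ∀ x k, m' .chd x k = if x = u ∧ k = m .nchd u 0 then m .nblk 0 0 else m .chd x k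

/-- Distinct stack entries and the absence of `u` among them keep the new lists free of repetitions.
A popped node costs 8 steps: 4 in `addNode` and 4 in the loop body. -/
theorem popCluster_runs {n u s : ℕ} {σ : RamState}
    (h : σ.mem .nv (σ.mem .nblk 0 0) 0 = 0 ∧ σ.mem .nc (σ.mem .nblk 0 0) 0 = 0)
    (hstk : Set.InjOn (fun k => σ.mem .stk k 0) (Set.Ico s (σ.mem .sp 0 0)))
    (hu : u ∉ stackFrom σ.mem s) :
    Runs (popCluster n u s) σ fun _ σ' => PopsCluster n u s σ.mem σ'.mem ∧
      σ'.time ≤ σ.time + 14 + 8 * (σ.mem .sp 0 0 - s) := by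
  classical
  refine Runs.tick_bind <| Runs.bind <| (newCluster_runs (σ := ⟨σ.mem, σ.time + 1⟩) h).mono ?_
  rintro _ σ₁ ⟨rfl, h₁, h₂, h₃⟩
  dsimp only at h₁ h₂ h₃
  set b := σ.mem .nblk 0 0 with hb
  refine Runs.load_bind ?_
  rw [h₂ .sp rfl (by simp) (by simp)]
  set e := σ.mem .sp 0 0 with he
  -- `T k` is the set of nodes moved in the first `k` iterations.
  set T : ℕ → Finset ℕ := fun k => (Finset.range k).image fun i => σ.mem .stk (s + i) 0 with hT
  have hTe : T (e - s) = stackFrom σ.mem s := by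
    ext x
    simp only [hT, stackFrom, Finset.mem_image, Finset.mem_range, Finset.mem_Ico, ← he]
    constructor
    · rintro ⟨i, hi, rfl⟩
      exact ⟨s + i, by omega, rfl⟩
    · rintro ⟨i, hi, rfl⟩
      exact ⟨i - s, by omega, by congr 1; omega⟩
  refine Runs.bind <| Runs.forIn_range (fun k σ' => IsNodeList n σ'.mem b (insert u (T k)) ∧
    (∀ a, listArrays a = false → a ≠ .loc → a ≠ .blk → σ'.mem a = σ₁.mem a) ∧
    (∀ b' ≠ b, ∀ a, listArrays a = true → σ'.mem a b' = σ₁.mem a b') ∧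
    (∀ x, σ'.mem .blk x 0 = if x ∈ T k then b else σ.mem .blk x 0) ∧
    σ'.time ≤ σ.time + 10 + 8 * k) ⟨?_, ?_, ?_, ?_, ?_⟩ ?_ ?_
  · simpa [hT] using h₁.list
  · intros; rfl
  · intros; rfl
  · intro x
    simp [hT, h₂ .blk rfl]
  · dsimp only; omega
  · rintro k hk σ₂ ⟨h₄, h₅, h₆, h₇, h₈⟩
    refine Runs.tick_bind <| Runs.load_bind ?_
    dsimp only
    have hy : σ₂.mem .stk (s + k) 0 = σ.mem .stk (s + k) 0 := by
      rw [h₅ .stk rfl (by simp) (by simp), h₂ .stk rfl (by simp) (by simp)]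
    rw [hy]
    set y := σ.mem .stk (s + k) 0 with hy'
    have hyT : y ∉ insert u (T k) := by
      rw [Finset.mem_insert, not_or]
      constructor
      · rintro rfl
        refine hu ?_
        rw [← hTe]
        exact Finset.mem_image.2 ⟨k, by simpa using hk, hy'.symm⟩
      · simp only [hT, Finset.mem_image, Finset.mem_range, not_exists, not_and]
        intro i hi h
        have := hstk (Set.mem_Ico.2 ⟨by omega, by omega⟩) (Set.mem_Ico.2 ⟨by omega, by omega⟩) h
        omega
    have hTk : T (k + 1) = insert y (T k) := by
      simp only [hT]
      rw [Finset.range_add_one, Finset.image_insert]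
    refine Runs.bind <| (addNode_runs (σ := ⟨σ₂.mem, σ₂.time + 1 + 1⟩) h₄ hyT).mono ?_
    rintro p σ₃ ⟨h₉, h₁₀, h₁₁⟩
    dsimp only at h₉ h₁₀ h₁₁
    refine Runs.store_bind <| Runs.store_bind <| Runs.pure ⟨rfl, ?_, ?_, ?_, ?_, ?_⟩
    · rw [hTk, Finset.insert_comm]
      refine h₉.congr fun a ha => ?_
      simp only
      rw [Mem.write_of_ne _ (by rintro rfl; simp [listArrays] at ha),
        Mem.write_of_ne _ (by rintro rfl; simp [listArrays] at ha)]
    · intro a h₁₂ h₁₃ h₁₄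
      simp only
      rw [Mem.write_of_ne _ h₁₄, Mem.write_of_ne _ h₁₃, (h₁₀ a).1 h₁₂, h₅ a h₁₂ h₁₃ h₁₄]
    · intro b' hb' a ha
      simp only
      rw [Mem.write_of_ne _ (by rintro rfl; simp [listArrays] at ha),
        Mem.write_of_ne _ (by rintro rfl; simp [listArrays] at ha), (h₁₀ a).2 b' hb', h₆ b' hb' a ha]
    · intro x
      rw [hTk]
      simp only [Mem.write_apply_zero, Finset.mem_insert]
      rw [Mem.write_of_ne _ (by simp), (h₁₀ .blk).1 rfl, h₇]
      by_cases hx : x = y <;> simp [hx]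
    · dsimp only; omega
  · rintro σ₂ ⟨h₄, h₅, h₆, h₇, h₈⟩
    rw [hTe] at h₄ h₇
    have h₉ : ∀ a, listArrays a = false → a ≠ .loc → a ≠ .blk → a ≠ .nblk → a ≠ .top →
        σ₂.mem a = σ.mem a := fun a i₁ i₂ i₃ i₄ i₅ => by rw [h₅ a i₁ i₂ i₃, h₂ a i₁ i₄ i₅]
    refine Runs.store_bind <| Runs.load_bind <| Runs.put_bind <| Runs.store ⟨?_, ?_⟩
    · have hnchd : (σ₂.mem.write .sp 0 0 s) .nchd u 0 = σ.mem .nchd u 0 := by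
        rw [Mem.write_of_ne _ (by simp), h₉ .nchd rfl] <;> simp
      dsimp only
      rw [hnchd]
      have h₁₀ : ∀ a, a ≠ .sp → a ≠ .chd → a ≠ .nchd →
          (((σ₂.mem.write .sp 0 0 s).write .chd u (σ.mem .nchd u 0) b).write .nchd u 0
            (σ.mem .nchd u 0 + 1)) a = σ₂.mem a := fun a i₁ i₂ i₃ => by
        rw [Mem.write_of_ne _ i₃, Mem.write_of_ne _ i₂, Mem.write_of_ne _ i₁]
      refine ⟨⟨?_, ?_, ?_, ?_⟩, ?_, ?_, ?_, ?_, ?_⟩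
      · rw [h₁₀ .nblk, h₅ .nblk rfl, h₁.nblk] <;> simp
      · intro b'
        rw [h₁₀ .top, h₅ .top rfl, h₁.top] <;> simp
      · exact h₄.congr fun a ha => by rw [h₁₀ a] <;> rintro rfl <;> simp [listArrays] at ha
      · intro b' hb' a ha
        rw [h₁₀ a, h₆ b' hb' a ha, h₁.lists b' hb' a ha] <;> rintro rfl <;>
          simp [listArrays] at ha
      · intro a ha
        rw [h₁₀ a, h₉ a (listArrays_eq_false ha)] <;> (rintro rfl; simp [popArrays] at ha)
      · intro x
        rw [h₁₀ .blk, h₇] <;> simp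
      · rw [Mem.write_of_ne _ (by simp), Mem.write_of_ne _ (by simp)]
        simp [Mem.write]
      · intro x
        rw [Mem.write_apply_zero, Mem.write_of_ne _ (by simp), Mem.write_of_ne _ (by simp),
          h₉ .nchd rfl (by simp) (by simp) (by simp) (by simp)]
      · intro x k
        rw [Mem.write_of_ne _ (by simp), Mem.write_apply, Mem.write_of_ne _ (by simp),
          h₉ .chd rfl (by simp) (by simp) (by simp) (by simp)]
    · dsimp only; omega

/-! ### Invariants of the depth-first search -/

theorem mem_stackFrom {m : Mem} {s x : ℕ} :
    x ∈ stackFrom m s ↔ ∃ k, s ≤ k ∧ k < m .sp 0 0 ∧ m .stk k 0 = x := by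
  simp [stackFrom, and_assoc]

/-- The adjacency lists in `m` describe the graph `G` on the nodes `U`. -/
structure IsAdjacencyList (G : SimpleGraph ℕ) (U : Finset ℕ) (m : Mem) : Prop where
  mem : ∀ x y, G.Adj x y → y ∈ U
  adj_iff : ∀ x ∈ U, ∀ y, G.Adj x y ↔ ∃ k < m .deg x 0, m .nbr x k = y

/-- `X` is the node set of a cluster with number `b`; apart from the topmost node, its nodes are not
on the stack and belong to no other cluster above them. -/
structure IsClusterOf (G : SimpleGraph ℕ) (n : ℕ) (m : Mem) (b : ℕ) (X : Finset ℕ) : Prop where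
  list : IsNodeList n m b X
  connected : StaysConnected G X
  top_mem : m .top b 0 ∈ X
  disc : ∀ x ∈ X, m .disc x 0 ≠ 0
  eq_top_or : ∀ x ∈ X, x = m .top b 0 ∨ x ∉ stackFrom m 0 ∧ m .blk x 0 = b
  nonempty : ∃ x ∈ X, x ∉ stackFrom m 0 ∧ m .blk x 0 = b

/-- The global invariant of the depth-first search. -/
structure SearchInvariant (G : SimpleGraph ℕ) (U : Finset ℕ) (n : ℕ) (m : Mem) : Prop where
  disc_mem : ∀ x, m .disc x 0 ≠ 0 → x ∈ U
  disc_le : ∀ x, m .disc x 0 ≤ m .clock 0 0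
  stk_inj : Set.InjOn (fun k => m .stk k 0) (Set.Iio (m .sp 0 0))
  stk_disc : ∀ k < m .sp 0 0, m .disc (m .stk k 0) 0 ≠ 0
  cluster : ∀ b < m .nblk 0 0, ∃ X : Finset ℕ, IsClusterOf G n m b X
  fresh : ∀ b, m .nblk 0 0 ≤ b → m .nv b 0 = 0 ∧ m .nc b 0 = 0
  chd_lt : ∀ x, ∀ k < m .nchd x 0, m .chd x k < m .nblk 0 0
  top_chd : ∀ x, ∀ k < m .nchd x 0, m .top (m .chd x k) 0 = x
  chd_mono : ∀ x i j, i < j → j < m .nchd x 0 → m .chd x i < m .chd x j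
  chd_lt_blk : ∀ x, m .disc x 0 ≠ 0 → x ∉ stackFrom m 0 → ∀ k < m .nchd x 0,
    m .chd x k < m .blk x 0

/-- The arrays that the depth-first search leaves alone. -/
def searchFrame : Arr → Bool
  | .deg | .nbr | .vars | .cnt | .nroot | .root => true
  | _ => false

/-- The search may proceed from `m` to `m'`. -/
structure Extends (m m' : Mem) : Prop where
  frame : ∀ a, searchFrame a = true → m' a = m a
  nblk_le : m .nblk 0 0 ≤ m' .nblk 0 0
  top : ∀ b < m .nblk 0 0, m' .top b 0 = m .top b 0
  blk : ∀ x, m .disc x 0 ≠ 0 → m' .blk x 0 = m .blk x 0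
  disc : ∀ x, m .disc x 0 ≠ 0 → m' .disc x 0 = m .disc x 0
  clock_le : m .clock 0 0 ≤ m' .clock 0 0
  disc_new : ∀ x, m .disc x 0 = 0 → m' .disc x 0 ≠ 0 → m .clock 0 0 < m' .disc x 0
  sp_le : m .sp 0 0 ≤ m' .sp 0 0
  stk : ∀ k < m .sp 0 0, m' .stk k 0 = m .stk k 0
  low : ∀ x, m .disc x 0 ≠ 0 → m' .low x 0 = m .low x 0

theorem Extends.trans {m m' m'' : Mem} (h : Extends m m') (h' : Extends m' m'') :
    Extends m m'' where
  frame a ha := (h'.frame a ha).trans (h.frame a ha)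
  nblk_le := h.nblk_le.trans h'.nblk_le
  top b hb := (h'.top b (hb.trans_le h.nblk_le)).trans (h.top b hb)
  blk x hx := (h'.blk x (by rwa [h.disc x hx])).trans (h.blk x hx)
  disc x hx := (h'.disc x (by rwa [h.disc x hx])).trans (h.disc x hx)
  clock_le := h.clock_le.trans h'.clock_le
  disc_new x hx hx' := by
    by_cases hx'' : m' .disc x 0 = 0
    · exact h.clock_le.trans_lt (h'.disc_new x hx'' hx')
    · rw [h'.disc x hx'']; exact h.disc_new x hx hx''
  sp_le := h.sp_le.trans h'.sp_le
  stk k hk := (h'.stk k (hk.trans_le h.sp_le)).trans (h.stk k hk)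
  low x hx := (h'.low x (by rwa [h.disc x hx])).trans (h.low x hx)

theorem Extends.disc_ne_zero {m m' : Mem} (h : Extends m m') {x : ℕ} (hx : m .disc x 0 ≠ 0) :
    m' .disc x 0 ≠ 0 := by rwa [h.disc x hx]

/-- `m'` arises from `m` by discovering the node `u`. -/
structure Discovers (u : ℕ) (m m' : Mem) : Prop where
  clock : m' .clock 0 0 = m .clock 0 0 + 1
  disc : ∀ x, m' .disc x 0 = if x = u then m .clock 0 0 + 1 else m .disc x 0
  low : ∀ x, m' .low x 0 = if x = u then m .clock 0 0 + 1 else m .low x 0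
  sp : m' .sp 0 0 = m .sp 0 0 + 1
  stk : ∀ k, m' .stk k 0 = if k = m .sp 0 0 then u else m .stk k 0
  frame : ∀ a, a ≠ .clock → a ≠ .disc → a ≠ .low → a ≠ .sp → a ≠ .stk → m' a = m a

/-- The number of steps that undiscovered nodes may still cause. -/
def potential (U : Finset ℕ) (m : Mem) : ℕ :=
  ∑ x ∈ U with m .disc x 0 = 0, (20 + 24 * m .deg x 0)

/-! ### Preservation of the search invariant -/

section

variable {G : SimpleGraph ℕ} {U : Finset ℕ} {n u s : ℕ} {m m' : Mem}

theorem IsAdjacencyList.congr (h : IsAdjacencyList G U m) (h₁ : m' .deg = m .deg)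
    (h₂ : m' .nbr = m .nbr) : IsAdjacencyList G U m' :=
  ⟨h.mem, by simpa only [h₁, h₂] using h.adj_iff⟩

theorem stackFrom_congr (h₁ : m' .sp = m .sp) (h₂ : m' .stk = m .stk) :
    stackFrom m' s = stackFrom m s := by
  simp only [stackFrom, h₁, h₂]

theorem SearchInvariant.write_low (h : SearchInvariant G U n m) (v : ℕ) :
    SearchInvariant G U n (m.write .low u 0 v) := by
  have hf : ∀ a, a ≠ .low → m.write .low u 0 v a = m a := fun a ha => Mem.write_of_ne _ ha ..
  have hs : ∀ s, stackFrom (m.write .low u 0 v) s = stackFrom m s := fun s =>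
    stackFrom_congr (hf _ (by simp)) (hf _ (by simp))
  obtain ⟨h₁, h₂, h₃, h₄, h₅, h₆, h₇, h₈, h₉, h₁₀⟩ := h
  refine ⟨?_, ?_, ?_, ?_, ?_, ?_, ?_, ?_, ?_, ?_⟩
  case refine_5 =>
    intro b hb
    rw [hf .nblk (by simp)] at hb
    obtain ⟨X, i₁, i₂, i₃, i₄, i₅, i₆⟩ := h₅ b hb
    refine ⟨X, i₁.congr fun a ha => ?_, i₂, ?_, ?_, ?_, ?_⟩
    · rw [hf]; rintro rfl; simp [listArrays] at ha
    all_goals simpa only [hs, hf .top (by simp), hf .disc (by simp), hf .blk (by simp)]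
  all_goals
    simpa only [hs, hf .disc (by simp), hf .clock (by simp), hf .sp (by simp),
      hf .stk (by simp), hf .nblk (by simp), hf .nv (by simp), hf .nc (by simp),
      hf .nchd (by simp), hf .chd (by simp), hf .top (by simp), hf .blk (by simp)]

theorem Discovers.stackFrom_eq (h : Discovers u m m') (hs : s ≤ m .sp 0 0) :
    stackFrom m' s = insert u (stackFrom m s) := by
  ext x
  simp only [Finset.mem_insert, mem_stackFrom, h.sp, h.stk]
  constructor
  · rintro ⟨k, hk, hk', rfl⟩
    split_ifs with h'
    · exact Or.inl rfl
    · exact Or.inr ⟨k, hk, by omega, rfl⟩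
  · rintro (rfl | ⟨k, hk, hk', rfl⟩)
    · exact ⟨m .sp 0 0, hs, by omega, by simp⟩
    · exact ⟨k, hk, by omega, by simp [hk'.ne]⟩

/-- All nodes of existing clusters have been discovered before, so putting the new node on the stack
affects none of them. -/
theorem SearchInvariant.discovers (h : SearchInvariant G U n m) (hu : u ∈ U)
    (hdu : m .disc u 0 = 0) (hd : Discovers u m m') : SearchInvariant G U n m' := by
  have hf := hd.frame
  have hs : ∀ x, x ∉ stackFrom m' 0 ↔ x ≠ u ∧ x ∉ stackFrom m 0 := fun x => by
    rw [hd.stackFrom_eq (Nat.zero_le _), Finset.mem_insert, not_or]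
  have hne : ∀ x, m .disc x 0 ≠ 0 → x ≠ u := by rintro x hx rfl; exact hx hdu
  have hne' : ∀ x, m .disc x 0 ≠ 0 → m' .disc x 0 ≠ 0 := fun x hx => by
    rwa [hd.disc, if_neg (hne x hx)]
  refine ⟨?_, ?_, ?_, ?_, ?_, ?_, ?_, ?_, ?_, ?_⟩
  · intro x hx
    rw [hd.disc] at hx
    split_ifs at hx with hxu
    exacts [hxu ▸ hu, h.disc_mem x hx]
  · intro x
    rw [hd.disc, hd.clock]
    have := h.disc_le x
    split_ifs <;> omega
  · intro i hi j hj hij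
    simp only [Set.mem_Iio, hd.sp] at hi hj
    simp only [hd.stk] at hij
    split_ifs at hij with h₁ h₂ h₂
    · omega
    · exact absurd hij.symm (hne _ (h.stk_disc j (by omega)))
    · exact absurd hij (hne _ (h.stk_disc i (by omega)))
    · exact h.stk_inj (Set.mem_Iio.2 (by omega)) (Set.mem_Iio.2 (by omega)) hij
  · intro k hk
    rw [hd.sp] at hk
    rw [hd.stk]
    split_ifs
    · simp [hd.disc]
    · exact hne' _ (h.stk_disc k (by omega))
  · intro b hb
    rw [hf .nblk (by simp) (by simp) (by simp) (by simp) (by simp)] at hb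
    obtain ⟨X, i₁, i₂, i₃, i₄, i₅, i₆⟩ := h.cluster b hb
    have ht : m' .top b 0 = m .top b 0 := by
      rw [hf .top (by simp) (by simp) (by simp) (by simp) (by simp)]
    have hb : m' .blk = m .blk := hf .blk (by simp) (by simp) (by simp) (by simp) (by simp)
    refine ⟨X, i₁.congr fun a ha => ?_, i₂, ?_, fun x hx => hne' x (i₄ x hx), ?_, ?_⟩
    · rw [hf] <;> (rintro rfl; simp [listArrays] at ha)
    · rwa [ht]
    · intro x hx
      rw [ht, hb, hs]
      exact (i₅ x hx).imp_right fun h => ⟨⟨hne x (i₄ x hx), h.1⟩, h.2⟩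
    · obtain ⟨x, hx, hx₁, hx₂⟩ := i₆
      exact ⟨x, hx, (hs x).2 ⟨hne x (i₄ x hx), hx₁⟩, by rw [hb, hx₂]⟩
  · simpa [hf] using h.fresh
  · simpa [hf] using h.chd_lt
  · simpa [hf] using h.top_chd
  · simpa [hf] using h.chd_mono
  · intro x hx hxs
    obtain ⟨hxu, hxs⟩ := (hs x).1 hxs
    rw [hd.disc, if_neg hxu] at hx
    simpa [hf] using h.chd_lt_blk x hx hxs

/-- The new cluster has the largest number so far, so the child clusters of the popped nodes lie
below it, as `chd_lt_blk` requires. The node `u`, which gets this cluster as a child, stays on the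
stack and is exempt until it is popped itself. -/
theorem SearchInvariant.pops (h : SearchInvariant G U n m) (hp : PopsCluster n u s m m')
    (hsp : s < m .sp 0 0) (hu : u ∈ stackFrom m 0) (hus : u ∉ stackFrom m s)
    (hX : StaysConnected G (insert u (stackFrom m s) : Finset ℕ)) : SearchInvariant G U n m' := by
  have hdisc : m' .disc = m .disc := hp.frame _ rfl
  have hstk : m' .stk = m .stk := hp.frame _ rfl
  have hs : ∀ x, x ∉ stackFrom m 0 → x ∉ stackFrom m' 0 ∧ x ∉ stackFrom m s := by
    refine fun x hx => ⟨fun hx' => hx ?_, fun hx' => hx ?_⟩ <;> rw [mem_stackFrom] at hx' ⊢ <;>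
      obtain ⟨k, h₁, h₂, rfl⟩ := hx'
    · rw [hp.sp] at h₂
      exact ⟨k, h₁, by omega, by rw [hstk]⟩
    · exact ⟨k, by omega, h₂, rfl⟩
  have hs' : ∀ x, x ∈ stackFrom m s → x ∉ stackFrom m' 0 := by
    intro x hx hx'
    rw [mem_stackFrom] at hx hx'
    obtain ⟨k, h₁, h₂, rfl⟩ := hx
    obtain ⟨l, -, h₃, h₄⟩ := hx'
    rw [hp.sp] at h₃
    rw [hstk] at h₄
    have := h.stk_inj (Set.mem_Iio.2 (by omega)) (Set.mem_Iio.2 (by omega)) h₄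
    omega
  have hs'' : ∀ x, x ∉ stackFrom m' 0 → x ∉ stackFrom m s → x ∉ stackFrom m 0 := by
    intro x hx hxs hx'
    rw [mem_stackFrom] at hx'
    obtain ⟨k, h₁, h₂, rfl⟩ := hx'
    by_cases hk : k < s
    · exact hx (mem_stackFrom.2 ⟨k, h₁, by rwa [hp.sp], by rw [hstk]⟩)
    · exact hxs (mem_stackFrom.2 ⟨k, by omega, h₂, rfl⟩)
  have hdu : ∀ x s, x ∈ stackFrom m s → m .disc x 0 ≠ 0 := by
    intro x s hx
    obtain ⟨k, h₁, h₂, rfl⟩ := mem_stackFrom.1 hx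
    exact h.stk_disc k h₂
  refine ⟨?_, ?_, ?_, ?_, ?_, ?_, ?_, ?_, ?_, ?_⟩
  · simpa only [hdisc] using h.disc_mem
  · simpa only [hdisc, hp.frame .clock rfl] using h.disc_le
  · rw [hstk, hp.sp]
    exact h.stk_inj.mono (Set.Iio_subset_Iio hsp.le)
  · rw [hdisc, hstk, hp.sp]
    exact fun k hk => h.stk_disc k (hk.trans hsp)
  · intro b hb
    rw [hp.nblk] at hb
    by_cases hbN : b = m .nblk 0 0
    · subst hbN
      have htop : m' .top (m .nblk 0 0) 0 = u := by rw [hp.top, if_pos rfl]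
      refine ⟨_, hp.list, hX, ?_, ?_, ?_, ?_⟩
      · simp [htop]
      · intro x hx
        rw [hdisc]
        rcases Finset.mem_insert.1 hx with rfl | hx
        exacts [hdu _ _ hu, hdu _ _ hx]
      · intro x hx
        rw [htop]
        refine (Finset.mem_insert.1 hx).imp_right fun hx => ⟨hs' x hx, ?_⟩
        rw [hp.blk, if_pos hx]
      · have hx : m .stk s 0 ∈ stackFrom m s := mem_stackFrom.2 ⟨s, le_rfl, hsp, rfl⟩
        exact ⟨m .stk s 0, Finset.mem_insert_of_mem hx, hs' _ hx, by rw [hp.blk, if_pos hx]⟩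
    · obtain ⟨X, i₁, i₂, i₃, i₄, i₅, i₆⟩ := h.cluster b (by omega)
      have htop : m' .top b 0 = m .top b 0 := by rw [hp.top, if_neg hbN]
      refine ⟨X, i₁.congr fun a ha => hp.lists b hbN a ha, i₂, by rwa [htop], by rwa [hdisc], ?_, ?_⟩
      · intro x hx
        rw [htop]
        refine (i₅ x hx).imp_right fun ⟨hx₁, hx₂⟩ => ⟨(hs x hx₁).1, ?_⟩
        rw [hp.blk, if_neg (hs x hx₁).2, hx₂]
      · obtain ⟨x, hx, hx₁, hx₂⟩ := i₆
        exact ⟨x, hx, (hs x hx₁).1, by rw [hp.blk, if_neg (hs x hx₁).2, hx₂]⟩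
  · intro b hb
    rw [hp.nblk] at hb
    rw [hp.lists b (by omega) .nv rfl, hp.lists b (by omega) .nc rfl]
    exact h.fresh b (by omega)
  · intro x k hk
    rw [hp.nchd] at hk
    rw [hp.chd, hp.nblk]
    split_ifs with hc
    · omega
    · have := h.chd_lt x k (by split_ifs at hk with hxu <;> [(subst hxu; omega); exact hk])
      omega
  · intro x k hk
    rw [hp.nchd] at hk
    rw [hp.chd, hp.top]
    split_ifs with hc hc' hc'
    · exact hc.1.symm
    · exact absurd rfl hc'
    · have := h.chd_lt x k (by split_ifs at hk with hxu <;> [(subst hxu; omega); exact hk])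
      omega
    · exact h.top_chd x k (by split_ifs at hk with hxu <;> [(subst hxu; omega); exact hk])
  · intro x i j hij hj
    rw [hp.nchd] at hj
    rw [hp.chd, hp.chd]
    have hj' : ¬ (x = u ∧ j = m .nchd u 0) → j < m .nchd x 0 := by
      intro hc; split_ifs at hj with hxu <;> [(subst hxu; omega); exact hj]
    have hi' : i < m .nchd x 0 := by
      split_ifs at hj with hxu <;> [(subst hxu; omega); omega]
    have hi'' : ¬ (x = u ∧ i = m .nchd u 0) := by rintro ⟨rfl, rfl⟩; omega
    rw [if_neg hi'']
    split_ifs with hc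
    · exact h.chd_lt x i hi'
    · exact h.chd_mono x i j hij (hj' hc)
  · intro x hx hxs k hk
    rw [hdisc] at hx
    rw [hp.nchd] at hk
    rw [hp.chd, hp.blk]
    by_cases hxT : x ∈ stackFrom m s
    · have hxu : x ≠ u := by rintro rfl; exact hus hxT
      rw [if_neg hxu] at hk
      rw [if_neg (fun h => hxu h.1), if_pos hxT]
      exact h.chd_lt x k hk
    · have hxm := hs'' x hxs hxT
      have hxu : x ≠ u := by rintro rfl; exact hxm hu
      rw [if_neg hxu] at hk
      rw [if_neg (fun h => hxu h.1), if_neg hxT]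
      exact h.chd_lt_blk x hx hxm k hk

theorem Discovers.extends (h : Discovers u m m') (hu : m .disc u 0 = 0) : Extends m m' := by
  have hne : ∀ x, m .disc x 0 ≠ 0 → x ≠ u := by rintro x hx rfl; exact hx hu
  have hf := h.frame
  refine ⟨fun a ha => ?_, ?_, ?_, ?_, fun x hx => ?_, ?_, fun x hx hx' => ?_, ?_, fun k hk => ?_,
    fun x hx => ?_⟩
  · rw [hf] <;> (rintro rfl; simp [searchFrame] at ha)
  · simp [hf]
  · simp [hf]
  · simp [hf]
  · rw [h.disc, if_neg (hne x hx)]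
  · rw [h.clock]; omega
  · rw [h.disc] at hx' ⊢
    split_ifs at hx' ⊢
    · omega
    · exact absurd hx hx'
  · rw [h.sp]; omega
  · rw [h.stk, if_neg hk.ne]
  · rw [h.low, if_neg (hne x hx)]

theorem Discovers.potential_add (h : Discovers u m m') (hu : u ∈ U) (hdu : m .disc u 0 = 0) :
    potential U m' + (20 + 24 * m .deg u 0) = potential U m := by
  have hdeg : m' .deg = m .deg := h.frame _ (by simp) (by simp) (by simp) (by simp) (by simp)
  have : U.filter (fun x => m' .disc x 0 = 0) = (U.filter fun x => m .disc x 0 = 0).erase u := by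
    ext x
    simp only [Finset.mem_filter, Finset.mem_erase, h.disc]
    by_cases hx : x = u <;> simp [hx]
  rw [potential, potential, this, hdeg]
  exact Finset.sum_erase_add _ _ (by simp [hu, hdu])

end

/-! ### Correctness and running time of the depth-first search -/

/-- What has to hold when the search from `u` starts in the memory `m`; `Γ` is the set of the nodes
whose search is still in progress. -/
structure SearchStart (G : SimpleGraph ℕ) (U : Finset ℕ) (n : ℕ) (Γ : Set ℕ) (u : ℕ) (m : Mem) :
    Prop where
  inv : SearchInvariant G U n m
  adj : IsAdjacencyList G U m
  mem : u ∈ U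
  disc : m .disc u 0 = 0
  active : ∀ a ∈ Γ, m .disc a 0 ≠ 0
  closed : ∀ x, m .disc x 0 ≠ 0 → x ∉ Γ → ∀ y, G.Adj x y → m .disc y 0 ≠ 0

/-- The state `m` of the search from `u`, started in the memory `m₀`, when the neighbours `N` of `u`
have been inspected. -/
structure SearchState (G : SimpleGraph ℕ) (U : Finset ℕ) (n : ℕ) (Γ : Set ℕ) (u : ℕ)
    (m₀ : Mem) (N : Set ℕ) (m : Mem) : Prop where
  inv : SearchInvariant G U n m
  ext : Extends m₀ m
  disc : m .disc u 0 = m₀ .clock 0 0 + 1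
  sp_lt : m₀ .sp 0 0 < m .sp 0 0
  new : ∀ x ∈ stackFrom m (m₀ .sp 0 0), m₀ .disc x 0 = 0
  closed : ∀ x, m .disc x 0 ≠ 0 → x ∉ insert u Γ → ∀ y, G.Adj x y → m .disc y 0 ≠ 0
  inspected : ∀ y ∈ N, m .disc y 0 ≠ 0
  seg : IsSegment G (stackFrom m (m₀ .sp 0 0)) u Γ
  low_le_disc : ∀ z ∈ stackFrom m (m₀ .sp 0 0), ∀ a ∈ Γ, G.Adj z a → (z = u → a ∈ N) →
    m .low u 0 ≤ m .disc a 0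
  low_le : m .low u 0 ≤ m₀ .clock 0 0 + 1
  low_eq : m .low u 0 = m₀ .clock 0 0 + 1 ∨ ∃ z ∈ stackFrom m (m₀ .sp 0 0), ∃ a ∈ Γ,
    G.Adj z a ∧ m .disc a 0 = m .low u 0

section

variable {G : SimpleGraph ℕ} {U : Finset ℕ} {n u w : ℕ} {Γ N : Set ℕ} {m₀ m m' m'' : Mem}

theorem SearchStart.init (h : SearchStart G U n Γ u m₀) (hd : Discovers u m₀ m) :
    SearchState G U n Γ u m₀ ∅ m := by
  have hs : stackFrom m (m₀ .sp 0 0) = {u} := by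
    rw [hd.stackFrom_eq le_rfl]
    simp [stackFrom]
  refine ⟨h.inv.discovers h.mem h.disc hd, hd.extends h.disc, ?_, ?_, ?_, ?_, ?_, ?_, ?_, ?_, ?_⟩
  · simp [hd.disc]
  · rw [hd.sp]; omega
  · rw [hs]; simpa using h.disc
  · intro x hx hxΓ y hxy
    rw [Set.mem_insert_iff, not_or] at hxΓ
    rw [hd.disc, if_neg hxΓ.1] at hx
    exact (hd.extends h.disc).disc_ne_zero (h.closed x hx hxΓ.2 y hxy)
  · simp
  · rw [hs, Finset.coe_singleton]; exact .singleton
  · rw [hs]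
    intro z hz a _ _ ha
    exact absurd (ha (by simpa using hz)) (by simp)
  · simp [hd.low]
  · simp [hd.low]

namespace SearchState

theorem mono {N' : Set ℕ} (h : SearchState G U n Γ u m₀ N m) (hN : N' = N) :
    SearchState G U n Γ u m₀ N' m := hN ▸ h

/-- Inspecting a neighbour that has already been discovered. -/
theorem inspect (h : SearchState G U n Γ u m₀ N m) (h₀ : SearchStart G U n Γ u m₀)
    (huw : G.Adj u w) (hw : m .disc w 0 ≠ 0) :
    SearchState G U n Γ u m₀ (insert w N)
      (m.write .low u 0 (min (m .low u 0) (m .disc w 0))) := by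
  set m' := m.write .low u 0 (min (m .low u 0) (m .disc w 0)) with hm'
  have hf : ∀ a, a ≠ .low → m' a = m a := fun a ha => Mem.write_of_ne _ ha ..
  have hdisc : m' .disc = m .disc := hf _ (by simp)
  have hs : ∀ s, stackFrom m' s = stackFrom m s := fun s =>
    stackFrom_congr (hf _ (by simp)) (hf _ (by simp))
  have hlow : m' .low u 0 = min (m .low u 0) (m .disc w 0) := by simp [hm', Mem.write]
  have hdu := h.disc
  refine ⟨h.inv.write_low _, ?_, ?_, ?_, ?_, ?_, ?_, ?_, ?_, ?_, ?_⟩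
  · have e := h.ext
    refine ⟨fun a ha => ?_, ?_, ?_, ?_, ?_, ?_, ?_, ?_, ?_, fun x hx => ?_⟩
    · rw [hf, e.frame a ha]; rintro rfl; simp [searchFrame] at ha
    · simpa [hf] using e.nblk_le
    · simpa [hf] using e.top
    · simpa [hf] using e.blk
    · simpa [hf] using e.disc
    · simpa [hf] using e.clock_le
    · simpa [hf] using e.disc_new
    · simpa [hf] using e.sp_le
    · simpa [hf] using e.stk
    · rw [hm', Mem.write_apply_zero, if_neg, e.low x hx]
      rintro rfl
      exact hx h₀.disc
  · rw [hdisc, hdu]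
  · rw [hf .sp (by simp)]; exact h.sp_lt
  · rw [hs]; exact h.new
  · simpa only [hdisc] using h.closed
  · rw [hdisc]
    rintro y (rfl | hy)
    exacts [hw, h.inspected y hy]
  · rw [hs]; exact h.seg
  · rw [hs, hlow, hdisc]
    intro z hz a ha hza hN
    by_cases haw : a = w
    · subst haw; exact min_le_right ..
    · refine (min_le_left ..).trans (h.low_le_disc z hz a ha hza fun hzu => ?_)
      exact (hN hzu).resolve_left haw
  · rw [hlow]; exact (min_le_left ..).trans h.low_le
  · rw [hs, hlow, hdisc]
    rcases le_or_gt (m .low u 0) (m .disc w 0) with hle | hlt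
    · rw [min_eq_left hle]; exact h.low_eq
    · rw [min_eq_right hlt.le]
      refine Or.inr ⟨u, h.seg.mem, w, ?_, huw, rfl⟩
      -- An inactive `w` was undiscovered when the search from `u` started, for otherwise `closed`
      -- would make `u` discovered. So `w` was discovered after `u`, and its discovery time could
      -- not lower `low u`.
      by_contra hwΓ
      have hw₀ : m₀ .disc w 0 = 0 := by
        by_contra hw₀
        exact h₀.closed w hw₀ hwΓ u huw.symm h₀.disc
      have h₁ := h.ext.disc_new w hw₀ hw
      have h₂ := h.low_le
      omega

/-- The situation in which the search from an undiscovered neighbour starts. -/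
theorem searchStart (h : SearchState G U n Γ u m₀ N m) (h₀ : SearchStart G U n Γ u m₀)
    (huw : G.Adj u w) (hw : m .disc w 0 = 0) : SearchStart G U n (insert u Γ) w m where
  inv := h.inv
  adj := h₀.adj.congr (h.ext.frame _ rfl) (h.ext.frame _ rfl)
  mem := h₀.adj.mem u w huw
  disc := hw
  active := by
    rintro a (rfl | ha)
    · rw [h.disc]; omega
    · exact h.ext.disc_ne_zero (h₀.active a ha)
  closed := h.closed

theorem stackFrom_child_prefix (h : SearchState G U n Γ u m₀ N m)
    (h' : SearchState G U n (insert u Γ) w m {y | G.Adj w y} m') :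
    stackFrom m' (m₀ .sp 0 0) = stackFrom m (m₀ .sp 0 0) ∪ stackFrom m' (m .sp 0 0) := by
  have h₁ := h.sp_lt
  have h₂ := h'.sp_lt
  ext x
  simp only [Finset.mem_union, mem_stackFrom]
  constructor
  · rintro ⟨k, hk, hk', rfl⟩
    by_cases hkm : k < m .sp 0 0
    · exact Or.inl ⟨k, hk, hkm, (h'.ext.stk k hkm).symm⟩
    · exact Or.inr ⟨k, by omega, hk', rfl⟩
  · rintro (⟨k, hk, hk', rfl⟩ | ⟨k, hk, hk', rfl⟩)
    · exact ⟨k, hk, by omega, h'.ext.stk k hk'⟩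
    · exact ⟨k, by omega, hk', rfl⟩

theorem disjoint_child (h : SearchState G U n Γ u m₀ N m)
    (h' : SearchState G U n (insert u Γ) w m {y | G.Adj w y} m') :
    Disjoint (stackFrom m (m₀ .sp 0 0) : Set ℕ) (stackFrom m' (m .sp 0 0)) := by
  refine Set.disjoint_left.2 fun x hx hx' => ?_
  obtain ⟨k, -, hk, rfl⟩ := mem_stackFrom.1 (Finset.mem_coe.1 hx)
  exact h.inv.stk_disc k hk (h'.new _ (Finset.mem_coe.1 hx'))

theorem low_child_eq (h : SearchState G U n Γ u m₀ N m)
    (h' : SearchState G U n (insert u Γ) w m {y | G.Adj w y} m') :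
    m' .low u 0 = m .low u 0 :=
  h'.ext.low u (by rw [h.disc]; omega)

theorem disc_child_eq (h : SearchState G U n Γ u m₀ N m)
    (h' : SearchState G U n (insert u Γ) w m {y | G.Adj w y} m') :
    m' .disc u 0 = m₀ .clock 0 0 + 1 := by
  rw [h'.ext.disc u (by rw [h.disc]; omega), h.disc]

theorem closed_child (h' : SearchState G U n (insert u Γ) w m {y | G.Adj w y} m') :
    ∀ x, m' .disc x 0 ≠ 0 → x ∉ insert u Γ → ∀ y, G.Adj x y → m' .disc y 0 ≠ 0 := by
  intro x hx hxΓ y hxy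
  by_cases hxw : x = w
  · subst hxw; exact h'.inspected y hxy
  · exact h'.closed x hx (by rw [Set.mem_insert_iff]; tauto) y hxy

theorem disc_lt_of_mem (h : SearchState G U n Γ u m₀ N m) (h₀ : SearchStart G U n Γ u m₀)
    (h' : SearchState G U n (insert u Γ) w m {y | G.Adj w y} m') :
    ∀ a ∈ Γ, m' .disc a 0 < m₀ .clock 0 0 + 1 := by
  intro a ha
  rw [h'.ext.disc a (h.ext.disc_ne_zero (h₀.active a ha)), h.ext.disc a (h₀.active a ha)]
  exact Nat.lt_succ_of_le (h₀.inv.disc_le a)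

theorem extends_write_low (h : SearchState G U n Γ u m₀ N m) (h₀ : SearchStart G U n Γ u m₀)
    (h' : SearchState G U n (insert u Γ) w m {y | G.Adj w y} m')
    (v : ℕ) : Extends m₀ (m'.write .low u 0 v) := by
  have e := h.ext.trans h'.ext
  have hf : ∀ a, a ≠ .low → m'.write .low u 0 v a = m' a := fun a ha => Mem.write_of_ne _ ha ..
  refine ⟨fun a ha => ?_, ?_, ?_, ?_, ?_, ?_, ?_, ?_, ?_, fun x hx => ?_⟩
  · rw [hf, e.frame a ha]; rintro rfl; simp [searchFrame] at ha
  · simpa [hf] using e.nblk_le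
  · simpa [hf] using e.top
  · simpa [hf] using e.blk
  · simpa [hf] using e.disc
  · simpa [hf] using e.clock_le
  · simpa [hf] using e.disc_new
  · simpa [hf] using e.sp_le
  · simpa [hf] using e.stk
  · rw [Mem.write_apply_zero, if_neg, e.low x hx]
    rintro rfl
    exact hx h₀.disc

/-- The search from a child has finished, and the child remains in the same cluster as `u` and its
parent. -/
theorem keep (h : SearchState G U n Γ u m₀ N m) (h₀ : SearchStart G U n Γ u m₀) (huw : G.Adj u w)
    (hw : m .disc w 0 = 0) (h' : SearchState G U n (insert u Γ) w m {y | G.Adj w y} m')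
    (hlow : m' .low w 0 < m₀ .clock 0 0 + 1) :
    SearchState G U n Γ u m₀ (insert w N)
      (m'.write .low u 0 (min (m' .low u 0) (m' .low w 0))) := by
  have hlu := low_child_eq h h'
  have hE := extends_write_low h h₀ h' (min (m' .low u 0) (m' .low w 0))
  set m₁ := m'.write .low u 0 (min (m' .low u 0) (m' .low w 0)) with hm₁
  have hf : ∀ a, a ≠ .low → m₁ a = m' a := fun a ha => Mem.write_of_ne _ ha ..
  have hdisc : m₁ .disc = m' .disc := hf _ (by simp)
  have hs : stackFrom m₁ (m₀ .sp 0 0) =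
      stackFrom m (m₀ .sp 0 0) ∪ stackFrom m' (m .sp 0 0) := by
    rw [stackFrom_congr (hf _ (by simp)) (hf _ (by simp)), stackFrom_child_prefix h h']
  have hlow₁ : m₁ .low u 0 = min (m .low u 0) (m' .low w 0) := by simp [hm₁, Mem.write, hlu]
  have hdu := disc_child_eq h h'
  have hdΓ : ∀ a ∈ Γ, m' .disc a 0 = m .disc a 0 := fun a ha =>
    h'.ext.disc a (h.ext.disc_ne_zero (h₀.active a ha))
  -- The value `low w` is below the discovery time of `u`, so it is neither that of `w` nor that of
  -- `u`; it must come from an edge to a proper ancestor.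
  have hexit : ∃ z ∈ stackFrom m' (m .sp 0 0), ∃ a ∈ Γ, G.Adj z a ∧ m' .disc a 0 = m' .low w 0 := by
    have hmc : m₀ .clock 0 0 ≤ m .clock 0 0 := h.ext.clock_le
    obtain h₁ | ⟨z, hz, a, rfl | ha, hza, had⟩ := h'.low_eq
    · omega
    · omega
    · exact ⟨z, hz, a, ha, hza, had⟩
  refine ⟨h'.inv.write_low _, hE, ?_, ?_, ?_, ?_, ?_, ?_, ?_, ?_, ?_⟩
  · rw [hdisc, hdu]
  · rw [hf .sp (by simp)]; exact h.sp_lt.trans h'.sp_lt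
  · rw [hs]
    intro x hx
    rcases Finset.mem_union.1 hx with hx | hx
    · exact h.new x hx
    · by_contra hx₀
      exact h.ext.disc_ne_zero hx₀ (h'.new x hx)
  · rw [hdisc]; exact closed_child h'
  · rw [hdisc]
    rintro y (rfl | hy)
    · rw [h'.disc]; omega
    · exact h'.ext.disc_ne_zero (h.inspected y hy)
  · rw [hs, Finset.coe_union]
    obtain ⟨z, hz, a, ha, hza, -⟩ := hexit
    exact h.seg.union h'.seg huw (disjoint_child h h') ⟨z, hz, a, ha, hza⟩
  · rw [hs, hlow₁, hdisc]
    intro z hz a ha hza hN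
    rcases Finset.mem_union.1 hz with hz | hz
    · refine (min_le_left ..).trans ?_
      rw [hdΓ a ha]
      refine h.low_le_disc z hz a ha hza fun hzu => (hN hzu).resolve_left ?_
      rintro rfl
      exact h.ext.disc_ne_zero (h₀.active a ha) hw
    · exact (min_le_right ..).trans (h'.low_le_disc z hz a (Or.inr ha) hza fun hzw => hzw ▸ hza)
  · rw [hlow₁]; exact (min_le_left ..).trans h.low_le
  · rw [hs, hlow₁, hdisc]
    rcases le_or_gt (m .low u 0) (m' .low w 0) with hle | hlt
    · rw [min_eq_left hle]
      refine h.low_eq.imp_right ?_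
      rintro ⟨z, hz, a, ha, hza, had⟩
      exact ⟨z, Finset.mem_union_left _ hz, a, ha, hza, by rw [hdΓ a ha, had]⟩
    · rw [min_eq_right hlt.le]
      obtain ⟨z, hz, a, ha, hza, had⟩ := hexit
      exact Or.inr ⟨z, Finset.mem_union_right _ hz, a, ha, hza, had⟩

/-- The search from a child has finished, and `u` together with the remaining nodes below it can
be removed as a cluster. -/
theorem staysConnected_child (h : SearchState G U n Γ u m₀ N m) (h₀ : SearchStart G U n Γ u m₀)
    (huw : G.Adj u w) (h' : SearchState G U n (insert u Γ) w m {y | G.Adj w y} m')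
    (hlow : m₀ .clock 0 0 + 1 ≤ m' .low w 0) :
    StaysConnected G (insert u (stackFrom m' (m .sp 0 0)) : Finset ℕ) := by
  rw [Finset.coe_insert]
  refine h'.seg.staysConnected_insert huw ?_ ?_
  · intro hu
    have := h'.new u (Finset.mem_coe.1 hu)
    rw [h.disc] at this
    omega
  · rintro z hz a (rfl | ha) hza
    · rfl
    -- An edge to a proper ancestor `a` would force `low w ≤ disc a < disc u`.
    · have h₁ := h'.low_le_disc z hz a (Or.inr ha) hza fun hzw => hzw ▸ hza
      have h₂ := disc_lt_of_mem h h₀ h' a ha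
      omega

/-- Once the child's segment has been removed, the stack is what it was before the child was
visited, and `low u` is unchanged because `low u ≤ disc u ≤ low w`. Hence the segment of `u` and its
exits are those of `m`; only the set of inspected neighbours has grown. -/
theorem pop (h : SearchState G U n Γ u m₀ N m) (h₀ : SearchStart G U n Γ u m₀) (huw : G.Adj u w)
    (hw : m .disc w 0 = 0) (h' : SearchState G U n (insert u Γ) w m {y | G.Adj w y} m')
    (hlow : m₀ .clock 0 0 + 1 ≤ m' .low w 0)
    (hp : PopsCluster n u (m .sp 0 0) (m'.write .low u 0 (min (m' .low u 0) (m' .low w 0))) m'') :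
    SearchState G U n Γ u m₀ (insert w N) m'' := by
  have hlu := low_child_eq h h'
  have hE := extends_write_low h h₀ h' (min (m' .low u 0) (m' .low w 0))
  have hinv := h'.inv.write_low (u := u) (min (m' .low u 0) (m' .low w 0))
  set m₁ := m'.write .low u 0 (min (m' .low u 0) (m' .low w 0)) with hm₁
  have hf : ∀ a, a ≠ .low → m₁ a = m' a := fun a ha => Mem.write_of_ne _ ha ..
  have hdisc₁ : m₁ .disc = m' .disc := hf _ (by simp)
  have hs₁ : ∀ s, stackFrom m₁ s = stackFrom m' s := fun s =>
    stackFrom_congr (hf _ (by simp)) (hf _ (by simp))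
  have hdisc : m'' .disc = m' .disc := by rw [hp.frame _ rfl, hdisc₁]
  have hsp : m'' .sp 0 0 = m .sp 0 0 := hp.sp
  have hstk : m'' .stk = m' .stk := by rw [hp.frame _ rfl, hf _ (by simp)]
  have hdu := disc_child_eq h h'
  have hdΓ : ∀ a ∈ Γ, m' .disc a 0 = m .disc a 0 := fun a ha =>
    h'.ext.disc a (h.ext.disc_ne_zero (h₀.active a ha))
  have hlow₁ : m'' .low u 0 = m .low u 0 := by
    rw [hp.frame _ rfl, hm₁, Mem.write_apply_zero, if_pos rfl, hlu]
    exact min_eq_left (h.low_le.trans hlow)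
  have hs : stackFrom m'' (m₀ .sp 0 0) = stackFrom m (m₀ .sp 0 0) := by
    rw [stackFrom, stackFrom, hsp, hstk]
    refine Finset.image_congr fun k hk => h'.ext.stk k ?_
    simp only [Finset.coe_Ico, Set.mem_Ico] at hk
    exact hk.2
  have hu : u ∈ stackFrom m₁ 0 := by
    rw [hs₁]
    obtain ⟨k, -, hk, hku⟩ := mem_stackFrom.1 h.seg.mem
    exact mem_stackFrom.2 ⟨k, Nat.zero_le _, hk.trans h'.sp_lt, by rw [h'.ext.stk k hk, hku]⟩
  have hu' : u ∉ stackFrom m₁ (m .sp 0 0) := by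
    rw [hs₁]
    intro hu
    have := h'.new u hu
    rw [h.disc] at this
    omega
  refine ⟨?_, ?_, ?_, ?_, ?_, ?_, ?_, ?_, ?_, ?_, ?_⟩
  · refine hinv.pops hp ?_ hu hu' ?_
    · rw [hf .sp (by simp)]; exact h'.sp_lt
    · rw [hs₁]; exact staysConnected_child h h₀ huw h' hlow
  · have hnew : ∀ x, m₀ .disc x 0 ≠ 0 → x ∉ stackFrom m₁ (m .sp 0 0) := by
      intro x hx hx'
      rw [hs₁] at hx'
      exact h.ext.disc_ne_zero hx (h'.new x hx')
    refine ⟨fun a ha => ?_, ?_, fun b hb => ?_, fun x hx => ?_, ?_, ?_, ?_, ?_, fun k hk => ?_,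
      fun x hx => ?_⟩
    · rw [hp.frame a (by cases a <;> first | rfl | cases ha), hE.frame a ha]
    · rw [hp.nblk]; exact hE.nblk_le.trans (Nat.le_succ _)
    · have := hE.nblk_le
      rw [hp.top, if_neg (by omega), hE.top b hb]
    · rw [hp.blk, if_neg (hnew x hx), hE.blk x hx]
    · rw [hdisc, ← hdisc₁]; exact hE.disc
    · rw [hp.frame .clock rfl]; exact hE.clock_le
    · rw [hdisc, ← hdisc₁]; exact hE.disc_new
    · rw [hsp]; exact h.ext.sp_le
    · rw [hp.frame .stk rfl, hE.stk k hk]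
    · rw [hp.frame .low rfl, hE.low x hx]
  · rw [hdisc, hdu]
  · rw [hsp]; exact h.sp_lt
  · rw [hs]; exact h.new
  · rw [hdisc]; exact closed_child h'
  · rw [hdisc]
    rintro y (rfl | hy)
    · rw [h'.disc]; omega
    · exact h'.ext.disc_ne_zero (h.inspected y hy)
  · rw [hs]; exact h.seg
  · rw [hs, hlow₁, hdisc]
    intro z hz a ha hza hN
    rw [hdΓ a ha]
    refine h.low_le_disc z hz a ha hza fun hzu => (hN hzu).resolve_left ?_
    rintro rfl
    exact h.ext.disc_ne_zero (h₀.active a ha) hw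
  · rw [hlow₁]; exact h.low_le
  · rw [hs, hlow₁, hdisc]
    refine h.low_eq.imp_right ?_
    rintro ⟨z, hz, a, ha, hza, had⟩
    exact ⟨z, hz, a, ha, hza, by rw [hdΓ a ha, had]⟩

end SearchState

end

/-! ### The depth-first search -/

section

variable {G : SimpleGraph ℕ} {U : Finset ℕ} {n u w : ℕ} {Γ N : Set ℕ} {m₀ m m' m'' : Mem}

theorem potential_congr (h₁ : m' .disc = m .disc) (h₂ : m' .deg = m .deg) :
    potential U m' = potential U m := by
  simp only [potential, h₁, h₂]

/-- Every call discovers a node, so the number of undiscovered nodes bounds the recursion depth. The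
time is amortized: an undiscovered node holds 20 steps for its discovery and 24 for each adjacency
entry, and a node on the stack holds 8 for its removal. Discovery takes 9 steps and deposits these
8, within its 20. -/
theorem SearchStart.dfs_runs {h : ℕ} : ∀ {Γ : Set ℕ} {u : ℕ} {σ : RamState},
    SearchStart G U n Γ u σ.mem → (U.filter fun x => σ.mem .disc x 0 = 0).card ≤ h →
    Runs (dfs h n u) σ fun _ σ' => SearchState G U n Γ u σ.mem {y | G.Adj u y} σ'.mem ∧
      σ'.time + 8 * σ'.mem .sp 0 0 + potential U σ'.mem ≤
        σ.time + 8 * σ.mem .sp 0 0 + potential U σ.mem := by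
  induction h with
  | zero =>
    intro Γ u σ h₀ hc
    have : u ∈ U.filter fun x => σ.mem .disc x 0 = 0 := by simp [h₀.mem, h₀.disc]
    rw [Finset.card_eq_zero.1 (Nat.le_zero.1 hc)] at this
    simp at this
  | succ h ih =>
  intro Γ u σ h₀ hc
  refine Runs.tick_bind <| Runs.load_bind <| Runs.store_bind <| Runs.store_bind <|
    Runs.store_bind <| Runs.load_bind <| Runs.store_bind <| Runs.store_bind <| Runs.load_bind ?_
  dsimp only
  generalize hm₁ : ((((((σ.mem.write .clock 0 0 (σ.mem .clock 0 0 + 1)).write .disc u 0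
    (σ.mem .clock 0 0 + 1)).write .low u 0 (σ.mem .clock 0 0 + 1)).write .stk _ 0 u).write
      .sp 0 0 _)) = m₁
  have hd : Discovers u σ.mem m₁ := by
    subst hm₁
    refine ⟨?_, fun x => ?_, fun x => ?_, ?_, fun k => ?_, fun a i₁ i₂ i₃ i₄ i₅ => ?_⟩
    · simp [Mem.write]
    · simp [Mem.write]
    · simp [Mem.write]
    · simp [Mem.write]
    · simp [Mem.write]
    · rw [Mem.write_of_ne _ i₄, Mem.write_of_ne _ i₅, Mem.write_of_ne _ i₃, Mem.write_of_ne _ i₂,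
        Mem.write_of_ne _ i₁]
  have hpot := hd.potential_add h₀.mem h₀.disc
  have hdeg : m₁ .deg = σ.mem .deg := hd.frame _ (by simp) (by simp) (by simp) (by simp) (by simp)
  rw [hdeg]
  set d := σ.mem .deg u 0 with hdd
  -- The terms with 24 state that the budget of the `d - k` entries not yet inspected is still
  -- available, without natural subtraction.
  refine Runs.bind <| Runs.forIn_range (fun k σ' =>
    SearchState G U n Γ u σ.mem {y | ∃ i < k, σ.mem .nbr u i = y} σ'.mem ∧
    σ'.time + 8 * σ'.mem .sp 0 0 + potential U σ'.mem + 24 * d ≤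
        σ.time + 8 * σ.mem .sp 0 0 + potential U σ.mem + 24 * k) ⟨?_, ?_⟩ ?_ ?_
  · exact (h₀.init hd).mono (by ext; simp)
  · dsimp only
    rw [hd.sp]
    omega
  · rintro k hk σ₁ ⟨h₁, h₂⟩
    have hN : {y | ∃ i < k + 1, σ.mem .nbr u i = y} =
        insert (σ.mem .nbr u k) {y | ∃ i < k, σ.mem .nbr u i = y} := by
      ext y
      simp only [Set.mem_ofPred_eq, Set.mem_insert_iff]
      constructor
      · rintro ⟨i, hi, rfl⟩
        rcases Nat.lt_succ_iff_lt_or_eq.1 hi with hi | rfl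
        exacts [Or.inr ⟨i, hi, rfl⟩, Or.inl rfl]
      · rintro (rfl | ⟨i, hi, rfl⟩)
        exacts [⟨k, by omega, rfl⟩, ⟨i, by omega, rfl⟩]
    rw [hN]
    refine Runs.tick_bind <| Runs.load_bind <| Runs.load_bind ?_
    dsimp only
    have hnbr : σ₁.mem .nbr = σ.mem .nbr := h₁.ext.frame _ rfl
    rw [hnbr]
    set w := σ.mem .nbr u k with hw
    have huw : G.Adj u w := (h₀.adj.adj_iff u h₀.mem w).2 ⟨k, hk, rfl⟩
    split_ifs with hdw
    · refine Runs.load_bind <| Runs.bind ?_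
      dsimp only
      have hstart := h₁.searchStart h₀ huw hdw
      refine (ih (σ := ⟨σ₁.mem, σ₁.time + 1 + 1 + 1 + 1⟩) hstart ?_).mono ?_
      -- The node `u` is no longer undiscovered, so depth `h` suffices for the child.
      · have hsub : U.filter (fun x => σ₁.mem .disc x 0 = 0) ⊆
            (U.filter fun x => σ.mem .disc x 0 = 0).erase u := by
          intro x hx
          simp only [Finset.mem_filter, Finset.mem_erase] at hx ⊢
          refine ⟨?_, hx.1, ?_⟩
          · rintro rfl
            rw [h₁.disc] at hx
            omega
          · by_contra hx'
            exact h₁.ext.disc_ne_zero hx' hx.2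
        have := Finset.card_le_card hsub
        rw [Finset.card_erase_of_mem (by simp [h₀.mem, h₀.disc])] at this
        dsimp only
        omega
      rintro - σ₂ ⟨h₃, h₄⟩
      dsimp only at h₃ h₄
      refine Runs.load_bind <| Runs.load_bind <| Runs.store_bind ?_
      dsimp only
      have hpot₂ := potential_congr (U := U) (m := σ₂.mem)
        (m' := σ₂.mem.write .low u 0 (min (σ₂.mem .low u 0) (σ₂.mem .low w 0)))
        (Mem.write_of_ne _ (by simp) ..) (Mem.write_of_ne _ (by simp) ..)
      have hsp₂ : (σ₂.mem.write .low u 0 (min (σ₂.mem .low u 0) (σ₂.mem .low w 0))) .sp =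
        σ₂.mem .sp := Mem.write_of_ne _ (by simp) ..
      have hlt := h₃.sp_lt
      split_ifs with hlow
      · refine Runs.bind ?_
        have hinv := h₃.inv.write_low (u := u) (min (σ₂.mem .low u 0) (σ₂.mem .low w 0))
        refine (popCluster_runs (σ := ⟨σ₂.mem.write .low u 0 (min (σ₂.mem .low u 0) (σ₂.mem .low w 0)),
          σ₂.time + 1 + 1 + 1⟩) (hinv.fresh _ le_rfl) ?_ ?_).mono ?_
        · exact hinv.stk_inj.mono Set.Ico_subset_Iio_self
        · dsimp only
          rw [stackFrom_congr (m := σ₂.mem) (Mem.write_of_ne _ (by simp) ..)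
            (Mem.write_of_ne _ (by simp) ..)]
          intro hu
          have := h₃.new u hu
          rw [h₁.disc] at this
          omega
        rintro - σ₃ ⟨h₅, h₆⟩
        dsimp only at h₅ h₆
        refine Runs.pure ⟨rfl, h₁.pop h₀ huw hdw h₃ hlow h₅, ?_⟩
        rw [hsp₂] at h₆
        rw [h₅.sp, potential_congr (h₅.frame .disc rfl) (h₅.frame .deg rfl), hpot₂]
        omega
      · refine Runs.pure ⟨rfl, h₁.keep h₀ huw hdw h₃ (by omega), ?_⟩
        dsimp only
        rw [hsp₂, hpot₂]
        omega
    · refine Runs.load_bind <| Runs.store_bind <| Runs.pure ⟨rfl, h₁.inspect h₀ huw hdw, ?_⟩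
      dsimp only
      rw [potential_congr (Mem.write_of_ne _ (by simp) ..) (Mem.write_of_ne _ (by simp) ..),
        Mem.write_of_ne _ (by simp)]
      omega
  · rintro σ₁ ⟨h₁, h₂⟩
    refine Runs.pure ⟨h₁.mono ?_, by omega⟩
    ext y
    exact h₀.adj.adj_iff u h₀.mem y

end

/-! ### Building the cluster forest -/

/-- The state between the searches in two connected components; `M` is the input. -/
structure ForestInvariant (G : SimpleGraph ℕ) (U : Finset ℕ) (n : ℕ) (M m : Mem) : Prop where
  inv : SearchInvariant G U n m
  deg : m .deg = M .deg
  nbr : m .nbr = M .nbr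
  vars : m .vars = M .vars
  sp : m .sp 0 0 = 0
  closed : ∀ x, m .disc x 0 ≠ 0 → ∀ y, G.Adj x y → m .disc y 0 ≠ 0
  root_lt : ∀ q < m .nroot 0 0, m .root q 0 < m .nblk 0 0
  blk_top_root : ∀ q < m .nroot 0 0, m .blk (m .top (m .root q 0) 0) 0 = m .root q 0
  root_inj : Set.InjOn (fun q => m .root q 0) (Set.Iio (m .nroot 0 0))

/-- `m'` arises from `m` by completing the tree with root node `r` and root cluster `b`. -/
structure CompletesTree (r b : ℕ) (m m' : Mem) : Prop where
  frame : ∀ a, a = .disc ∨ a = .clock ∨ a = .stk ∨ a = .chd ∨ a = .deg ∨ a = .nbr ∨ a = .vars →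
    m' a = m a
  sp : m' .sp 0 0 = 0
  blk : ∀ x, m' .blk x 0 = if x = r then b else m .blk x 0
  nchd_le : ∀ x, m' .nchd x 0 ≤ m .nchd x 0
  nblk_le : m .nblk 0 0 ≤ m' .nblk 0 0
  top : ∀ b < m .nblk 0 0, m' .top b 0 = m .top b 0
  lists : ∀ b < m .nblk 0 0, ∀ a, listArrays a = true → m' a b = m a b
  nroot : m' .nroot 0 0 = m .nroot 0 0 + 1
  root : ∀ q, m' .root q 0 = if q = m .nroot 0 0 then b else m .root q 0
  root_lt : b < m' .nblk 0 0
  top_root : m' .top b 0 = r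
  chd_lt : ∀ k < m' .nchd r 0, m .chd r k < b

section

variable {G : SimpleGraph ℕ} {U : Finset ℕ} {n r b : ℕ} {M m₀ m m' : Mem}

/-- Only the root node `r` is left on the stack. When it is taken off, it must satisfy `chd_lt_blk`,
which is the field `chd_lt` of `CompletesTree`. -/
theorem SearchInvariant.completesTree (h : SearchInvariant G U n m) (hc : CompletesTree r b m m')
    (hstack : stackFrom m 0 = {r})
    (hnew : ∀ b, m .nblk 0 0 ≤ b → b < m' .nblk 0 0 → ∃ X, IsClusterOf G n m' b X)
    (hfresh : ∀ b, m' .nblk 0 0 ≤ b → m' .nv b 0 = 0 ∧ m' .nc b 0 = 0) :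
    SearchInvariant G U n m' := by
  have hs : stackFrom m' 0 = ∅ := by simp [stackFrom, hc.sp]
  have hdisc : m' .disc = m .disc := hc.frame _ (by simp)
  have hchd : m' .chd = m .chd := hc.frame _ (by simp)
  have hblk : ∀ x, x ∉ stackFrom m 0 → m' .blk x 0 = m .blk x 0 := by
    intro x hx
    rw [hstack, Finset.mem_singleton] at hx
    rw [hc.blk, if_neg hx]
  refine ⟨?_, ?_, ?_, ?_, ?_, hfresh, ?_, ?_, ?_, ?_⟩
  · simpa only [hdisc] using h.disc_mem
  · simpa only [hdisc, hc.frame .clock (by simp)] using h.disc_le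
  · rw [hc.sp]; intro i hi; simp at hi
  · rw [hc.sp]; intro i hi; omega
  · intro b' hb'
    rcases lt_or_ge b' (m .nblk 0 0) with hlt | hge
    · obtain ⟨X, i₁, i₂, i₃, i₄, i₅, i₆⟩ := h.cluster b' hlt
      refine ⟨X, i₁.congr (hc.lists b' hlt), i₂, ?_, ?_, ?_, ?_⟩
      · rwa [hc.top b' hlt]
      · rwa [hdisc]
      · intro x hx
        rw [hc.top b' hlt, hs]
        exact (i₅ x hx).imp_right fun ⟨hx₁, hx₂⟩ => ⟨by simp, by rw [hblk x hx₁, hx₂]⟩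
      · obtain ⟨x, hx, hx₁, hx₂⟩ := i₆
        exact ⟨x, hx, by simp [hs], by rw [hblk x hx₁, hx₂]⟩
    · exact hnew b' hge hb'
  · intro x k hk
    rw [hchd]
    exact (h.chd_lt x k (hk.trans_le (hc.nchd_le x))).trans_le hc.nblk_le
  · intro x k hk
    rw [hchd, hc.top _ (h.chd_lt x k (hk.trans_le (hc.nchd_le x)))]
    exact h.top_chd x k (hk.trans_le (hc.nchd_le x))
  · intro x i j hij hj
    rw [hchd]
    exact h.chd_mono x i j hij (hj.trans_le (hc.nchd_le x))
  · intro x hx _ k hk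
    rw [hdisc] at hx
    rw [hchd]
    by_cases hxr : x = r
    · subst hxr
      rw [hc.blk, if_pos rfl]
      exact hc.chd_lt k hk
    · rw [hc.blk, if_neg hxr]
      exact h.chd_lt_blk x hx (by simpa [hstack] using hxr) k (hk.trans_le (hc.nchd_le x))

/-- The new root cluster differs from the earlier ones because its topmost node `r` was undiscovered
when they were built, while theirs were discovered. -/
theorem ForestInvariant.completesTree (h₀ : ForestInvariant G U n M m₀) (hr : m₀ .disc r 0 = 0)
    (h : SearchState G U n ∅ r m₀ {y | G.Adj r y} m) (hc : CompletesTree r b m m')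
    (hinv : SearchInvariant G U n m') : ForestInvariant G U n M m' := by
  have hdisc : m' .disc = m .disc := hc.frame _ (by simp)
  have hroot : ∀ q < m₀ .nroot 0 0, m .root q 0 < m₀ .nblk 0 0 := by
    rw [h.ext.frame .root rfl]; exact h₀.root_lt
  have htop : ∀ q < m₀ .nroot 0 0, m' .top (m .root q 0) 0 = m₀ .top (m .root q 0) 0 := by
    intro q hq
    rw [hc.top _ ((hroot q hq).trans_le h.ext.nblk_le), h.ext.top _ (hroot q hq)]
  have hdt : ∀ q < m₀ .nroot 0 0, m₀ .disc (m₀ .top (m .root q 0) 0) 0 ≠ 0 := by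
    intro q hq
    obtain ⟨X, hX⟩ := h₀.inv.cluster _ (hroot q hq)
    exact hX.disc _ hX.top_mem
  have hnroot : m' .nroot 0 0 = m₀ .nroot 0 0 + 1 := by rw [hc.nroot, h.ext.frame .nroot rfl]
  have hroot' : ∀ q, m' .root q 0 = if q = m₀ .nroot 0 0 then b else m .root q 0 := by
    intro q; rw [hc.root, h.ext.frame .nroot rfl]
  have hne : ∀ q < m₀ .nroot 0 0, m .root q 0 ≠ b := by
    rintro q hq rfl
    refine hdt q hq ?_
    rw [← htop q hq, hc.top_root, hr]
  refine ⟨hinv, ?_, ?_, ?_, hc.sp, ?_, ?_, ?_, ?_⟩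
  · rw [hc.frame _ (by simp), h.ext.frame _ rfl, h₀.deg]
  · rw [hc.frame _ (by simp), h.ext.frame _ rfl, h₀.nbr]
  · rw [hc.frame _ (by simp), h.ext.frame _ rfl, h₀.vars]
  · rw [hdisc]
    intro x hx
    by_cases hxr : x = r
    · subst hxr; exact h.inspected
    · exact h.closed x hx (by simpa using hxr)
  · intro q hq
    rw [hnroot] at hq
    rw [hroot']
    split_ifs with hqr
    · exact hc.root_lt
    · exact ((hroot q (by omega)).trans_le h.ext.nblk_le).trans_le hc.nblk_le
  · intro q hq
    rw [hnroot] at hq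
    rw [hroot']
    split_ifs with hqr
    · rw [hc.top_root, hc.blk, if_pos rfl]
    · have hq' : q < m₀ .nroot 0 0 := by omega
      rw [htop q hq', hc.blk, if_neg, h.ext.blk _ (hdt q hq')]
      · rw [h.ext.frame .root rfl]; exact h₀.blk_top_root q hq'
      · intro h'
        exact hdt q hq' (by rw [h', hr])
  · intro q hq q' hq' hqq
    simp only [Set.mem_Iio, hnroot] at hq hq'
    simp only [hroot'] at hqq
    split_ifs at hqq with h₁ h₂ h₂
    · omega
    · exact absurd hqq.symm (hne q' (by omega))
    · exact absurd hqq (hne q (by omega))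
    · rw [h.ext.frame .root rfl] at hqq
      exact h₀.root_inj (Set.mem_Iio.2 (by omega)) (Set.mem_Iio.2 (by omega)) hqq

theorem ForestInvariant.buildTree_runs {h : ℕ} {σ : RamState}
    (h₀ : ForestInvariant G U n M σ.mem) (hadj : IsAdjacencyList G U M) (hU : U.card ≤ h)
    (hr : r ∈ U) (hdr : σ.mem .disc r 0 = 0) :
    Runs (buildTree h n r) σ fun _ σ' => ForestInvariant G U n M σ'.mem ∧
      σ'.time + potential U σ'.mem ≤ σ.time + potential U σ.mem + 20 := by
  have hstart : SearchStart G U n ∅ r σ.mem := ⟨h₀.inv, hadj.congr h₀.deg h₀.nbr, hr, hdr,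
    by simp, fun x hx _ => h₀.closed x hx⟩
  refine Runs.tick_bind <| Runs.bind <| (hstart.dfs_runs (σ := ⟨σ.mem, σ.time + 1⟩) (h := h)
    ((Finset.card_filter_le ..).trans hU)).mono ?_
  rintro - σ₁ ⟨h₁, h₂⟩
  dsimp only at h₁ h₂
  rw [h₀.sp] at h₂
  -- There are no active nodes above `r`, so its segment has no exits and is trivial.
  have hstack : stackFrom σ₁.mem 0 = {r} := by
    have := h₁.seg.eq_singleton
    rw [h₀.sp] at this
    exact_mod_cast this
  have hsp := h₁.sp_lt
  rw [h₀.sp] at hsp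
  refine Runs.store_bind <| Runs.load_bind <| Runs.store_bind <| Runs.store_bind <|
    Runs.load_bind ?_
  dsimp only
  have hq : (σ₁.mem.write .sp 0 0 0) .nroot 0 0 = σ₁.mem .nroot 0 0 := by
    rw [Mem.write_of_ne _ (by simp)]
  rw [hq]
  set q := σ₁.mem .nroot 0 0 with hq
  generalize hm₂ : ((σ₁.mem.write .sp 0 0 0).write .nroot 0 0 (q + 1)).write .loc r 0 0 = m₂
  have hf₂ : ∀ a, a ≠ .sp → a ≠ .nroot → a ≠ .loc → m₂ a = σ₁.mem a := by
    intro a i₁ i₂ i₃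
    rw [← hm₂, Mem.write_of_ne _ i₃, Mem.write_of_ne _ i₂, Mem.write_of_ne _ i₁]
  have hsp₂ : m₂ .sp 0 0 = 0 := by simp [← hm₂, Mem.write]
  have hnroot₂ : m₂ .nroot 0 0 = q + 1 := by simp [← hm₂, Mem.write]
  rw [hf₂ .nchd (by simp) (by simp) (by simp)]
  have hblk₂ : m₂ .blk = σ₁.mem .blk := hf₂ _ (by simp) (by simp) (by simp)
  have hroot₂ : m₂ .root = σ₁.mem .root := hf₂ _ (by simp) (by simp) (by simp)
  have hnblk₂ : m₂ .nblk = σ₁.mem .nblk := hf₂ _ (by simp) (by simp) (by simp)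
  have htop₂ : m₂ .top = σ₁.mem .top := hf₂ _ (by simp) (by simp) (by simp)
  have hnchd₂ : m₂ .nchd = σ₁.mem .nchd := hf₂ _ (by simp) (by simp) (by simp)
  have hchd₂ : m₂ .chd = σ₁.mem .chd := hf₂ _ (by simp) (by simp) (by simp)
  split_ifs with hc
  -- No child cluster was created at `r`; the singleton `{r}` trivially stays connected.
  · refine Runs.bind ?_
    refine (newCluster_runs (σ := ⟨m₂, σ₁.time + 1 + 1 + 1 + 1 + 1⟩) ?_).mono ?_
    · dsimp only
      rw [hnblk₂, hf₂ .nv (by simp) (by simp) (by simp), hf₂ .nc (by simp) (by simp) (by simp)]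
      exact h₁.inv.fresh _ le_rfl
    rintro b' σ₂ ⟨rfl, h₃, h₄, h₅⟩
    dsimp only at h₃ h₄ h₅
    have hblk₃ : σ₂.mem .blk = σ₁.mem .blk := by rw [h₄ .blk rfl (by simp) (by simp), hblk₂]
    have hroot₃ : σ₂.mem .root = σ₁.mem .root := by rw [h₄ .root rfl (by simp) (by simp), hroot₂]
    refine Runs.store_bind <| Runs.store ?_
    dsimp only
    obtain ⟨h₆, h₇, h₈, h₉⟩ := h₃
    rw [hnblk₂] at h₆ h₇ h₈ h₉ ⊢
    rw [htop₂] at h₇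
    set b' := σ₁.mem .nblk 0 0 with hb'
    generalize hm₃ : (σ₂.mem.write .blk r 0 b').write .root q 0 b' = m₃
    have hf₃ : ∀ a, a ≠ .blk → a ≠ .root → m₃ a = σ₂.mem a := fun a i₁ i₂ => by
      rw [← hm₃, Mem.write_of_ne _ i₂, Mem.write_of_ne _ i₁]
    have hblk : ∀ x, m₃ .blk x 0 = if x = r then b' else σ₁.mem .blk x 0 := fun x => by
      rw [← hm₃, Mem.write_of_ne _ (by simp), Mem.write_apply_zero, hblk₃]
    have hf : ∀ a, listArrays a = false → a ≠ .blk → a ≠ .root → a ≠ .nblk → a ≠ .top →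
        a ≠ .sp → a ≠ .nroot → a ≠ .loc → m₃ a = σ₁.mem a :=
      fun a i₀ i₁ i₂ i₃ i₄ i₅ i₆ i₇ => by
        rw [hf₃ a i₁ i₂, h₄ a i₀ i₃ i₄, hf₂ a i₅ i₆ i₇]
    have hl : ∀ a, listArrays a = true → m₃ a = σ₂.mem a := fun a ha => by
      rw [hf₃] <;> (rintro rfl; simp [listArrays] at ha)
    have htop : ∀ b, m₃ .top b 0 = if b = b' then r else σ₁.mem .top b 0 := fun b => by
      rw [hf₃ _ (by simp) (by simp), h₇]
    have hnblk : m₃ .nblk 0 0 = b' + 1 := by rw [hf₃ _ (by simp) (by simp), h₆]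
    have hnchd : m₃ .nchd = σ₁.mem .nchd := hf _ rfl (by simp) (by simp) (by simp) (by simp)
      (by simp) (by simp) (by simp)
    have hlist : ∀ b ≠ b', ∀ a, listArrays a = true → m₃ a b = σ₁.mem a b := fun b hb a ha => by
      rw [hl a ha, h₉ b hb a ha, hf₂] <;> (rintro rfl; simp [listArrays] at ha)
    have hcomp : CompletesTree r b' σ₁.mem m₃ := by
      refine ⟨?_, ?_, hblk, ?_, ?_, ?_, ?_, ?_, ?_, ?_, ?_, ?_⟩
      · rintro a (rfl | rfl | rfl | rfl | rfl | rfl | rfl) <;> exact hf _ rfl (by simp) (by simp)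
          (by simp) (by simp) (by simp) (by simp) (by simp)
      · rw [hf₃ _ (by simp) (by simp), h₄ _ rfl (by simp) (by simp), hsp₂]
      · simp [hnchd]
      · omega
      · intro b hb
        rw [htop, if_neg hb.ne]
      · exact fun b hb => hlist b hb.ne
      · rw [hf₃ _ (by simp) (by simp), h₄ _ rfl (by simp) (by simp), hnroot₂]
      · intro q'
        rw [← hm₃, Mem.write_apply_zero, Mem.write_of_ne _ (by simp), hroot₃]
      · omega
      · rw [htop, if_pos rfl]
      · rw [hnchd, hc]; intro k hk; omega
    have hdr' : m₃ .disc r 0 ≠ 0 := by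
      rw [hcomp.frame _ (by simp), h₁.disc]; omega
    refine ⟨h₀.completesTree hdr h₁ hcomp (h₁.inv.completesTree hcomp hstack ?_ ?_), ?_⟩
    · intro b hb hb'
      obtain rfl : b = b' := by omega
      have hempty : stackFrom m₃ 0 = ∅ := by simp [stackFrom, hcomp.sp]
      refine ⟨{r}, h₈.congr fun a ha => by rw [hl a ha], ?_, ?_, ?_, ?_, ?_⟩
      · rw [Finset.coe_singleton]; exact staysConnected_singleton
      · rw [htop, if_pos rfl]; simp
      · simpa using hdr'
      · intro x hx
        rw [htop, if_pos rfl]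
        exact Or.inl (by simpa using hx)
      · refine ⟨r, by simp, by simp [hempty], by rw [hblk, if_pos rfl]⟩
    · intro b hb
      rw [hnblk] at hb
      rw [hlist b (by omega) _ rfl, hlist b (by omega) _ rfl]
      exact h₁.inv.fresh b (by omega)
    · rw [potential_congr (hcomp.frame _ (by simp)) (hcomp.frame _ (by simp))]
      omega
  -- The last child cluster of `r` becomes the root. By `chd_mono` it has the largest number of
  -- them, so the remaining ones are numbered below the cluster that now owns `r`.
  · refine Runs.load_bind <| Runs.store_bind <| Runs.store_bind <| Runs.store ?_
    dsimp only
    rw [hchd₂]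
    set c := σ₁.mem .nchd r 0 with hcc
    set b' := σ₁.mem .chd r (c - 1) with hb'
    generalize hm₃ : ((m₂.write .nchd r 0 (c - 1)).write .blk r 0 b').write .root q 0 b' = m₃
    have hf : ∀ a, a ≠ .blk → a ≠ .root → a ≠ .nchd → a ≠ .sp → a ≠ .nroot → a ≠ .loc →
        m₃ a = σ₁.mem a := fun a i₁ i₂ i₃ i₄ i₅ i₆ => by
      rw [← hm₃, Mem.write_of_ne _ i₂, Mem.write_of_ne _ i₁, Mem.write_of_ne _ i₃, hf₂ a i₄ i₅ i₆]
    have hblk : ∀ x, m₃ .blk x 0 = if x = r then b' else σ₁.mem .blk x 0 := fun x => by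
      rw [← hm₃, Mem.write_of_ne _ (by simp), Mem.write_apply_zero, Mem.write_of_ne _ (by simp),
        hblk₂]
    have hnchd : ∀ x, m₃ .nchd x 0 = if x = r then c - 1 else σ₁.mem .nchd x 0 := fun x => by
      rw [← hm₃, Mem.write_of_ne _ (by simp), Mem.write_of_ne _ (by simp), Mem.write_apply_zero,
        hnchd₂]
    have hl : ∀ a, listArrays a = true → m₃ a = σ₁.mem a := fun a ha => by
      rw [hf] <;> (rintro rfl; simp [listArrays] at ha)
    have htop : m₃ .top = σ₁.mem .top := hf _ (by simp) (by simp) (by simp) (by simp) (by simp)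
      (by simp)
    have hnblk : m₃ .nblk = σ₁.mem .nblk := hf _ (by simp) (by simp) (by simp) (by simp) (by simp)
      (by simp)
    have hcomp : CompletesTree r b' σ₁.mem m₃ := by
      refine ⟨?_, ?_, hblk, ?_, ?_, ?_, ?_, ?_, ?_, ?_, ?_, ?_⟩
      · rintro a (rfl | rfl | rfl | rfl | rfl | rfl | rfl) <;> exact hf _ (by simp) (by simp)
          (by simp) (by simp) (by simp) (by simp)
      · rw [← hm₃, Mem.write_of_ne _ (by simp), Mem.write_of_ne _ (by simp),
          Mem.write_of_ne _ (by simp), hsp₂]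
      · intro x
        rw [hnchd]
        split_ifs with hx
        · subst hx; omega
        · exact le_rfl
      · rw [hnblk]
      · intro b hb; rw [htop]
      · intro b hb a ha; rw [hl a ha]
      · rw [← hm₃, Mem.write_of_ne _ (by simp), Mem.write_of_ne _ (by simp),
          Mem.write_of_ne _ (by simp), hnroot₂]
      · intro q'
        rw [← hm₃, Mem.write_apply_zero, Mem.write_of_ne _ (by simp), Mem.write_of_ne _ (by simp),
          hroot₂]
      · rw [hnblk]; exact h₁.inv.chd_lt r _ (by omega)
      · rw [htop]; exact h₁.inv.top_chd r _ (by omega)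
      · rw [hnchd, if_pos rfl]
        exact fun k hk => h₁.inv.chd_mono r k (c - 1) hk (by omega)
    refine ⟨h₀.completesTree hdr h₁ hcomp (h₁.inv.completesTree hcomp hstack ?_ ?_), ?_⟩
    · intro b hb hb'
      rw [hnblk] at hb'
      omega
    · intro b hb
      rw [hl _ rfl, hl _ rfl]
      rw [hnblk] at hb
      exact h₁.inv.fresh b hb
    · rw [potential_congr (hcomp.frame _ (by simp)) (hcomp.frame _ (by simp))]
      omega

theorem ForestInvariant.buildForest_runs {h : ℕ} {σ : RamState}
    (h₀ : ForestInvariant G U n σ.mem σ.mem) (hadj : IsAdjacencyList G U σ.mem) (hU : U.card ≤ h)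
    (hvars : ∀ k < σ.mem .cnt 0 0, σ.mem .vars k 0 ∈ U) :
    Runs (buildForest h n) σ fun _ σ' => ForestInvariant G U n σ.mem σ'.mem ∧
      σ'.time ≤ σ.time + potential U σ.mem + 23 * σ.mem .cnt 0 0 + 2 := by
  refine Runs.tick_bind <| Runs.load_bind <| Runs.bind <| Runs.forIn_range
    (fun k σ' => ForestInvariant G U n σ.mem σ'.mem ∧
      σ'.time + potential U σ'.mem ≤ σ.time + potential U σ.mem + 23 * k + 2) ⟨h₀, ?_⟩ ?_ ?_
  · dsimp only; omega
  · rintro k hk σ₁ ⟨h₁, h₂⟩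
    refine Runs.tick_bind <| Runs.load_bind <| Runs.load_bind ?_
    dsimp only
    rw [h₁.vars]
    split_ifs with hd
    · refine Runs.bind <| (h₁.buildTree_runs (σ := ⟨σ₁.mem, σ₁.time + 1 + 1 + 1⟩) hadj hU
        (hvars k hk) hd).mono ?_
      rintro - σ₂ ⟨h₃, h₄⟩
      dsimp only at h₄
      exact Runs.pure ⟨rfl, h₃, by omega⟩
    · exact Runs.pure ⟨rfl, h₁, by dsimp only; omega⟩
  · rintro σ₁ ⟨h₁, h₂⟩
    dsimp only at h₂
    exact Runs.pure ⟨h₁, by omega⟩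

/-- With an empty stack, `chd_lt_blk` holds for all discovered nodes, so children precede their
parents; `chd_mono` makes them distinct. -/
theorem ForestInvariant.isForest (h : ForestInvariant G U n M m) : IsForest m := by
  have hs : stackFrom m 0 = ∅ := by simp [stackFrom, h.sp]
  have hinv := h.inv
  refine ⟨?_, hinv.top_chd, ?_, ?_, ?_, ?_, h.root_lt, h.blk_top_root, h.root_inj⟩
  · intro b hb x hx hxb k hk
    obtain ⟨X, hX⟩ := hinv.cluster b hb
    have hxX : x ∈ X := by
      rcases hx with ⟨j, hj, rfl⟩ | ⟨i, hi, rfl⟩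
      exacts [(hX.list.vars.mapsTo hj).1, (hX.list.checks.mapsTo hi).1]
    rw [← hxb]
    exact hinv.chd_lt_blk x (hX.disc x hxX) (by simp [hs]) k hk
  · intro x i hi j hj hij
    by_contra hne
    rcases lt_or_gt_of_ne hne with h' | h'
    · have := hinv.chd_mono x i j h' hj; omega
    · have := hinv.chd_mono x j i h' hi; omega
  · intro b hb
    obtain ⟨X, hX⟩ := hinv.cluster b hb
    exact hX.list.vars.injOn
  · intro b hb
    obtain ⟨X, hX⟩ := hinv.cluster b hb
    exact hX.list.checks.injOn
  · intro b hb j hj i hi hji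
    obtain ⟨X, hX⟩ := hinv.cluster b hb
    have h₁ := (hX.list.vars.mapsTo hj).2
    rw [hji] at h₁
    exact (hX.list.checks.mapsTo hi).2 h₁

end

/-! ### Clusters of the residual graph -/

theorem Linked.exists_reachable {V : Type*} {G : SimpleGraph V} {f : V ↪ ℕ} {Y : Set ℕ} {x : V}
    (hx : f x ∈ Y) {b : ℕ} (h : Linked (G.map f) Y (f x) b) :
    ∃ (y : V) (hy : f y ∈ Y), f y = b ∧
      (G.induce (f ⁻¹' Y)).Reachable ⟨x, hx⟩ ⟨y, hy⟩ := by
  induction h with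
  | refl => exact ⟨x, hx, rfl, .refl _⟩
  | tail _ h ih =>
    obtain ⟨y, hy, rfl, hr⟩ := ih
    obtain ⟨hadj, -, hz⟩ := h
    obtain ⟨y', z, hyz, hy', rfl⟩ := (SimpleGraph.map_adj f G _ _).1 hadj
    obtain rfl := f.injective hy'
    refine ⟨z, hz, rfl, hr.trans (SimpleGraph.Adj.reachable ?_)⟩
    exact hyz

/-- An articulation point would have to raise the number of components above one, but deleting a
node leaves at most one. -/
theorem StaysConnected.biconnected {V : Type*} [Finite V] {G : SimpleGraph V} {f : V ↪ ℕ}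
    {X : Set ℕ} (h : StaysConnected (G.map f) X) (hX : (f ⁻¹' X).Nonempty) :
    (G.induce (f ⁻¹' X)).Connected ∧
      ∀ v : f ⁻¹' X, ¬ IsArticulationPoint (G.induce (f ⁻¹' X)) v := by
  have key : ∀ v, ∀ x y : V, ∀ (hx : f x ∈ X \ {v}) (hy : f y ∈ X \ {v}),
      (G.induce (f ⁻¹' (X \ {v}))).Reachable ⟨x, hx⟩ ⟨y, hy⟩ := by
    intro v x y hx hy
    obtain ⟨y', hy', hyy, hr⟩ := (h v _ hx _ hy).exists_reachable hx
    obtain rfl := f.injective hyy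
    exact hr
  have hconn : (G.induce (f ⁻¹' X)).Connected := by
    obtain ⟨x₀, hx₀⟩ := hX
    -- Removing a number that belongs to no node gives the connectedness of the whole set.
    obtain ⟨v, hv⟩ := (Set.finite_range f).exists_notMem
    have hne : ∀ x : V, f x ≠ v := fun x hx => hv ⟨x, hx⟩
    refine { preconnected := ?_, nonempty := ⟨⟨x₀, hx₀⟩⟩ }
    rintro ⟨x, hx⟩ ⟨y, hy⟩
    have := key v x y ⟨hx, hne x⟩ ⟨hy, hne y⟩
    exact this.map (SimpleGraph.induceHomOfLE G (Set.preimage_mono Set.sdiff_subset)).toHom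
  refine ⟨hconn, fun v => not_lt_of_ge ?_⟩
  have h₁ : 1 ≤ numComponents (G.induce (f ⁻¹' X)) := by
    have := hconn.nonempty
    exact Nat.card_pos
  refine le_trans ?_ h₁
  refine Finite.card_le_one_iff_subsingleton.2 ?_
  refine SimpleGraph.Preconnected.subsingleton_connectedComponent ?_
  rintro ⟨⟨x, hx⟩, hxv⟩ ⟨⟨y, hy⟩, hyv⟩
  have hne : ∀ (x : V) (hx : x ∈ f ⁻¹' X), (⟨x, hx⟩ : f ⁻¹' X) ≠ v → f x ∈ X \ {f v} := by
    intro x hx hxv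
    exact ⟨hx, fun h => hxv (Subtype.ext (f.injective h))⟩
  have := key (f v) x y (hne x hx hxv) (hne y hy hyv)
  refine this.map (G' := (G.induce (f ⁻¹' X)).induce {w | w ≠ v})
    ⟨fun z => ⟨⟨z.1, z.2.1⟩, fun h => z.2.2 (congrArg (fun w : f ⁻¹' X => f w.1) h)⟩, fun h => h⟩

/-- In a finite graph a biconnected set extends to a maximal one. Only this inclusion is used;
equality is not. -/
theorem StaysConnected.exists_cluster {V : Type*} [Finite V] {G : SimpleGraph V} {f : V ↪ ℕ}
    {X : Set ℕ} (h : StaysConnected (G.map f) X) (hX : (f ⁻¹' X).Nonempty) :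
    ∃ B, IsCluster G B ∧ f ⁻¹' X ⊆ B := by
  obtain ⟨B, hB, hmax⟩ := Set.Finite.exists_le_maximal (Set.toFinite {A : Set V |
    (G.induce A).Connected ∧ ∀ v : A, ¬ IsArticulationPoint (G.induce A) v}) (h.biconnected hX)
  exact ⟨B, hmax, hB⟩

/-! ### Counting -/

theorem eliminationWork_le (R C : ℕ) :
    eliminationWork R C ≤ 8 * (R * C * min R C) + R + C + 1 := by
  unfold eliminationWork
  rcases Nat.eq_zero_or_pos R with rfl | hR
  · simp
  rcases Nat.eq_zero_or_pos C with rfl | hC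
  · simp
  have h₁ : R + 1 ≤ 2 * R := by omega
  have h₂ : C + 1 ≤ 2 * C := by omega
  have h₃ : min R C + 1 ≤ 2 * min R C := by omega
  calc (R + 1) * (C + 1) * (min R C + 1) ≤ 2 * R * (2 * C) * (2 * min R C) := by gcongr
    _ = 8 * (R * C * min R C) := by ring
    _ ≤ _ := by omega

/-- An extra row at most doubles `r` and the minimum, unless `r = 0`; then there is at most one row,
and the cost is linear in `c`. -/
theorem mul_mul_min_le {R C r c : ℕ} (h : R ≤ r + 1 ∧ C ≤ c) :
    R * C * min R C ≤ 4 * (r * c * min r c) + c := by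
  obtain ⟨hR, hC⟩ := h
  rcases Nat.eq_zero_or_pos r with rfl | hr
  · have h₁ : min R C ≤ 1 := by omega
    have h₂ : R ≤ 1 := by omega
    calc R * C * min R C ≤ 1 * c * 1 := by gcongr
      _ ≤ _ := by omega
  · have h₁ : R ≤ 2 * r := by omega
    have h₂ : min R C ≤ 2 * min r c := by omega
    calc R * C * min R C ≤ (2 * r) * c * (2 * min r c) := by gcongr
      _ = 4 * (r * c * min r c) := by ring
      _ ≤ _ := by omega

/-- The topmost node is either a check or a variable, so only one of the two numbers exceeds the
owned one. Here 32 = 8 · 4, and 11 collects 8 from the extra line and 3 from `R + C + 1 ≤ r + c +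
2`, as something is owned. -/
theorem eliminationWork_le_of_own {R C r c : ℕ} (h : R ≤ r + 1 ∧ C ≤ c ∨ R ≤ r ∧ C ≤ c + 1)
    (hrc : 1 ≤ r + c) :
    eliminationWork R C ≤ 32 * (c * r * min c r) + 11 * (r + c) := by
  have h₁ := eliminationWork_le R C
  have h₂ : R * C * min R C ≤ 4 * (c * r * min c r) + (r + c) := by
    rcases h with h | h
    · have := mul_mul_min_le h
      rw [mul_comm c r, min_comm c r]; omega
    · have := mul_mul_min_le h.symm
      rw [mul_comm R C, min_comm R C]; omega
  have h₃ : R + C ≤ r + c + 1 := by omega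
  omega

/-- The function `p q min (p, q)` is superadditive. -/
theorem sum_mul_mul_min_le {ι : Type*} [DecidableEq ι] {N : ℕ} {t : Finset ι} {κ : ℕ → ι}
    (hκ : ∀ b < N, κ b ∈ t) {p q : ℕ → ℕ} {P Q : ι → ℕ}
    (hp : ∀ B ∈ t, ∑ b ∈ Finset.range N with κ b = B, p b ≤ P B)
    (hq : ∀ B ∈ t, ∑ b ∈ Finset.range N with κ b = B, q b ≤ Q B) :
    ∑ b ∈ Finset.range N, p b * q b * min (p b) (q b) ≤
      ∑ B ∈ t, P B * Q B * min (P B) (Q B) := by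
  rw [← Finset.sum_fiberwise_of_maps_to (g := κ) (t := t) fun b hb => hκ b (Finset.mem_range.1 hb)]
  refine Finset.sum_le_sum fun B hB => ?_
  -- Two of the three factors are replaced by those of `B`; only `p` has to be summed.
  calc ∑ b ∈ Finset.range N with κ b = B, p b * q b * min (p b) (q b)
      ≤ ∑ b ∈ Finset.range N with κ b = B, p b * (Q B * min (P B) (Q B)) := by
        refine Finset.sum_le_sum fun b hb => ?_
        have h₁ : p b ≤ P B := (Finset.single_le_sum (fun _ _ => Nat.zero_le _) hb).trans (hp B hB)
        have h₂ : q b ≤ Q B := (Finset.single_le_sum (fun _ _ => Nat.zero_le _) hb).trans (hq B hB)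
        rw [mul_assoc]
        gcongr
    _ = (∑ b ∈ Finset.range N with κ b = B, p b) * (Q B * min (P B) (Q B)) := by
        rw [Finset.sum_mul]
    _ ≤ P B * (Q B * min (P B) (Q B)) := Nat.mul_le_mul_right _ (hp B hB)
    _ = _ := by ring

/-! ### The work on all clusters -/

section

variable {G : SimpleGraph ℕ} {U : Finset ℕ} {n b : ℕ} {M m : Mem} {X : Finset ℕ}

theorem IsNodeList.sum_vars (h : IsNodeList n m b X) (f : ℕ → ℕ) :
    ∑ j ∈ Finset.range (m .nv b 0), f (m .cvar b j) = ∑ x ∈ X with x < n, f x := by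
  refine Finset.sum_nbij (m .cvar b) (fun j hj => ?_) ?_ ?_ fun _ _ => rfl
  · simpa using h.vars.mapsTo (by simpa using hj)
  · simpa using h.vars.injOn
  · intro x hx
    simpa using h.vars.surjOn (by simpa using hx)

theorem IsNodeList.sum_checks (h : IsNodeList n m b X) (f : ℕ → ℕ) :
    ∑ j ∈ Finset.range (m .nc b 0), f (m .cchk b j) = ∑ x ∈ X with ¬ x < n, f x := by
  refine Finset.sum_nbij (m .cchk b) (fun j hj => ?_) ?_ ?_ fun _ _ => rfl
  · simpa using h.checks.mapsTo (by simpa using hj)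
  · simpa using h.checks.injOn
  · intro x hx
    simpa using h.checks.surjOn (by simpa using hx)

theorem IsNodeList.nv_eq (h : IsNodeList n m b X) : m .nv b 0 = (X.filter (· < n)).card := by
  simpa using h.sum_vars fun _ => 1

theorem IsNodeList.nc_eq (h : IsNodeList n m b X) : m .nc b 0 = (X.filter (¬ · < n)).card := by
  simpa using h.sum_checks fun _ => 1

/-- Every cluster of the forest lies in a set `nodes B`, and the work on all clusters is bounded in
terms of these sets. -/
theorem ForestInvariant.sum_clusterWork_le (h : ForestInvariant G U n M m) {ι : Type*}
    [DecidableEq ι] {t : Finset ι} {nodes : ι → Finset ℕ}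
    (hnodes : ∀ X : Finset ℕ, StaysConnected G X → X ⊆ U → X.Nonempty → ∃ B ∈ t, X ⊆ nodes B) :
    m .nblk 0 0 ≤ U.card ∧ ∑ b ∈ Finset.range (m .nblk 0 0), clusterWork m b ≤
      300 * (32 * ∑ B ∈ t, ((nodes B).filter (· < n)).card * ((nodes B).filter (¬ · < n)).card *
        min ((nodes B).filter (· < n)).card ((nodes B).filter (¬ · < n)).card +
          11 * U.card + 2 * ∑ x ∈ U, m .deg x 0) := by
  set N := m .nblk 0 0 with hN
  have hs : stackFrom m 0 = ∅ := by simp [stackFrom, h.sp]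
  have hX : ∀ b < N, ∃ X B, IsClusterOf G n m b X ∧ B ∈ t ∧ X ⊆ nodes B := by
    intro b hb
    obtain ⟨X, hX⟩ := h.inv.cluster b hb
    obtain ⟨B, hB, hXB⟩ := hnodes X hX.connected (fun x hx => h.inv.disc_mem x (hX.disc x hx))
      ⟨_, hX.top_mem⟩
    exact ⟨X, B, hX, hB, hXB⟩
  -- The empty forest is set aside because `choose!` needs an inhabited `ι`.
  rcases Nat.eq_zero_or_pos N with h0 | hpos
  · simp [h0]
  obtain ⟨-, B₀, -⟩ := hX 0 hpos
  have : Nonempty ι := ⟨B₀⟩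
  choose! X κ hX hκ hXκ using hX
  -- A cluster is charged only for the nodes it owns. Owned sets are disjoint since `blk` is a
  -- function, and they omit at most the topmost node.
  set own : ℕ → Finset ℕ := fun b => (X b).filter fun x => m .blk x 0 = b with hown
  have hownX : ∀ b, own b ⊆ X b := fun b => Finset.filter_subset ..
  have hownU : ∀ b < N, own b ⊆ U := fun b hb x hx =>
    h.inv.disc_mem x ((hX b hb).disc x (hownX b hx))
  have hdisj : ∀ s : Set ℕ, s.PairwiseDisjoint own := by
    intro s b _ b' _ hbb
    refine Finset.disjoint_left.2 fun x hx hx' => hbb ?_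
    rw [← (Finset.mem_filter.1 hx).2, (Finset.mem_filter.1 hx').2]
  have hsum : ∀ f : ℕ → ℕ, ∑ b ∈ Finset.range N, ∑ x ∈ own b, f x ≤ ∑ x ∈ U, f x := by
    intro f
    rw [← Finset.sum_biUnion (hdisj _)]
    refine Finset.sum_le_sum_of_subset fun x hx => ?_
    obtain ⟨b, hb, hx⟩ := Finset.mem_biUnion.1 hx
    exact hownU b (Finset.mem_range.1 hb) hx
  have hfiber : ∀ (p : ℕ → Prop) [DecidablePred p], ∀ B ∈ t,
      ∑ b ∈ Finset.range N with κ b = B, ((own b).filter p).card ≤ ((nodes B).filter p).card := by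
    intro p _ B _
    rw [← Finset.card_biUnion fun b hb b' hb' hne =>
      Finset.disjoint_filter_filter (hdisj Set.univ (Set.mem_univ b) (Set.mem_univ b') hne)]
    refine Finset.card_le_card fun x hx => ?_
    obtain ⟨b, hb, hx⟩ := Finset.mem_biUnion.1 hx
    rw [Finset.mem_filter, Finset.mem_range] at hb
    rw [Finset.mem_filter] at hx ⊢
    exact ⟨hb.2 ▸ hXκ b hb.1 (hownX b hx.1), hx.2⟩
  have hcard : ∀ b, ((own b).filter (· < n)).card + ((own b).filter (¬ · < n)).card =
      (own b).card := fun b => Finset.card_filter_add_card_filter_not _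
  have hownpos : ∀ b < N, 1 ≤ (own b).card := by
    intro b hb
    obtain ⟨x, hx, -, hxb⟩ := (hX b hb).nonempty
    exact Finset.card_pos.2 ⟨x, Finset.mem_filter.2 ⟨hx, hxb⟩⟩
  have hmem_own : ∀ b < N, ∀ x ∈ X b, x ≠ m .top b 0 → x ∈ own b := fun b hb x hx hxt =>
    Finset.mem_filter.2 ⟨hx, (((hX b hb).eq_top_or x hx).resolve_left hxt).2⟩
  have hcardX : ∀ b < N, ∀ (p : ℕ → Prop) [DecidablePred p],
      ((X b).filter p).card ≤ ((own b).filter p).card + 1 ∧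
      (¬ p (m .top b 0) → ((X b).filter p).card ≤ ((own b).filter p).card) := by
    intro b hb p _
    refine ⟨?_, fun hp => ?_⟩
    · refine le_trans (Finset.card_le_card fun x hx => ?_)
        (Finset.card_insert_le (m .top b 0) ((own b).filter p))
      rw [Finset.mem_filter] at hx
      rw [Finset.mem_insert, Finset.mem_filter]
      by_cases hxt : x = m .top b 0
      exacts [Or.inl hxt, Or.inr ⟨hmem_own b hb x hx.1 hxt, hx.2⟩]
    · refine Finset.card_le_card fun x hx => ?_
      rw [Finset.mem_filter] at hx ⊢
      exact ⟨hmem_own b hb x hx.1 (by rintro rfl; exact hp hx.2), hx.2⟩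
  have hUcard : ∑ b ∈ Finset.range N, (own b).card ≤ U.card := by
    simpa using hsum fun _ => 1
  refine ⟨?_, ?_⟩
  · calc N = ∑ b ∈ Finset.range N, 1 := by simp
      _ ≤ ∑ b ∈ Finset.range N, (own b).card :=
        Finset.sum_le_sum fun b hb => hownpos b (Finset.mem_range.1 hb)
      _ ≤ _ := hUcard
  · have hwork : ∀ b ∈ Finset.range N, clusterWork m b ≤ 300 * (32 *
        (((own b).filter (· < n)).card * ((own b).filter (¬ · < n)).card *
          min ((own b).filter (· < n)).card ((own b).filter (¬ · < n)).card) +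
        11 * (own b).card + 2 * ∑ x ∈ own b, m .deg x 0) := by
      intro b hb
      rw [Finset.mem_range] at hb
      have hl := (hX b hb).list
      have h₁ := eliminationWork_le_of_own (R := m .nc b 0) (C := m .nv b 0)
        (r := ((own b).filter (¬ · < n)).card) (c := ((own b).filter (· < n)).card) ?_ ?_
      rotate_left
      · rw [hl.nc_eq, hl.nv_eq]
        have h₂ := hcardX b hb (· < n)
        have h₃ := hcardX b hb (¬ · < n)
        by_cases htop : m .top b 0 < n
        · exact Or.inr ⟨h₃.2 (not_not.2 htop), h₂.1⟩
        · exact Or.inl ⟨h₃.1, h₂.2 htop⟩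
      · have := hcard b
        have := hownpos b hb
        omega
      -- A topmost node owned by another cluster contributes nothing to `edgeWork`, so owned degrees
      -- suffice.
      have h₂ : clusterEdgeWork m b ≤ ∑ x ∈ own b, m .deg x 0 := by
        rw [clusterEdgeWork, hl.sum_vars, hl.sum_checks, Finset.sum_filter_add_sum_filter_not,
          hown, Finset.sum_filter]
        refine Finset.sum_le_sum fun x hx => ?_
        unfold edgeWork
        split_ifs with h₃ h₄ h₄
        · exact Nat.zero_le _
        · exact le_rfl
        · exact le_rfl
        · exact absurd (Finset.mem_filter.1 (hmem_own b hb x hx h₃)).2 h₄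
      have h₃ : contributionWork m b ≤ ∑ x ∈ own b, m .deg x 0 := by
        rw [contributionWork, hl.sum_checks fun x => if m .blk x 0 = b then m .deg x 0 else 0]
        exact (Finset.sum_le_sum_of_subset (Finset.filter_subset ..)).trans
          (Finset.sum_filter _ _).ge
      have h₄ := hcard b
      rw [clusterWork, solveWork]
      refine Nat.mul_le_mul_left _ ?_
      omega
    refine (Finset.sum_le_sum hwork).trans ?_
    rw [← Finset.mul_sum, Finset.sum_add_distrib, Finset.sum_add_distrib, ← Finset.mul_sum,
      ← Finset.mul_sum, ← Finset.mul_sum]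
    have h₁ := sum_mul_mul_min_le hκ (hfiber (· < n)) (hfiber (¬ · < n))
    have h₂ := hsum fun x => m .deg x 0
    gcongr

end

/-! ### The running time -/

section

variable {n m : ℕ} {H : Matrix (Fin m) (Fin n) (ZMod 2)} {S : Finset (Fin n)} {s' : Fin m → ZMod 2}
  {M : Mem}

theorem nodeNumber_injective : Function.Injective (nodeNumber : Fin n ⊕ Fin m → ℕ) := by
  rintro (j | i) (j' | i') h <;> simp only [nodeNumber] at h
  · rw [Fin.ext h]
  · omega
  · omega
  · rw [Fin.ext (Nat.add_left_cancel h)]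

theorem nodeNumber_lt_iff (x : Fin n ⊕ Fin m) : nodeNumber x < n ↔ ∃ j, x = .inl j := by
  rcases x with j | i <;> simp [nodeNumber]

theorem not_nodeNumber_lt_iff (x : Fin n ⊕ Fin m) : ¬ nodeNumber x < n ↔ ∃ i, x = .inr i := by
  rcases x with j | i <;> simp [nodeNumber]

/-! ### The residual graph on node numbers -/

variable (H S)

/-- The numbers of the nodes of the residual graph. -/
def residualNumber : residualNodes H S ↪ ℕ :=
  ⟨fun x => nodeNumber x.1, nodeNumber_injective.comp Subtype.val_injective⟩

/-- The residual graph on the node numbers. -/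
def numberedGraph : SimpleGraph ℕ := (residualGraph H S).map (residualNumber H S)

open Classical in
/-- The set of all node numbers of the residual graph. -/
noncomputable def numberedNodes : Finset ℕ := Finset.univ.map (residualNumber H S)

variable {H S}

theorem mem_numberedNodes {x : ℕ} : x ∈ numberedNodes H S ↔ ∃ y, residualNumber H S y = x := by
  simp [numberedNodes]

theorem IsInput.isAdjacencyList (h : IsInput H S s' M) :
    IsAdjacencyList (numberedGraph H S) (numberedNodes H S) M where
  mem x y hxy := by
    obtain ⟨a, b, -, rfl, rfl⟩ := (SimpleGraph.map_adj _ _ _ _).1 hxy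
    exact mem_numberedNodes.2 ⟨b, rfl⟩
  adj_iff x hx y := by
    obtain ⟨x, rfl⟩ := mem_numberedNodes.1 hx
    have hb := h.nbr x
    constructor
    · intro hxy
      obtain ⟨a, b, hab, ha, rfl⟩ := (SimpleGraph.map_adj _ _ _ _).1 hxy
      obtain rfl := (residualNumber H S).injective ha
      exact hb.surjOn ⟨b, hab, rfl⟩
    · rintro ⟨k, hk, rfl⟩
      obtain ⟨y, hy, hky⟩ := hb.mapsTo hk
      exact (SimpleGraph.map_adj _ _ _ _).2 ⟨x, y, hy, rfl, hky.symm⟩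

theorem IsInput.vars_mem (h : IsInput H S s' M) : ∀ k < M .cnt 0 0,
    M .vars k 0 ∈ numberedNodes H S := by
  intro k hk
  obtain ⟨j, hj, hkj⟩ := h.vars.mapsTo hk
  exact mem_numberedNodes.2 ⟨⟨.inl j, Or.inl ⟨j, hj, rfl⟩⟩, hkj.symm⟩

theorem IsInput.cnt_le (h : IsInput H S s' M) : M .cnt 0 0 ≤ n := by
  have h₁ := h.vars.injOn.ncard_image
  rw [h.vars.image_eq] at h₁
  have h₂ : (Set.Iio (M .cnt 0 0)).ncard = M .cnt 0 0 := by
    rw [← Finset.coe_Iio, Set.ncard_coe_finset, Nat.card_Iio]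
  have h₃ : {v : ℕ | ∃ j ∈ S, v = (j : ℕ)} ⊆ Set.Iio n := by
    rintro v ⟨j, -, rfl⟩
    exact j.2
  have h₄ := Set.ncard_le_ncard h₃ (Set.finite_Iio n)
  rw [← Finset.coe_Iio n, Set.ncard_coe_finset, Nat.card_Iio] at h₄
  omega

theorem IsInput.forestInvariant (h : IsInput H S s' M) :
    ForestInvariant (numberedGraph H S) (numberedNodes H S) n M M := by
  have h₀ := h.zero
  refine ⟨⟨?_, ?_, ?_, ?_, ?_, ?_, ?_, ?_, ?_, ?_⟩, rfl, rfl, rfl, ?_, ?_, ?_, ?_, ?_⟩ <;>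
    simp [h₀]

open Classical in
-- Handshake lemma for the residual graph, whose edges embed into those of the Tanner graph.
theorem IsInput.sum_deg_le (h : IsInput H S s' M) :
    ∑ x ∈ numberedNodes H S, M .deg x 0 ≤ 2 * (tannerGraph H).edgeSet.ncard := by
  have hdeg : ∀ x : residualNodes H S,
      M .deg (residualNumber H S x) 0 = (residualGraph H S).degree x := by
    intro x
    have hb := h.nbr x
    have h₁ := hb.injOn.ncard_image
    rw [hb.image_eq, ← Finset.coe_Iio, Set.ncard_coe_finset, Nat.card_Iio] at h₁
    change M .deg (nodeNumber x.1) 0 = _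
    rw [← h₁, ← SimpleGraph.card_neighborFinset_eq_degree, ← Set.ncard_coe_finset,
      SimpleGraph.coe_neighborFinset,
      ← Set.ncard_image_of_injective _ (residualNumber H S).injective]
    congr 1
    ext y
    constructor
    · rintro ⟨y', hy, rfl⟩; exact ⟨y', hy, rfl⟩
    · rintro ⟨y', hy, rfl⟩; exact ⟨y', hy, rfl⟩
  rw [numberedNodes, Finset.sum_map, Finset.sum_congr rfl fun x _ => hdeg x,
    SimpleGraph.sum_degrees_eq_twice_card_edges]
  refine Nat.mul_le_mul_left 2 ?_
  rw [← Set.ncard_coe_finset, SimpleGraph.coe_edgeFinset]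
  exact Nat.card_le_card_of_injective _
    (SimpleGraph.Embedding.induce (G := tannerGraph H) (residualNodes H S)).mapEdgeSet.injective

open Classical in
-- The number `m` of checks is not controlled by `n`, but a check in the residual graph has degree
-- at least one there, so the degree sum bounds their number.
theorem IsInput.card_numberedNodes_le (h : IsInput H S s' M) :
    (numberedNodes H S).card ≤ n + 2 * (tannerGraph H).edgeSet.ncard := by
  rw [← Finset.card_filter_add_card_filter_not (· < n)]
  refine Nat.add_le_add ?_ (le_trans ?_ h.sum_deg_le)
  · refine (Finset.card_le_card fun x hx => ?_).trans (Finset.card_range n).le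
    exact Finset.mem_range.2 (Finset.mem_filter.1 hx).2
  · rw [Finset.card_eq_sum_ones]
    refine le_trans (Finset.sum_le_sum fun x hx => ?_)
      (Finset.sum_le_sum_of_subset (Finset.filter_subset ..))
    rw [Finset.mem_filter] at hx
    obtain ⟨⟨x, hxR⟩, rfl⟩ := mem_numberedNodes.1 hx.1
    obtain ⟨i, rfl⟩ := (not_nodeNumber_lt_iff x).1 hx.2
    obtain ⟨j, -, hj⟩ | ⟨j, hj, hadj⟩ := hxR
    · cases hj
    · have : (numberedGraph H S).Adj (residualNumber H S ⟨.inr i, Or.inr ⟨j, hj, hadj⟩⟩)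
          (residualNumber H S ⟨.inl j, Or.inl ⟨j, hj, rfl⟩⟩) :=
        (SimpleGraph.map_adj _ _ _ _).2 ⟨⟨.inr i, Or.inr ⟨j, hj, hadj⟩⟩, ⟨.inl j, Or.inl ⟨j, hj, rfl⟩⟩,
          hadj.symm, rfl, rfl⟩
      obtain ⟨k, hk, -⟩ := (h.isAdjacencyList.adj_iff _ hx.1 _).1 this
      exact Nat.one_le_of_lt hk

/-! ### Clusters as sets of node numbers -/

open Classical in
/-- The numbers of the nodes of a cluster. -/
noncomputable def clusterNumbers (B : Set (residualNodes H S)) : Finset ℕ :=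
  B.toFinset.map (residualNumber H S)

theorem card_clusterNumbers_lt (B : Set (residualNodes H S)) :
    ((clusterNumbers B).filter (· < n)).card = numVars B := by
  classical
  rw [numVars, ← Set.ncard_image_of_injective _ (residualNumber H S).injective,
    ← Set.ncard_coe_finset]
  congr 1
  ext x
  simp only [clusterNumbers, Finset.coe_filter, Finset.mem_map, Set.mem_toFinset, Set.mem_ofPred_eq,
    Set.mem_image]
  constructor
  · rintro ⟨⟨y, hy, rfl⟩, hlt⟩
    exact ⟨y, ⟨hy, (nodeNumber_lt_iff _).1 hlt⟩, rfl⟩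
  · rintro ⟨y, ⟨hy, hlt⟩, rfl⟩
    exact ⟨⟨y, hy, rfl⟩, (nodeNumber_lt_iff _).2 hlt⟩

theorem card_clusterNumbers_not_lt (B : Set (residualNodes H S)) :
    ((clusterNumbers B).filter (¬ · < n)).card = numChecks B := by
  classical
  rw [numChecks, ← Set.ncard_image_of_injective _ (residualNumber H S).injective,
    ← Set.ncard_coe_finset]
  congr 1
  ext x
  simp only [clusterNumbers, Finset.coe_filter, Finset.mem_map, Set.mem_toFinset, Set.mem_ofPred_eq,
    Set.mem_image]
  constructor
  · rintro ⟨⟨y, hy, rfl⟩, hlt⟩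
    exact ⟨y, ⟨hy, (not_nodeNumber_lt_iff _).1 hlt⟩, rfl⟩
  · rintro ⟨y, ⟨hy, hlt⟩, rfl⟩
    exact ⟨⟨y, hy, rfl⟩, (not_nodeNumber_lt_iff _).2 hlt⟩

theorem exists_cluster_subset {X : Finset ℕ} (hX : StaysConnected (numberedGraph H S) X)
    (hXU : X ⊆ numberedNodes H S) (hne : X.Nonempty) :
    ∃ B ∈ clusters H S, X ⊆ clusterNumbers B := by
  have hpre : (residualNumber H S ⁻¹' X).Nonempty := by
    obtain ⟨x, hx⟩ := hne
    obtain ⟨y, rfl⟩ := mem_numberedNodes.1 (hXU hx)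
    exact ⟨y, hx⟩
  obtain ⟨B, hB, hXB⟩ := hX.exists_cluster hpre
  refine ⟨B, by simpa [clusters] using hB, fun x hx => ?_⟩
  obtain ⟨y, rfl⟩ := mem_numberedNodes.1 (hXU hx)
  have : y ∈ B := hXB hx
  simpa [clusterNumbers] using this

/-- One more than the number of nodes is enough depth for the search and for the recursions over
clusters, as there are at most as many clusters as nodes. The constants are 28800 = 3 · 300 · 32,
9920 = 3 · 300 · 11 + 20 and 1824 = 3 · 300 · 2 + 24, the last summands coming from the potential of
the search. -/
theorem IsInput.clusterDecomposition_runs (h : IsInput H S s' M) :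
    Runs (clusterDecomposition ((numberedNodes H S).card + 1) n) ⟨M, 0⟩ fun _ σ => σ.time ≤
      28800 * ∑ B ∈ clusters H S, numVars B * numChecks B * min (numVars B) (numChecks B) +
        9920 * (numberedNodes H S).card + 1824 * ∑ x ∈ numberedNodes H S, M .deg x 0 +
          23 * n + 7 := by
  classical
  refine Runs.tick_bind <| Runs.bind <| (h.forestInvariant.buildForest_runs (σ := ⟨M, 0 + 1⟩)
    h.isAdjacencyList (Nat.le_succ _) h.vars_mem).mono ?_
  rintro - σ ⟨h₁, h₂⟩
  dsimp only at h₁ h₂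
  obtain ⟨h₃, h₄⟩ := h₁.sum_clusterWork_le (t := clusters H S) (nodes := clusterNumbers)
    fun X hX hXU hne => exists_cluster_subset hX hXU hne
  simp only [card_clusterNumbers_lt, card_clusterNumbers_not_lt] at h₄
  refine (RunsWithin.stages_runsWithin (n := n) h₁.isForest (Nat.lt_succ_of_le h₃)).runs.mono ?_
  rintro - σ' ⟨-, h₅, -⟩
  rw [h₁.deg] at h₄
  have h₆ : potential (numberedNodes H S) M ≤
      20 * (numberedNodes H S).card + 24 * ∑ x ∈ numberedNodes H S, M .deg x 0 := by
    unfold potential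
    refine (Finset.sum_le_sum_of_subset (Finset.filter_subset ..)).trans ?_
    rw [Finset.sum_add_distrib, ← Finset.mul_sum]
    simp [mul_comm]
  have h₇ := h.cnt_le
  omega

end

theorem theorem1 (c : ℕ) :
    ∃ K : ℕ, ∀ (n m : ℕ) (H : Matrix (Fin m) (Fin n) (ZMod 2)), 0 < n →
      (tannerGraph H).edgeSet.ncard ≤ c * n →
      ∀ (x : Fin n → ZMod 2) (ε : Finset (Fin n)), (∀ j, x j ≠ 0 → j ∈ ε) →
      ∀ (S : Finset (Fin n)) (s' : Fin m → ZMod 2), IsPeelingResult H ε (H.mulVec x) S s' →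
      ∀ M : Mem, IsInput H S s' M →
      ∃ (h : ℕ) (σ : RamState), clusterDecomposition h n ⟨M, 0⟩ = some ((), σ) ∧
        σ.time ≤ K * (∑ B ∈ clusters H S, numVars B * numChecks B * min (numVars B) (numChecks B))
          + K * n := by
  -- With at most `n + 2cn` nodes and degree sum at most `2cn`, the linear part is at most 9950n +
  -- 23488cn; here `0 < n` absorbs the constant 7.
  refine ⟨40000 * (c + 1), fun n m H hn hE x ε _ S s' _ M hM => ?_⟩
  obtain ⟨_, σ, hσ, ht⟩ := hM.clusterDecomposition_runs
  refine ⟨_, σ, hσ, ht.trans ?_⟩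
  have h₁ := hM.sum_deg_le
  have h₂ := hM.card_numberedNodes_le
  generalize ∑ B ∈ clusters H S, numVars B * numChecks B * min (numVars B) (numChecks B) = W
  generalize ∑ x ∈ numberedNodes H S, M .deg x 0 = D at *
  generalize (numberedNodes H S).card = u at *
  generalize (tannerGraph H).edgeSet.ncard = e at *
  nlinarith [Nat.zero_le (c * W), Nat.zero_le (c * n)]
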